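/- Throughout, $A^k$ is the set of products $a_1\cdots a_k$ with all $a_i\in A$; a finite set $A$ in a group is symmetric if $A^{-1}=A$ and $K$-tripling if $|A^3|\le K|A|$; $|A\Gamma/\Gamma|$ is the number of left cosets of $\Gamma$ that meet $A$; $O_p(\Sigma)$ is the largest normal $p$-subgroup of a finite group $\Sigma$; and $\gamma_1(\Delta)=\Delta$, $\gamma_{k+1}(\Delta)=[\gamma_k(\Delta),\Delta]$. A subgroup of $\mathrm{GL}_n(\mathbf F)$ is trigonalizable if over some extension field $\mathbf E$ of $\mathbf F$ it is conjugate to a group of invertible upper-triangular matrices over $\mathbf E$. **Proposition.** For every integer $n\ge 2$ and every integer $c\ge 0$ there are integers $C,m\ge 0$, depending only on $n$ and $c$, such that the following holds. Let $\mathbf F$ be a finite field of characteristic $p$, let $K$ be a real number, let $A\subset\mathrm{GL}_n(\mathbf F)$ be a finite, nonempty, symmetric, $K$-tripling set, and let $G=\langle A\rangle$. Assume there are subgroups $P\le\Gamma\trianglelefteq G$, with $P$ characteristic in $\Gamma$, such that, with $\Sigma=\Gamma/P$, (i) $|A\Gamma/\Gamma|\le K^{c}$; (ii) $\Sigma$ is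 soluble; (iii) $P\subseteq A^6$; (iv) there is a trigonalizable subgroup $B\le\Gamma$ whose image in $\Sigma$ is all of $\Sigma$; (v) $G$, acting by conjugation, acts trivially on $\Sigma/O_p(\Sigma)$. Then there is a normal subgroup $\Delta\trianglelefteq G$ with $P\le\Delta\le\Gamma$ such that (1) $|A\Delta/\Delta|\le K^{C}$, and (2) $\gamma_n(\Delta)\subseteq A^{m}$. -/

import Mathlib

open scoped Pointwise

universe u

/-- The group `B_n(E)` of invertible upper-triangular `n × n` matrices. -/
def borelSubgroup (n : ℕ) (E : Type u) [Field E] : Subgroup (GL (Fin n) E) where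
  carrier := {g | (g : Matrix (Fin n) (Fin n) E).IsUpperTriangular}
  one_mem' := Matrix.blockTriangular_one
  mul_mem' {a b} ha hb := by
    have h := Matrix.BlockTriangular.mul (show Matrix.BlockTriangular _ id from ha)
      (show Matrix.BlockTriangular _ id from hb)
    simpa using h
  inv_mem' {a} ha := by
    have h := Matrix.blockTriangular_inv_of_blockTriangular
      (M := (a : Matrix (Fin n) (Fin n) E)) (show Matrix.BlockTriangular _ id from ha)
    simpa using h

/-- A subgroup `B ≤ GL_n(F)` is trigonalizable if, over some extension field `E` of `F`, it is
conjugate to a subgroup of `B_n(E)`. -/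
def IsTrigonalizable {n : ℕ} {F : Type u} [Field F] (B : Subgroup (GL (Fin n) F)) : Prop :=
  ∃ (E : Type u) (_ : Field E) (_ : Algebra F E) (g : GL (Fin n) E),
    (B.map (Matrix.GeneralLinearGroup.map (algebraMap F E))).map (MulAut.conj g).toMonoidHom
      ≤ borelSubgroup n E

/-- The `p`-core `O_p(S)` of a group `S`: the join of all normal `p`-subgroups of `S`. -/
def pCore (p : ℕ) (S : Type u) [Group S] : Subgroup S :=
  sSup {N | N.Normal ∧ IsPGroup p N}

instance pCore_normal (p : ℕ) (S : Type u) [Group S] : (pCore p S).Normal :=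
  Subgroup.sSup_normal _ fun _ h => h.1

/-- The `p`-core is the largest normal `p`-subgroup. -/
theorem pCore_isGreatest (p : ℕ) (S : Type u) [Group S] :
    IsGreatest {N : Subgroup S | N.Normal ∧ IsPGroup p N} (pCore p S) :=
  ⟨⟨pCore_normal p S, Sylow.sSup_of_normal _ (fun _ h => h.2) fun _ h => h.1⟩,
    fun _ h => le_sSup h⟩

/-- The section `Γ / P` of a group `L`, for subgroups `P ≤ Γ` of `L` (with `P` normal in `Γ` when
it is used as a group). -/
abbrev SectionOf {L : Type u} [Group L] (Γ P : Subgroup L) : Type u :=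
  Γ ⧸ P.subgroupOf Γ

/-- The trace `tr(A, Γ / P)`: the projection of `A ∩ Γ` to `Γ / P`. -/
def sectionTrace {L : Type u} [Group L] (A : Set L) (Γ P : Subgroup L) : Set (SectionOf Γ P) :=
  (fun x : Γ => (QuotientGroup.mk x : SectionOf Γ P)) '' {x : Γ | (x : L) ∈ A}

/-- For `G` normalizing `Γ` and `P`, and `M` a normal subgroup of `Γ / P` invariant under `G`:
the conjugation action of `G` on the quotient `(Γ / P) / M` is trivial. -/
def ActsTriviallyMod {L : Type u} [Group L] (G Γ P : Subgroup L) [(P.subgroupOf Γ).Normal]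
    (M : Subgroup (SectionOf Γ P)) : Prop :=
  ∀ g ∈ G, ∀ x y : Γ, (y : L) = g * x * g⁻¹ →
    (QuotientGroup.mk (QuotientGroup.mk y : SectionOf Γ P) : SectionOf Γ P ⧸ M) =
      QuotientGroup.mk (QuotientGroup.mk x : SectionOf Γ P)

/-- The number `|AΓ / Γ|` of left cosets of `Γ` that meet `A`. -/
noncomputable def cosetCount {L : Type u} [Group L] (A : Set L) (Γ : Subgroup L) : ℕ :=
  ((fun a : L => (QuotientGroup.mk a : L ⧸ Γ)) '' A).ncard

/-- `γ_k(D)` for `k ≥ 1`, with the indexing `γ_1(D) = D`, `γ_{k+1}(D) = [γ_k(D), D]`. -/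
def lowerCentralTerm {L : Type u} [Group L] (k : ℕ) (D : Subgroup L) : Subgroup L :=
  D.lowerCentralSeries (k - 1)

/-! Modulo `P`, which lies in `A ^ 6`, the group `Γ` is the image of a finite group of upper
triangular matrices. The unipotent part maps to a `p`-group `U` of class at most `n - 1`, and `Γ /
U` has exponent prime to `p`. By (v), commutators of `Γ` with `G` are `p`-elements modulo `P`, so
they lie in `U`: thus `Γ` is central modulo `U`. Filtering unitriangular matrices one entry at a
time gives a filtration `W` of `U` with `n ^ 2` steps; on each step an element of `Γ` acts through a
ratio of diagonal entries, hence either trivially or without fixed points.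

Let `Δ` be the common centralizer in `Γ` of a maximal set `J` of steps subject to `A` meeting few
cosets of it. By maximality `A ^ 4 ∩ Δ` meets many cosets of the centralizer of each remaining step,
so it contains a large set `T` whose pairwise quotients act without fixed points on every remaining
step. Let `D` be generated by the `p ^ n`-th powers in `Δ`, and let `S = D ∩ U`. Then `Δ = U D`, `D`
is central modulo `S`, and coprimality gives `S = [S, D]`. Hence `γ_n(Δ) ≤ γ_n(U) S = S`, and it
remains to put `S` into a bounded power of `A`. If no step remains, `S` is trivial.

The group `S` is exhausted along its lower central series, with two kinds of sections. A section
that is perfect under `D` is refined until `U` acts trivially on it. There `T` acts by endomorphisms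
commuting with `G` and having injective differences, and a sum-product pivot argument applies
(`eq_univ_of_pivot`, `covers_of_fixedPointFree`). It needs generators of the section in a bounded
power of `A`, which come from `le_of_pow_inter_le` at the top and from `le_of_covers` below it. On a
section centralized by `D`, commutators give a bilinear map; its character sums are small because
proper `D`-invariant subgroups of `S` containing `[S, S]` have index at least `|T|`
(`covers_of_bilinear`).

Constants are absorbed into powers of `K`, which requires `K` bounded away from `1`. For `K < 3 / 2`
the set `A ^ 2` is a subgroup, and `Γ ∩ A ^ 2` serves as `Δ`. -/

open scoped commutatorElement IsMulCommutative

/-! ### Character sums on finite abelian groups -/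

section Fourier

open Finset

variable {Z : Type*} [AddCommGroup Z] [Fintype Z] [DecidableEq Z]

/-- Parseval's identity for the pushforward of counting measure under `g`. -/
theorem sum_normSq_charSum {J : Type*} [Fintype J] (g : J → Z) :
    ∑ ξ : AddChar Z ℂ, ‖∑ j, ξ (g j)‖ ^ 2 =
      Fintype.card Z * #{q : J × J | g q.1 = g q.2} := by
  have key : ∀ ξ : AddChar Z ℂ,
      ((‖∑ j, ξ (g j)‖ ^ 2 : ℝ) : ℂ) = ∑ q : J × J, ξ (g q.1 - g q.2) := by
    intro ξ
    rw [← Complex.normSq_eq_norm_sq, Complex.normSq_eq_conj_mul_self, mul_comm, map_sum,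
      Finset.sum_mul_sum, ← Finset.univ_product_univ, Finset.sum_product]
    refine Finset.sum_congr rfl fun a _ => Finset.sum_congr rfl fun b _ => ?_
    rw [sub_eq_add_neg, AddChar.map_add_eq_mul, AddChar.map_neg_eq_conj]
  have : ((∑ ξ : AddChar Z ℂ, ‖∑ j, ξ (g j)‖ ^ 2 : ℝ) : ℂ) =
      ((Fintype.card Z * #{q : J × J | g q.1 = g q.2} : ℝ) : ℂ) := by
    rw [Complex.ofReal_sum]
    simp_rw [key]
    rw [Finset.sum_comm]
    simp_rw [AddChar.sum_apply_eq_ite, sub_eq_zero]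
    rw [← Finset.sum_filter, Finset.sum_const]
    simp [mul_comm]
  exact_mod_cast this

theorem sum_normSq_charSum_of_injective {J : Type*} [Fintype J] {g : J → Z}
    (hg : Function.Injective g) :
    ∑ ξ : AddChar Z ℂ, ‖∑ j, ξ (g j)‖ ^ 2 = Fintype.card Z * Fintype.card J := by
  rw [sum_normSq_charSum]
  congr 2
  have : ({q : J × J | g q.1 = g q.2} : Finset (J × J)) = Finset.univ.map
      ⟨fun j => (j, j), fun a b h => (Prod.ext_iff.1 h).1⟩ := by
    ext ⟨a, b⟩
    simp only [Finset.mem_filter, Finset.mem_univ, true_and, hg.eq_iff, Finset.mem_map]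
    constructor
    · rintro rfl
      exact ⟨a, rfl⟩
    · rintro ⟨j, hj⟩
      exact ((Prod.ext_iff.1 hj).1).symm.trans (Prod.ext_iff.1 hj).2
  rw [this, Finset.card_map, Finset.card_univ]

variable {I : Type*} [Fintype I] {Φ : I → Z} {ε : ℝ} {X : Finset Z}

/-- Expand the number of solutions in characters. The trivial character contributes `#X ^ 2 * |I|`;
the others contribute at most `ε * |I|` times `∑ ‖S ξ‖ ^ 2 = |Z| * #X`, which is smaller. Having no
solution would force the two to cancel. -/
theorem exists_sub_add_eq_of_charSum_le [Nonempty I]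
    (hΦ : ∀ ξ : AddChar Z ℂ, ξ ≠ 0 → ‖∑ i, ξ (Φ i)‖ ≤ ε * Fintype.card I)
    (hε0 : 0 ≤ ε) (hε : ε * Fintype.card Z < #X) (z : Z) :
    ∃ x ∈ X, ∃ x' ∈ X, ∃ i, x - x' + Φ i = z := by
  classical
  by_contra! hcon
  have hXpos : (0 : ℝ) < #X := lt_of_le_of_lt (by positivity) hε
  have hIpos : (0 : ℝ) < Fintype.card I := by exact_mod_cast Fintype.card_pos
  set S : AddChar Z ℂ → ℂ := fun ξ => ∑ x : X, ξ x with hS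
  have hpars : ∑ ξ, ‖S ξ‖ ^ 2 = Fintype.card Z * #X := by
    rw [← Fintype.card_coe X]
    exact sum_normSq_charSum_of_injective (g := fun x : X => (x : Z)) Subtype.val_injective
  have hzero : ∑ ξ : AddChar Z ℂ, (S ξ * (starRingEnd ℂ) (S ξ)) * (∑ i, ξ (Φ i)) * ξ (-z) = 0 := by
    have : ∀ ξ : AddChar Z ℂ, (S ξ * (starRingEnd ℂ) (S ξ)) * (∑ i, ξ (Φ i)) * ξ (-z) =
        ∑ x : X, ∑ x' : X, ∑ i, ξ (x - x' + Φ i - z) := by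
      intro ξ
      rw [hS, map_sum, Finset.sum_mul_sum, Finset.sum_mul, Finset.sum_mul]
      simp_rw [Finset.sum_mul, Finset.mul_sum, Finset.sum_mul]
      refine Finset.sum_congr rfl fun a _ => Finset.sum_congr rfl fun b _ =>
        Finset.sum_congr rfl fun i _ => ?_
      rw [sub_eq_add_neg _ z, AddChar.map_add_eq_mul, AddChar.map_add_eq_mul, sub_eq_add_neg,
        AddChar.map_add_eq_mul, AddChar.map_neg_eq_conj ξ (b : Z)]
    simp_rw [this]
    rw [Finset.sum_comm]
    refine Finset.sum_eq_zero fun a _ => ?_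
    rw [Finset.sum_comm]
    refine Finset.sum_eq_zero fun b _ => ?_
    rw [Finset.sum_comm]
    refine Finset.sum_eq_zero fun i _ => ?_
    rw [AddChar.sum_apply_eq_ite, if_neg]
    rw [sub_eq_zero]
    exact hcon a a.2 b b.2 i
  rw [← Finset.add_sum_erase _ _ (Finset.mem_univ (0 : AddChar Z ℂ))] at hzero
  have h0 : S 0 * (starRingEnd ℂ) (S 0) * (∑ i, (0 : AddChar Z ℂ) (Φ i)) * (0 : AddChar Z ℂ) (-z)
      = (((#X : ℝ) ^ 2 * Fintype.card I : ℝ) : ℂ) := by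
    simp [hS, sq]
  rw [h0] at hzero
  have hle : (#X : ℝ) ^ 2 * Fintype.card I ≤
      ∑ ξ ∈ Finset.univ.erase (0 : AddChar Z ℂ), ‖S ξ‖ ^ 2 * (ε * Fintype.card I) := by
    have h1 := congrArg norm (eq_neg_of_add_eq_zero_left hzero)
    rw [norm_neg, Complex.norm_real, Real.norm_of_nonneg (by positivity)] at h1
    rw [h1]
    refine (norm_sum_le _ _).trans (Finset.sum_le_sum fun ξ hξ => ?_)
    rw [norm_mul, norm_mul, norm_mul, AddChar.norm_apply, RCLike.norm_conj, mul_one, ← sq]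
    exact mul_le_mul_of_nonneg_left (hΦ ξ (Finset.ne_of_mem_erase hξ)) (by positivity)
  have hle2 : ∑ ξ ∈ Finset.univ.erase (0 : AddChar Z ℂ), ‖S ξ‖ ^ 2 * (ε * Fintype.card I) ≤
      (Fintype.card Z * #X) * (ε * Fintype.card I) := by
    rw [← Finset.sum_mul, ← hpars]
    refine mul_le_mul_of_nonneg_right ?_ (by positivity)
    exact Finset.sum_le_sum_of_subset_of_nonneg (Finset.erase_subset _ _)
      fun _ _ _ => by positivity
  have h3 := hle.trans hle2
  have : (ε * Fintype.card Z) * (#X * Fintype.card I) < #X * (#X * Fintype.card I) :=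
    mul_lt_mul_of_pos_right hε (by positivity)
  nlinarith

/-- Let `E` count the collisions of `(x, i) ↦ x + Φ i`. Parseval bounds `|Z| * E` from above by the
trivial character plus an error of order `ε ^ 2`. As all values lie in `W`, Cauchy-Schwarz bounds
`E` from below by `(#X * |I|) ^ 2 / #W`. -/
theorem card_le_of_charSum_le [Nonempty I]
    (hΦ : ∀ ξ : AddChar Z ℂ, ξ ≠ 0 → ‖∑ i, ξ (Φ i)‖ ≤ ε * Fintype.card I)
    (hX : X.Nonempty) {W : Finset Z} (hW : ∀ x ∈ X, ∀ i, x + Φ i ∈ W) {L : ℝ}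
    (hL : #W ≤ L * #X) :
    (Fintype.card Z : ℝ) ≤ L * (#X + ε ^ 2 * Fintype.card Z) := by
  classical
  have hXpos : (0 : ℝ) < #X := by exact_mod_cast hX.card_pos
  have hIpos : (0 : ℝ) < Fintype.card I := by exact_mod_cast Fintype.card_pos
  set S : AddChar Z ℂ → ℂ := fun ξ => ∑ x : X, ξ x with hS
  have hpars : ∑ ξ, ‖S ξ‖ ^ 2 = Fintype.card Z * #X := by
    rw [← Fintype.card_coe X]
    exact sum_normSq_charSum_of_injective (g := fun x : X => (x : Z)) Subtype.val_injective
  set g : X × I → Z := fun q => q.1 + Φ q.2 with hg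
  set E : ℕ := #{q : (X × I) × (X × I) | g q.1 = g q.2} with hE
  have hE1 : (Fintype.card Z : ℝ) * E ≤
      (#X * Fintype.card I) ^ 2 + Fintype.card Z * #X * (ε * Fintype.card I) ^ 2 := by
    rw [← sum_normSq_charSum g, ← Finset.add_sum_erase _ _ (Finset.mem_univ (0 : AddChar Z ℂ))]
    refine add_le_add (le_of_eq ?_) ?_
    · simp [Fintype.card_prod]
    · rw [← hpars, Finset.sum_mul]
      refine le_trans (Finset.sum_le_sum (g := fun ξ => ‖S ξ‖ ^ 2 * (ε * Fintype.card I) ^ 2)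
        fun ξ hξ => ?_) (Finset.sum_le_sum_of_subset_of_nonneg (Finset.erase_subset _ _)
        fun _ _ _ => by positivity)
      have : ∑ j, ξ (g j) = S ξ * ∑ i, ξ (Φ i) := by
        rw [Finset.sum_mul_sum, ← Finset.univ_product_univ, Finset.sum_product]
        simp [hg, AddChar.map_add_eq_mul]
      rw [this, norm_mul, mul_pow]
      gcongr
      exact hΦ ξ (Finset.ne_of_mem_erase hξ)
  have hE2 : ((#X : ℝ) * Fintype.card I) ^ 2 ≤ #W * E := by
    have hcard : (#X * Fintype.card I : ℕ) = ∑ w ∈ W, #{j | g j = w} := by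
      rw [← Finset.card_eq_sum_card_fiberwise (fun j _ => hW _ j.1.2 _)]
      simp
    have hEc : E = ∑ w ∈ W, #{j | g j = w} ^ 2 := by
      rw [hE, Finset.card_eq_sum_card_fiberwise (f := fun q => g q.1) (t := W)
        (fun q _ => hW _ q.1.1.2 _)]
      refine Finset.sum_congr rfl fun w _ => ?_
      rw [sq, ← Finset.card_product]
      congr 1
      ext ⟨a, b⟩
      simp only [mem_filter, mem_univ, true_and, mem_product]
      constructor
      · rintro ⟨h1, h2⟩; exact ⟨h2, h1 ▸ h2⟩
      · rintro ⟨h1, h2⟩; exact ⟨h1.trans h2.symm, h1⟩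
    have := sq_sum_le_card_mul_sum_sq (s := W) (f := fun w => (#{j | g j = w} : ℝ))
    have e1 : ((#X : ℝ) * Fintype.card I) = ∑ w ∈ W, (#{j | g j = w} : ℝ) := by
      exact_mod_cast hcard
    have e2 : (E : ℝ) = ∑ w ∈ W, (#{j | g j = w} : ℝ) ^ 2 := by exact_mod_cast hEc
    rw [e1, e2]; exact this
  have hL0 : 0 ≤ L := by
    by_contra! h
    have : (0 : ℝ) ≤ #W := by positivity
    nlinarith
  have hZ : (0 : ℝ) ≤ Fintype.card Z := by positivity
  have h3 : (Fintype.card Z : ℝ) * ((#X : ℝ) * Fintype.card I) ^ 2 ≤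
      L * #X * ((#X * Fintype.card I) ^ 2 + Fintype.card Z * #X * (ε * Fintype.card I) ^ 2) :=
    calc (Fintype.card Z : ℝ) * ((#X : ℝ) * Fintype.card I) ^ 2
        ≤ Fintype.card Z * (#W * E) := by gcongr
      _ = #W * (Fintype.card Z * E) := by ring
      _ ≤ _ := by gcongr
  have hp : (0 : ℝ) < #X ^ 2 * Fintype.card I ^ 2 := by positivity
  refine le_of_mul_le_mul_right (a := (#X : ℝ) ^ 2 * Fintype.card I ^ 2) ?_ hp
  calc _ = (Fintype.card Z : ℝ) * ((#X : ℝ) * Fintype.card I) ^ 2 := by ring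
    _ ≤ _ := h3
    _ = _ := by ring

end Fourier

/-! ### The pivot argument for commuting endomorphisms -/

section Pivot

open Finset

variable {V : Type*} [AddCommGroup V] [Fintype V] [DecidableEq V]

/-- The character sums of the family `(t, x) ↦ φ t x` are small when the differences
`φ t - φ t'` are injective. -/
theorem norm_charSum_smul_le {T : Finset (AddMonoid.End V)}
    (hT : ∀ t ∈ T, ∀ t' ∈ T, t ≠ t' → Function.Injective (t - t' : AddMonoid.End V))
    (X : Finset V) (ξ : AddChar V ℂ) (hξ : ξ ≠ 0) :
    ‖∑ q : T × X, ξ ((q.1 : AddMonoid.End V) (q.2 : V))‖ ^ 2 ≤ #T * (Fintype.card V * #X) := by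
  classical
  set S : AddChar V ℂ → ℂ := fun η => ∑ x : X, η x with hS
  have hpars : ∑ η, ‖S η‖ ^ 2 = Fintype.card V * #X := by
    rw [← Fintype.card_coe X]
    exact sum_normSq_charSum_of_injective (g := fun x : X => (x : V)) Subtype.val_injective
  -- An injective difference `t - t'` is onto by finiteness, so `ξ ∘ t = ξ ∘ t'` would make `ξ`
  -- trivial. The characters `ξ ∘ t` are therefore distinct, and Parseval bounds the sum over them.
  have hinj : Function.Injective
      (fun t : T => (ξ.compAddMonoidHom (t : V →+ V) : AddChar V ℂ)) := by
    intro t t' h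
    by_contra hne
    have hne' : (t : AddMonoid.End V) ≠ t' := fun h' => hne (Subtype.ext h')
    have hsurj := Finite.surjective_of_injective (hT t t.2 t' t'.2 hne')
    apply hξ
    ext v
    obtain ⟨w, rfl⟩ := hsurj v
    have h1 : ξ ((t : AddMonoid.End V) w) = ξ ((t' : AddMonoid.End V) w) := by
      have := DFunLike.congr_fun h w
      simpa using this
    have h2 : ((t : AddMonoid.End V) - t') w = (t : AddMonoid.End V) w - (t' : AddMonoid.End V) w :=
      rfl
    rw [h2, sub_eq_add_neg, AddChar.map_add_eq_mul, h1, ← AddChar.map_add_eq_mul]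
    simp
  have h1 : ∑ q : T × X, ξ ((q.1 : AddMonoid.End V) (q.2 : V)) =
      ∑ t : T, S (ξ.compAddMonoidHom (t : V →+ V)) := by
    rw [← Finset.univ_product_univ, Finset.sum_product]
    rfl
  rw [h1]
  calc ‖∑ t : T, S (ξ.compAddMonoidHom (t : V →+ V))‖ ^ 2
      ≤ (∑ t : T, ‖S (ξ.compAddMonoidHom (t : V →+ V))‖) ^ 2 := by
        gcongr; exact norm_sum_le _ _
    _ ≤ #T * ∑ t : T, ‖S (ξ.compAddMonoidHom (t : V →+ V))‖ ^ 2 := by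
        have := sq_sum_le_card_mul_sum_sq (s := (Finset.univ : Finset T))
          (f := fun t => ‖S (ξ.compAddMonoidHom (t : V →+ V))‖)
        simpa using this
    _ ≤ #T * ∑ η, ‖S η‖ ^ 2 := by
        gcongr
        rw [← Finset.sum_image (s := Finset.univ)
          (g := fun t : T => (ξ.compAddMonoidHom (t : V →+ V) : AddChar V ℂ))
          (f := fun η => ‖S η‖ ^ 2) (fun a _ b _ h => hinj h)]
        exact Finset.sum_le_sum_of_subset_of_nonneg (Finset.subset_univ _)
          fun _ _ _ => by positivity
    _ = _ := by rw [hpars]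

/-- A set containing `0` and stable under `y ↦ ψ y + x` is everything, if the set of all `x`
generates `V` under the group `Ψ`. -/
theorem eq_univ_of_add_mem {V : Type*} [AddCommGroup V] {Ψ : Set (AddMonoid.End V)} {X N : Set V}
    (hΨ : ∀ ψ ∈ Ψ, ∃ ψ' ∈ Ψ, ψ * ψ' = 1 ∧ ψ' * ψ = 1) (hne : Ψ.Nonempty) (hX0 : 0 ∈ X)
    (hXneg : ∀ x ∈ X, -x ∈ X)
    (hgen : ∀ N' : AddSubgroup V, (∀ ψ ∈ Ψ, ∀ v ∈ N', ψ v ∈ N') → X ⊆ N' → N' = ⊤)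
    (h0 : 0 ∈ N) (h : ∀ ψ ∈ Ψ, ∀ y ∈ N, ∀ x ∈ X, ψ y + x ∈ N) : N = Set.univ := by
  have hψN : ∀ ψ ∈ Ψ, ∀ y ∈ N, ψ y ∈ N := fun ψ hψ y hy => by
    simpa using h ψ hψ y hy 0 hX0
  have hXN : ∀ y ∈ N, ∀ x ∈ X, y + x ∈ N := fun y hy x hx => by
    obtain ⟨ψ, hψ⟩ := hne
    obtain ⟨ψ', hψ', h1, -⟩ := hΨ ψ hψ
    have := h ψ hψ (ψ' y) (hψN ψ' hψ' y hy) x hx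
    rwa [show ψ (ψ' y) = y from DFunLike.congr_fun h1 y] at this
  -- The translation stabilizer of `N`. It contains `X` and is stable under `Ψ`, so it is
  -- everything, and `0 ∈ N` finishes.
  let N' : AddSubgroup V :=
    { carrier := {v | ∀ y, y ∈ N ↔ y + v ∈ N}
      zero_mem' := by simp
      add_mem' := fun {a b} ha hb y => by rw [ha y, hb (y + a), add_assoc]
      neg_mem' := fun {a} ha y => by rw [ha (y + -a), neg_add_cancel_right] }
  have hstep : ∀ ψ ∈ Ψ, ∀ v ∈ N', ∀ y ∈ N, y + ψ v ∈ N := fun ψ hψ v hv y hy => by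
    obtain ⟨ψ', hψ', h1, -⟩ := hΨ ψ hψ
    have := hψN ψ hψ _ ((hv (ψ' y)).1 (hψN ψ' hψ' y hy))
    rwa [map_add, show ψ (ψ' y) = y from DFunLike.congr_fun h1 y] at this
  have htop : N' = ⊤ := by
    refine hgen N' (fun ψ hψ v hv y => ⟨hstep ψ hψ v hv y, fun hy => ?_⟩)
      (fun x hx y => ⟨fun hy => hXN y hy x hx, fun hy => ?_⟩)
    · simpa using hstep ψ hψ (-v) (neg_mem hv) _ hy
    · simpa using hXN _ hy _ (hXneg x hx)
  rw [Set.eq_univ_iff_forall]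
  intro v
  have hv : v ∈ N' := htop ▸ AddSubgroup.mem_top v
  simpa using (hv 0).1 h0

/-- If commuting endomorphisms `t ∈ T` have injective differences, and the sets `X j` form a
filtered approximate group with `X m` generating `V` under a family `Ψ` of endomorphisms commuting
with `T`, then a bounded `X j` is everything. -/
theorem eq_univ_of_pivot {T : Finset (AddMonoid.End V)} {Ψ : Set (AddMonoid.End V)}
    (hT : ∀ t ∈ T, ∀ t' ∈ T, t ≠ t' → Function.Injective (t - t' : AddMonoid.End V))
    (hTT : ∀ t ∈ T, ∀ t' ∈ T, Commute t t') (hTΨ : ∀ t ∈ T, ∀ ψ ∈ Ψ, Commute t ψ)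
    (X : ℕ → Finset V) (a m : ℕ) (hmono : Monotone X) (h0 : ∀ j, 0 ∈ X j)
    (hneg : ∀ j, ∀ x ∈ X j, -x ∈ X j) (hadd : ∀ i j, ∀ x ∈ X i, ∀ y ∈ X j, x + y ∈ X (i + j))
    (hTX : ∀ t ∈ T, ∀ j, ∀ x ∈ X j, t x ∈ X (j + a))
    (hΨX : ∀ ψ ∈ Ψ, ∀ j, ∀ x ∈ X j, ψ x ∈ X (j + 1))
    (hgen : ∀ N : Set V, 0 ∈ N → (∀ ψ ∈ Ψ, ∀ y ∈ N, ∀ x ∈ X m, ψ y + x ∈ N) → N = Set.univ)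
    {L : ℝ} (hL1 : 1 ≤ L) (hL : #(X (20 * (m + a + 1))) ≤ L * #(X m))
    (hTL : 64 * L ^ 6 < #T) (v : V) :
    v ∈ X (6 * m + a) := by
  classical
  -- Just more than `L` elements, enough for the pigeonhole below, but at most `2 * L`, so that
  -- pairs from `T'` cost only `4 * L ^ 2`.
  obtain ⟨T', hT'T, hT'c⟩ : ∃ T' ⊆ T, #T' = ⌊L⌋₊ + 1 := by
    apply Finset.exists_subset_card_eq
    have h1 : L ≤ L ^ 6 := le_self_pow₀ hL1 (by norm_num)
    have h2 : (⌊L⌋₊ : ℝ) ≤ L := Nat.floor_le (by linarith)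
    have : ((⌊L⌋₊ + 1 : ℕ) : ℝ) ≤ #T := by push_cast; nlinarith
    exact_mod_cast this
  have hT'L : L < #T' := by rw [hT'c]; push_cast; exact Nat.lt_floor_add_one L
  have hT'U : (#T' : ℝ) ≤ 2 * L := by
    rw [hT'c]; push_cast
    have h2 : (⌊L⌋₊ : ℝ) ≤ L := Nat.floor_le (by linarith)
    linarith
  have hsub : ∀ i j, ∀ x ∈ X i, ∀ y ∈ X j, x - y ∈ X (i + j) := fun i j x hx y hy => by
    rw [sub_eq_add_neg]; exact hadd i j x hx _ (hneg j y hy)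
  have hXpos : (0 : ℝ) < #(X m) := by exact_mod_cast Finset.card_pos.2 ⟨0, h0 m⟩
  -- Complement of the pivots: if `y ∉ N`, then `(τ, w) ↦ w + τ y` is injective on `T' × X m`.
  set N : Set V := {y | ∃ t ∈ T', ∃ t' ∈ T', t ≠ t' ∧ (t - t') y ∈ X (2 * m)} with hN
  have hNuniv : N = Set.univ := by
    refine hgen N ?_ ?_
    · have : 1 < #T' := by
        have : (1 : ℝ) < #T' := lt_of_le_of_lt hL1 hT'L
        exact_mod_cast this
      obtain ⟨t, ht, t', ht', hne⟩ := Finset.one_lt_card.1 this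
      exact ⟨t, ht, t', ht', hne, by rw [map_zero]; exact h0 _⟩
    · rintro ψ hψ y ⟨t, ht, t', ht', hne, hy⟩ x hx
      by_contra hcon
      set r : AddMonoid.End V := t - t' with hr
      have hrinj := hT t (hT'T ht) t' (hT'T ht') hne
      have hcomm : ∀ τ ∈ T', ∀ w, r (τ w) = τ (r w) := by
        intro τ hτ w
        have h1 : Commute r τ :=
          (hTT t (hT'T ht) τ (hT'T hτ)).sub_left (hTT t' (hT'T ht') τ (hT'T hτ))
        exact DFunLike.congr_fun h1.eq w
      have hrψ : ∀ w, r (ψ w) = ψ (r w) := by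
        intro w
        have h1 : Commute r ψ := (hTΨ t (hT'T ht) ψ hψ).sub_left (hTΨ t' (hT'T ht') ψ hψ)
        exact DFunLike.congr_fun h1.eq w
      have hrX : ∀ j, ∀ w ∈ X j, r w ∈ X ((j + a) + (j + a)) := fun j w hw =>
        hsub _ _ _ (hTX t (hT'T ht) j w hw) _ (hTX t' (hT'T ht') j w hw)
      -- Were `ψ y + x` a pivot, its pivot map would be injective. Composing with the injective `r`,
      -- which commutes with `T'` and `ψ`, brings the image into a bounded `X j` because `r y ∈ X (2
      -- * m)`. This contradicts `#T' > L`.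
      set f : AddMonoid.End V × V → V := fun q => r q.2 + q.1 (r (ψ y + x)) with hf
      have hmaps : ∀ q ∈ T' ×ˢ X m, f q ∈ X (20 * (m + a + 1)) := by
        rintro ⟨τ, w⟩ hq
        rw [Finset.mem_product] at hq
        have h1 : r (ψ y + x) ∈ X ((2 * m + 1) + ((m + a) + (m + a))) := by
          rw [map_add, hrψ]
          exact hadd _ _ _ (hΨX ψ hψ _ _ hy) _ (hrX m x hx)
        have h2 := hadd _ _ _ (hrX m w hq.2) _ (hTX τ (hT'T hq.1) _ _ h1)
        exact hmono (by lia) h2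
      have hinj : Set.InjOn f (T' ×ˢ X m : Finset _) := by
        rintro ⟨τ, w⟩ hq ⟨τ', w'⟩ hq' heq
        rw [Finset.mem_coe, Finset.mem_product] at hq hq'
        have heq' : r w + τ (r (ψ y + x)) = r w' + τ' (r (ψ y + x)) := heq
        rw [← hcomm τ hq.1, ← hcomm τ' hq'.1, ← map_add, ← map_add] at heq'
        have h3 := hrinj heq'
        have h4 : (τ - τ') (ψ y + x) = w' - w := by
          change τ (ψ y + x) - τ' (ψ y + x) = w' - w
          rw [sub_eq_sub_iff_add_eq_add, add_comm, h3, add_comm]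
        have h5 : τ = τ' := by
          by_contra hne'
          exact hcon ⟨τ, hq.1, τ', hq'.1, hne', by
            rw [h4, two_mul]; exact hsub _ _ _ hq'.2 _ hq.2⟩
        subst h5
        rw [add_left_inj] at h3
        rw [h3]
      have hcard := Finset.card_le_card_of_injOn f hmaps hinj
      rw [Finset.card_product] at hcard
      have h6 : (#T' : ℝ) * #(X m) ≤ L * #(X m) :=
        le_trans (by exact_mod_cast hcard) hL
      have := le_of_mul_le_mul_right h6 hXpos
      linarith
  -- density of `X (2 * m)`
  have hVcard : (Fintype.card V : ℝ) ≤ 4 * L ^ 2 * #(X (2 * m)) := by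
    have hcover : (Finset.univ : Finset V) ⊆ (T'.offDiag).biUnion fun q =>
        Finset.univ.filter fun y => (q.1 - q.2 : AddMonoid.End V) y ∈ X (2 * m) := by
      intro y _
      have hy : y ∈ N := hNuniv ▸ Set.mem_univ y
      obtain ⟨t, ht, t', ht', hne, hy⟩ := hy
      rw [Finset.mem_biUnion]
      exact ⟨(t, t'), Finset.mem_offDiag.2 ⟨ht, ht', hne⟩, by simpa using hy⟩
    have h1 : Fintype.card V ≤ #T'.offDiag * #(X (2 * m)) := by
      rw [← Finset.card_univ]
      refine (Finset.card_le_card hcover).trans (Finset.card_biUnion_le_card_mul _ _ _ ?_)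
      rintro ⟨t, t'⟩ hq
      rw [Finset.mem_offDiag] at hq
      exact Finset.card_le_card_of_injOn (t - t' : AddMonoid.End V)
        (fun y hy => by simpa using hy) (hT _ (hT'T hq.1) _ (hT'T hq.2.1) hq.2.2).injOn
    have h2 : (#T'.offDiag : ℝ) ≤ 4 * L ^ 2 := by
      have : #T'.offDiag ≤ #T' * #T' := by rw [Finset.offDiag_card]; exact Nat.sub_le _ _
      calc (#T'.offDiag : ℝ) ≤ #T' * #T' := by exact_mod_cast this
        _ ≤ (2 * L) * (2 * L) := by gcongr
        _ = 4 * L ^ 2 := by ring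
    calc (Fintype.card V : ℝ) ≤ #T'.offDiag * #(X (2 * m)) := by exact_mod_cast h1
      _ ≤ _ := by gcongr
  have hX2 : (0 : ℝ) < #(X (2 * m)) := by exact_mod_cast Finset.card_pos.2 ⟨0, h0 _⟩
  have hVpos : (0 : ℝ) < Fintype.card V := by exact_mod_cast Fintype.card_pos
  have hTpos : (0 : ℝ) < #T := lt_of_le_of_lt (by positivity) hTL
  -- The bound of `norm_charSum_smul_le`, normalized. The requirement `ε * |V| < #X` reads `|V| ^ 3
  -- < #T * #X ^ 3`, which the density of `X (2 * m)` and `64 * L ^ 6 < #T` provide.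
  set ε : ℝ := Real.sqrt (Fintype.card V / (#T * #(X (2 * m)))) with hε
  have : Nonempty T := by
    obtain ⟨t, ht⟩ := Finset.card_pos.1 (by exact_mod_cast hTpos : 0 < #T)
    exact ⟨⟨t, ht⟩⟩
  have : Nonempty (X (2 * m)) := ⟨⟨0, h0 _⟩⟩
  have hsq : ε ^ 2 = Fintype.card V / (#T * #(X (2 * m))) := Real.sq_sqrt (by positivity)
  obtain ⟨x, hx, x', hx', ⟨t, w⟩, rfl⟩ := exists_sub_add_eq_of_charSum_le (Z := V)
    (I := T × X (2 * m)) (Φ := fun q => (q.1 : AddMonoid.End V) (q.2 : V)) (ε := ε)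
    (X := X (2 * m)) (by
      intro ξ hξ
      refine le_of_sq_le_sq ?_ (by positivity)
      refine (norm_charSum_smul_le hT (X (2 * m)) ξ hξ).trans (le_of_eq ?_)
      rw [mul_pow, hsq, Fintype.card_prod, Fintype.card_coe, Fintype.card_coe]
      push_cast
      field_simp) (Real.sqrt_nonneg _) (by
      refine lt_of_pow_lt_pow_left₀ 2 (by positivity) ?_
      rw [mul_pow, hsq, div_mul_eq_mul_div, div_lt_iff₀ (by positivity)]
      calc (Fintype.card V : ℝ) * Fintype.card V ^ 2 = (Fintype.card V : ℝ) ^ 3 := by ring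
        _ ≤ (4 * L ^ 2 * #(X (2 * m))) ^ 3 := by gcongr
        _ = 64 * L ^ 6 * #(X (2 * m)) ^ 3 := by ring
        _ < #T * #(X (2 * m)) ^ 3 := by gcongr
        _ = _ := by ring) v
  have h := hadd _ _ _ (hsub _ _ _ hx _ hx') _ (hTX t t.2 _ w w.2)
  exact hmono (by lia) h

end Pivot

/-! ### Counting cosets in slowly growing sets -/

section Counting

variable {G : Type*} [Group G]

/-- Translates of `S ⊆ H` by representatives of distinct cosets are disjoint. With the next bound
this is orbit-stabilizer for sets; a general `f` covers both coset maps and homomorphisms. -/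
theorem ncard_mul_ncard_image_le [Finite G] {X : Type*} {f : G → X} {H : Subgroup G}
    (hf : ∀ x y, f x = f y ↔ x⁻¹ * y ∈ H) (S Y : Set G) (hS : S ⊆ H) :
    S.ncard * (f '' Y).ncard ≤ (Y * S).ncard := by
  classical
  have hex : ∀ q : f '' Y, ∃ y ∈ Y, f y = q := fun q => q.2
  choose r hrY hr using hex
  rw [← Nat.card_coe_set_eq S, ← Nat.card_coe_set_eq (f '' Y), ← Nat.card_prod,
    ← Nat.card_coe_set_eq (Y * S)]
  refine Nat.card_le_card_of_injective
    (fun q : S × (f '' Y) => (⟨r q.2 * q.1, Set.mul_mem_mul (hrY _) q.1.2⟩ : ↥(Y * S))) ?_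
  rintro ⟨s, q⟩ ⟨s', q'⟩ h
  have h1 : r q * s = r q' * s' := congrArg Subtype.val h
  have h2 : (r q)⁻¹ * r q' = s * (s' : G)⁻¹ := by
    rw [eq_mul_inv_iff_mul_eq, mul_assoc, ← h1, inv_mul_cancel_left]
  have h3 : q = q' := by
    apply Subtype.ext
    rw [← hr q, ← hr q', hf, h2]
    exact H.mul_mem (hS s.2) (H.inv_mem (hS s'.2))
  subst h3
  rw [mul_right_inj] at h1
  rw [Subtype.ext h1]

theorem ncard_le_ncard_image_mul [Finite G] {X : Type*} {f : G → X} {H : Subgroup G}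
    (hf : ∀ x y, f x = f y ↔ x⁻¹ * y ∈ H) (Y : Set G) :
    Y.ncard ≤ (f '' Y).ncard * ((Y⁻¹ * Y) ∩ H : Set G).ncard := by
  classical
  have hex : ∀ q : f '' Y, ∃ y ∈ Y, f y = q := fun q => q.2
  choose r hrY hr using hex
  have hfin : Finite (f '' Y) := (Set.toFinite Y).image f
  rw [← Nat.card_coe_set_eq Y, ← Nat.card_coe_set_eq (f '' Y), ← Nat.card_coe_set_eq (_ ∩ _),
    ← Nat.card_prod]
  refine Nat.card_le_card_of_injective (fun y : Y => ((⟨f y, Set.mem_image_of_mem f y.2⟩,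
    ⟨(r ⟨f y, Set.mem_image_of_mem f y.2⟩)⁻¹ * y,
      Set.mul_mem_mul (Set.inv_mem_inv.2 (hrY _)) y.2, (hf _ _).1 (hr _)⟩) :
    (f '' Y) × ↥((Y⁻¹ * Y) ∩ H : Set G))) ?_
  rintro y y' h
  have h1 : (⟨f y, Set.mem_image_of_mem f y.2⟩ : f '' Y) = ⟨f y', Set.mem_image_of_mem f y'.2⟩ :=
    (Prod.ext_iff.1 h).1
  have h2 := congrArg Subtype.val (Prod.ext_iff.1 h).2
  dsimp only at h2
  rw [h1, mul_right_inj] at h2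
  exact Subtype.ext h2

theorem mk_eq_mk_iff_mem (H : Subgroup G) (x y : G) :
    (QuotientGroup.mk x : G ⧸ H) = QuotientGroup.mk y ↔ x⁻¹ * y ∈ H := QuotientGroup.eq

theorem MonoidHom.eq_iff_mem_ker {Q : Type*} [Group Q] (π : G →* Q) (x y : G) :
    π x = π y ↔ x⁻¹ * y ∈ π.ker := by
  rw [MonoidHom.mem_ker, map_mul, map_inv, inv_mul_eq_one]

theorem cosetCount_mono [Finite G] {Y Y' : Set G} (h : Y ⊆ Y') (H : Subgroup G) :
    cosetCount Y H ≤ cosetCount Y' H :=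
  Set.ncard_le_ncard (Set.image_mono h) (Set.toFinite _)

/-- With `r ∈ Y` a fixed representative of `y H`, the coset of `y` modulo `H ⊓ C` is determined by
`y H` and by the `C`-coset of `r⁻¹ * y`. -/
theorem cosetCount_inf_le [Finite G] (Y : Set G) (H C : Subgroup G) :
    cosetCount Y (H ⊓ C) ≤ cosetCount Y H * cosetCount ((Y⁻¹ * Y) ∩ H) C := by
  classical
  have hex : ∀ q : (fun a : G => (QuotientGroup.mk a : G ⧸ H)) '' Y,
    ∃ y ∈ Y, (QuotientGroup.mk y : G ⧸ H) = q := fun q => q.2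
  choose r hrY hr using hex
  have hex' : ∀ q : (fun a : G => (QuotientGroup.mk a : G ⧸ (H ⊓ C))) '' Y,
    ∃ y ∈ Y, (QuotientGroup.mk y : G ⧸ (H ⊓ C)) = q := fun q => q.2
  choose s hsY hs using hex'
  unfold cosetCount
  rw [← Nat.card_coe_set_eq, ← Nat.card_coe_set_eq, ← Nat.card_coe_set_eq, ← Nat.card_prod]
  refine Nat.card_le_card_of_injective (fun q => ((⟨QuotientGroup.mk (s q),
    Set.mem_image_of_mem _ (hsY q)⟩, ⟨QuotientGroup.mk
      ((r ⟨QuotientGroup.mk (s q), Set.mem_image_of_mem _ (hsY q)⟩)⁻¹ * s q),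
      Set.mem_image_of_mem _ ⟨Set.mul_mem_mul (Set.inv_mem_inv.2 (hrY _)) (hsY q),
        QuotientGroup.eq.1 (hr _)⟩⟩))) ?_
  rintro q q' h
  have h1 := (Prod.ext_iff.1 h).1
  have h2 := congrArg Subtype.val (Prod.ext_iff.1 h).2
  dsimp only at h1 h2
  rw [h1, QuotientGroup.eq] at h2
  have h3 := congrArg Subtype.val h1
  dsimp only at h3
  rw [QuotientGroup.eq] at h3
  apply Subtype.ext
  rw [← hs q, ← hs q', QuotientGroup.eq]
  refine ⟨h3, ?_⟩
  simpa [mul_assoc] using h2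

/-- A symmetric set containing `1`, all of whose powers grow slowly. -/
structure SmallGrowth (B : Set G) (K : ℝ) : Prop where
  one_mem : 1 ∈ B
  inv_eq : B⁻¹ = B
  one_le : 1 ≤ K
  card_pow : ∀ j, ((B ^ j).ncard : ℝ) ≤ K ^ j * B.ncard

namespace SmallGrowth

variable {B : Set G} {K : ℝ}

theorem pow_mono (hB : SmallGrowth B K) : Monotone (fun j : ℕ => B ^ j) :=
  fun _ _ h => Set.pow_subset_pow_right hB.one_mem h

theorem mul_mem {i j : ℕ} {x y : G} (hx : x ∈ B ^ i) (hy : y ∈ B ^ j) : x * y ∈ B ^ (i + j) := by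
  rw [pow_add]; exact Set.mul_mem_mul hx hy

theorem inv_mem (hB : SmallGrowth B K) {j : ℕ} {x : G} (hx : x ∈ B ^ j) : x⁻¹ ∈ B ^ j := by
  rw [← hB.inv_eq, inv_pow]; exact Set.inv_mem_inv.2 hx

theorem one_mem_pow (hB : SmallGrowth B K) (j : ℕ) : (1 : G) ∈ B ^ j :=
  hB.pow_mono (Nat.zero_le j) (by simp)

theorem commutator_mem (hB : SmallGrowth B K) {i j : ℕ} {x y : G} (hx : x ∈ B ^ i)
    (hy : y ∈ B ^ j) : ⁅x, y⁆ ∈ B ^ (i + j + i + j) :=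
  mul_mem (mul_mem (mul_mem hx hy) (hB.inv_mem hx)) (hB.inv_mem hy)

/-- If `B` meets `c` cosets of `H`, then `B ^ (j + 1)` has at least `c * |B ^ j ∩ H|` elements,
while `B` has at most `c * |B ^ 2 ∩ H|`. -/
theorem ncard_image_pow_inter_le [Finite G] (hB : SmallGrowth B K) (H : Subgroup G) (j : ℕ) :
    ((B ^ j ∩ H : Set G).ncard : ℝ) ≤ K ^ (j + 1) * (B ^ 2 ∩ H : Set G).ncard := by
  have hf := mk_eq_mk_iff_mem H
  have h1 := ncard_mul_ncard_image_le hf (B ^ j ∩ H) B Set.inter_subset_right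
  have h2 := ncard_le_ncard_image_mul hf B
  set c := ((fun a : G => (QuotientGroup.mk a : G ⧸ H)) '' B).ncard with hc
  have hcpos : (0 : ℝ) < c := by
    exact_mod_cast (Set.ncard_pos (Set.toFinite _)).2
        (Set.Nonempty.image _ ⟨1, hB.one_mem⟩)
  have h3 : (B * (B ^ j ∩ H)).ncard ≤ (B ^ (j + 1)).ncard := by
    refine Set.ncard_le_ncard ?_ (Set.toFinite _)
    rw [pow_succ']
    exact Set.mul_subset_mul_left Set.inter_subset_left
  rw [hB.inv_eq, ← sq] at h2
  refine le_of_mul_le_mul_right (a := (c : ℝ)) ?_ hcpos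
  have hK : 0 ≤ K := by linarith [hB.one_le]
  calc ((B ^ j ∩ H : Set G).ncard : ℝ) * c ≤ (B ^ (j + 1)).ncard := by
        exact_mod_cast h1.trans h3
    _ ≤ K ^ (j + 1) * B.ncard := hB.card_pow _
    _ ≤ K ^ (j + 1) * (c * (B ^ 2 ∩ H : Set G).ncard) := by
        gcongr; exact_mod_cast h2
    _ = _ := by ring

/-- Comparing fibres through `B ^ 2 ∩ π.ker` costs two extra factors of `B`, and `j + 2 ≤ 3 * j` for
`j ≥ 1`; hence the constant `K ^ 3`. -/
theorem image [Finite G] {Q : Type*} [Group Q] (hB : SmallGrowth B K) (π : G →* Q) :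
    SmallGrowth (π '' B) (K ^ 3) where
  one_mem := ⟨1, hB.one_mem, map_one π⟩
  inv_eq := by rw [← Set.image_inv, hB.inv_eq]
  one_le := one_le_pow₀ hB.one_le
  card_pow j := by
    have hK : 0 ≤ K := by linarith [hB.one_le]
    have hpos : (0 : ℝ) < (π '' B).ncard := by
      exact_mod_cast (Set.ncard_pos (Set.toFinite _)).2
        (Set.Nonempty.image _ ⟨1, hB.one_mem⟩)
    rcases Nat.eq_zero_or_pos j with rfl | hj
    · have : (1 : ℝ) ≤ (π '' B).ncard := by exact_mod_cast hpos
      simpa [← Set.singleton_one] using this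
    have hf := π.eq_iff_mem_ker
    have h1 := ncard_mul_ncard_image_le hf (B ^ 2 ∩ π.ker) (B ^ j) Set.inter_subset_right
    have h2 := ncard_le_ncard_image_mul hf B
    rw [hB.inv_eq, ← sq] at h2
    have h3 : (B ^ j * (B ^ 2 ∩ π.ker)).ncard ≤ (B ^ (j + 2)).ncard := by
      refine Set.ncard_le_ncard ?_ (Set.toFinite _)
      rw [pow_add]
      exact Set.mul_subset_mul_left Set.inter_subset_left
    have hne : (B ^ 2 ∩ π.ker : Set G).Nonempty := ⟨1, hB.one_mem_pow 2, π.ker.one_mem⟩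
    have hcpos : (0 : ℝ) < (B ^ 2 ∩ π.ker : Set G).ncard := by
      exact_mod_cast (Set.ncard_pos (Set.toFinite _)).2 hne
    rw [← Set.image_pow]
    refine le_of_mul_le_mul_right (a := ((B ^ 2 ∩ π.ker : Set G).ncard : ℝ)) ?_ hcpos
    calc ((π '' (B ^ j)).ncard : ℝ) * (B ^ 2 ∩ π.ker : Set G).ncard
        ≤ (B ^ (j + 2)).ncard := by rw [mul_comm]; exact_mod_cast h1.trans h3
      _ ≤ K ^ (j + 2) * B.ncard := hB.card_pow _
      _ ≤ K ^ (j + 2) * ((π '' B).ncard * (B ^ 2 ∩ π.ker : Set G).ncard) := by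
          gcongr; exact_mod_cast h2
      _ ≤ (K ^ 3) ^ j * ((π '' B).ncard * (B ^ 2 ∩ π.ker : Set G).ncard) := by
          rw [← pow_mul]
          gcongr
          · exact hB.one_le
          · lia
      _ = _ := by ring

/-- Small tripling controls all powers of a symmetric set. One passes to `A ^ 2` because `A` itself
need not contain `1`. -/
theorem of_tripling [Finite G] {A : Set G} (hA : A.Nonempty) (hinv : A⁻¹ = A)
    (h : ((A ^ 3).ncard : ℝ) ≤ K * A.ncard) : SmallGrowth (A ^ 2) (K ^ 2) := by
  classical
  have hApos : (0 : ℝ) < A.ncard := by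
    exact_mod_cast (Set.ncard_pos (Set.toFinite _)).2 hA
  obtain ⟨a, ha⟩ := hA
  have ha' : a⁻¹ ∈ A := by rw [← hinv]; exact Set.inv_mem_inv.2 ha
  have hle : ∀ j, (A ^ j).ncard ≤ (A ^ (j + 1)).ncard := fun j => by
    have : (A ^ j).ncard = ((fun x => x * a) '' (A ^ j)).ncard :=
      (Set.ncard_image_of_injective _ (mul_left_injective a)).symm
    rw [this]
    refine Set.ncard_le_ncard ?_ (Set.toFinite _)
    rintro _ ⟨x, hx, rfl⟩
    rw [pow_succ]
    exact Set.mul_mem_mul hx ha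
  have hK : 1 ≤ K := by
    have : (A.ncard : ℝ) ≤ (A ^ 3).ncard := by
      have h1 := hle 1
      have h2 := hle 2
      rw [pow_one] at h1
      exact_mod_cast h1.trans h2
    by_contra! hK
    nlinarith
  have hone : (1 : G) ∈ A ^ 2 := by
    rw [sq, ← mul_inv_cancel a]; exact Set.mul_mem_mul ha ha'
  refine ⟨hone, by rw [← inv_pow, hinv], one_le_pow₀ hK, fun j => ?_⟩
  have h2pos : (A.ncard : ℝ) ≤ (A ^ 2).ncard := by
    have := hle 1
    rw [pow_one] at this
    exact_mod_cast this
  rw [← pow_mul, ← pow_mul]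
  rcases j with _ | _ | j
  · have : (1 : ℝ) ≤ (A ^ 2).ncard := by
      exact_mod_cast (Set.ncard_pos (Set.toFinite _)).2 ⟨1, hone⟩
    simpa [← Set.singleton_one] using this
  · have : 1 ≤ K ^ 2 := one_le_pow₀ hK
    have h0 : (0 : ℝ) ≤ (A ^ 2).ncard := by positivity
    simpa using le_mul_of_one_le_left h0 this
  · set F : Finset G := (Set.toFinite A).toFinset with hF
    have hFA : (F : Set G) = A := (Set.toFinite A).coe_toFinset
    have key := Finset.small_pow_of_small_tripling (A := F) (K := K) (m := 2 * (j + 2)) (by lia)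
      (by
        rw [← Set.ncard_coe_finset, ← Set.ncard_coe_finset, Finset.coe_pow, hFA]; exact h)
      (by rw [← Finset.coe_inj, Finset.coe_inv, hFA, hinv])
    rw [← Set.ncard_coe_finset, ← Set.ncard_coe_finset, Finset.coe_pow, hFA] at key
    refine key.trans ?_
    have hK0 : 0 ≤ K := by linarith
    calc K ^ (2 * (j + 2) - 2) * (A.ncard : ℝ) ≤ K ^ (2 * (j + 1 + 1)) * (A ^ 2).ncard := by
          gcongr ?_ * ?_
          exact pow_le_pow_right₀ hK (by lia)
      _ = _ := rfl

end SmallGrowth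

end Counting

/-! ### Fixed-point-free action and filtrations -/

section FixedPointFree

/-- If commuting operators generate `V` through their differences `δ x - x`, and on each step of a
finite filtration either all operators act trivially or `e - 1` is onto, then `e - 1` is onto. -/
theorem surjective_sub_one_of_filtration {V : Type*} [AddCommGroup V] {𝒟 : Set (AddMonoid.End V)}
    {e : AddMonoid.End V} (he : ∀ δ ∈ 𝒟, Commute e δ) (W : ℕ → AddSubgroup V) (r : ℕ)
    (h0 : W 0 = ⊤) (hr : W r = ⊥)
    (hspan : ∀ N : AddSubgroup V, (∀ δ ∈ 𝒟, ∀ x, δ x - x ∈ N) → N = ⊤)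
    (hk : ∀ k < r, (∀ δ ∈ 𝒟, ∀ x ∈ W k, δ x - x ∈ W (k + 1)) ∨
      (∀ x ∈ W k, ∃ y, (e y - y) - x ∈ W (k + 1))) (x : V) : ∃ y, e y - y = x := by
  set R : AddSubgroup V := AddMonoidHom.range ((e - 1 : AddMonoid.End V) : V →+ V) with hR
  have hmem : ∀ y, e y - y ∈ R := fun y => ⟨y, rfl⟩
  -- On a trivial step, write `x = (e b - b) + c` with `c ∈ W k`. Commutation puts `δ x - x` in `R ⊔
  -- W (k + 1)`, and such differences generate `V`. On the other steps `W k ≤ R ⊔ W (k + 1)`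
  -- directly.
  have key : ∀ k ≤ r, R ⊔ W k = ⊤ := by
    intro k
    induction k with
    | zero => intro _; rw [h0, sup_top_eq]
    | succ k ih =>
      intro hkr
      have ih := ih (by lia)
      rcases hk k (by lia) with h | h
      · refine hspan _ fun δ hδ x => ?_
        obtain ⟨a, ⟨b, rfl⟩, c, hc, rfl⟩ :=
          AddSubgroup.mem_sup.1 (ih ▸ AddSubgroup.mem_top x : x ∈ R ⊔ W k)
        have h1 : δ (e b) = e (δ b) := (DFunLike.congr_fun (he δ hδ).eq b).symm
        have h2 : δ ((e b - b) + c) - ((e b - b) + c) =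
            (e (δ b - b) - (δ b - b)) + (δ c - c) := by
          rw [map_add, map_sub, map_sub, h1]; abel
        exact h2 ▸ AddSubgroup.add_mem_sup (hmem _) (h δ hδ c hc)
      · rw [eq_top_iff, ← ih]
        refine sup_le le_sup_left fun x hx => ?_
        obtain ⟨y, hy⟩ := h x hx
        have : x = (e y - y) + -((e y - y) - x) := by abel
        rw [this]
        exact AddSubgroup.add_mem_sup (hmem y) (neg_mem hy)
  have := key r le_rfl
  rw [hr, sup_bot_eq] at this
  obtain ⟨y, hy⟩ := (this ▸ AddSubgroup.mem_top x : x ∈ R)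
  exact ⟨y, hy⟩

variable {G : Type*} [Group G]

/-- As `S / S₁` is abelian, `x ↦ ⁅d, x⁆` is a homomorphism into it. Its kernel is exactly `S₁`, so
by counting it is onto. -/
theorem exists_commutator_inv_mul_mem {S S₁ : Subgroup G} [Finite S] {d : G}
    (hS : ∀ x ∈ S, d * x * d⁻¹ ∈ S) (hcomm : ⁅S, S⁆ ≤ S₁) (hd : ∀ x ∈ S₁, d * x * d⁻¹ ∈ S₁)
    (hinj : ∀ x ∈ S, ⁅d, x⁆ ∈ S₁ → x ∈ S₁) : ∀ x ∈ S, ∃ y ∈ S, ⁅d, y⁆⁻¹ * x ∈ S₁ := by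
  have hc : ∀ x ∈ S, ⁅d, x⁆ ∈ S := fun x hx => S.mul_mem (hS x hx) (S.inv_mem hx)
  have hnorm : (S₁.subgroupOf S).Normal := by
    refine ⟨fun x hx g => ?_⟩
    rw [Subgroup.mem_subgroupOf] at hx ⊢
    have : ((g * x * g⁻¹ : S) : G) = ⁅(g : G), (x : G)⁆ * x := by
      simp [commutatorElement_def]
    rw [this]
    exact S₁.mul_mem (hcomm (Subgroup.commutator_mem_commutator g.2 x.2)) hx
  let f : S →* S ⧸ S₁.subgroupOf S := MonoidHom.mk'
    (fun x => QuotientGroup.mk (⟨⁅d, (x : G)⁆, hc x x.2⟩ : S)) (by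
      intro x y
      rw [← QuotientGroup.mk_mul, QuotientGroup.eq, Subgroup.mem_subgroupOf]
      have : (((⟨⁅d, ((x * y : S) : G)⁆, hc _ (x * y).2⟩ : S)⁻¹ *
          (⟨⁅d, (x : G)⁆, hc x x.2⟩ * ⟨⁅d, (y : G)⁆, hc y y.2⟩) : S) : G) =
          ⁅(x : G), ⁅d, (y : G)⁆⁻¹⁆ := by
        simp only [Subgroup.coe_mul, Subgroup.coe_inv, commutatorElement_def]
        group
      rw [this]
      exact hcomm (Subgroup.commutator_mem_commutator x.2 (S.inv_mem (hc y y.2))))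
  have hker : f.ker = S₁.subgroupOf S := by
    ext x
    rw [MonoidHom.mem_ker, Subgroup.mem_subgroupOf]
    change (QuotientGroup.mk (⟨⁅d, (x : G)⁆, hc x x.2⟩ : S) : S ⧸ S₁.subgroupOf S) = 1 ↔ _
    rw [QuotientGroup.eq_one_iff, Subgroup.mem_subgroupOf]
    refine ⟨hinj x x.2, fun hx => S₁.mul_mem (hd x hx) (S₁.inv_mem hx)⟩
  have hsurj : Function.Surjective f := by
    have h1 : Nat.card f.range = Nat.card (S ⧸ S₁.subgroupOf S) := by
      rw [← Subgroup.index_ker f, hker, Subgroup.index]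
    rw [← MonoidHom.range_eq_top]
    exact Subgroup.eq_top_of_card_eq _ h1
  intro x hx
  obtain ⟨y, hy⟩ := hsurj (QuotientGroup.mk ⟨x, hx⟩)
  refine ⟨y, y.2, ?_⟩
  have hy' : (QuotientGroup.mk (⟨⁅d, (y : G)⁆, hc y y.2⟩ : S) : S ⧸ S₁.subgroupOf S) =
    QuotientGroup.mk ⟨x, hx⟩ := hy
  rw [QuotientGroup.eq, Subgroup.mem_subgroupOf] at hy'
  exact hy'

/-- Absence of fixed points passes to the quotient `S / V`: surjectivity on `V / S₁` yields `y ∈ V`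
with `⁅d, y⁆ ≡ ⁅d, x⁆`, so `y⁻¹ * x` is fixed modulo `S₁`. -/
theorem commutator_mem_imp_mem_of_le {S S₁ V : Subgroup G} [Finite S] {d : G} (h₁ : S₁ ≤ V)
    (h₂ : V ≤ S) (hcomm : ⁅S, S⁆ ≤ S₁) (hd : ∀ x ∈ S₁, d * x * d⁻¹ ∈ S₁)
    (hdV : ∀ x ∈ V, d * x * d⁻¹ ∈ V)
    (hinj : ∀ x ∈ S, ⁅d, x⁆ ∈ S₁ → x ∈ S₁) :
    ∀ x ∈ S, ⁅d, x⁆ ∈ V → x ∈ V := by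
  intro x hx hdx
  have : Finite V := Finite.of_injective _ (Subgroup.inclusion_injective h₂)
  obtain ⟨y, hy, hyx⟩ := exists_commutator_inv_mul_mem hdV
    ((Subgroup.commutator_mono h₂ h₂).trans hcomm) hd (fun x hx => hinj x (h₂ hx)) _ hdx
  have hc : ⁅d, y⁆ ∈ V := V.mul_mem (hdV y hy) (V.inv_mem hy)
  have h3 : ⁅d, y⁻¹ * x⁆ ∈ S₁ := by
    have : ⁅d, y⁻¹ * x⁆ = ⁅y⁻¹, ⁅d, y⁆⁻¹ * ⁅d, x⁆⁆ * (⁅d, y⁆⁻¹ * ⁅d, x⁆) := by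
      simp only [commutatorElement_def]; group
    rw [this]
    exact S₁.mul_mem (hcomm (Subgroup.commutator_mem_commutator (S.inv_mem (h₂ hy))
      (S.mul_mem (S.inv_mem (h₂ hc)) (h₂ hdx)))) hyx
  have h4 := h₁ (hinj _ (S.mul_mem (S.inv_mem (h₂ hy)) hx) h3)
  have := V.mul_mem hy h4
  rwa [mul_inv_cancel_left] at this

/-- The conjugation action on an abelian normal subgroup, written additively. -/
def conjEnd (M : Subgroup G) [M.Normal] [IsMulCommutative M] :
    G →* AddMonoid.End (Additive M) where
  toFun g := MonoidHom.toAdditive (MulAut.conjNormal (H := M) g).toMonoidHom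
  map_one' := by rw [map_one]; rfl
  map_mul' g h := by rw [map_mul]; rfl

theorem coe_conjEnd_sub (M : Subgroup G) [M.Normal] [IsMulCommutative M] (g : G)
    (x : Additive M) : ((conjEnd M g x - x).toMul : G) = ⁅g, (x.toMul : G)⁆ := by
  rw [commutatorElement_def, sub_eq_add_neg]; rfl

theorem commute_conjEnd (M : Subgroup G) [M.Normal] [IsMulCommutative M] {g h : G}
    (hgh : ∀ x ∈ M, ⁅⁅g, h⁆, x⁆ = 1) : Commute (conjEnd M g) (conjEnd M h) := by
  have h1 : conjEnd M ⁅g, h⁆ = 1 := by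
    refine AddMonoidHom.ext fun x => ?_
    apply Additive.toMul.injective
    apply Subtype.ext
    have := hgh _ x.toMul.2
    rw [commutatorElement_eq_one_iff_mul_comm] at this
    change ⁅g, h⁆ * (x.toMul : G) * ⁅g, h⁆⁻¹ = x.toMul
    rw [this, mul_inv_cancel_right]
  have h2 : g * h = ⁅g, h⁆ * (h * g) := by rw [commutatorElement_def]; group
  change _ * _ = _ * _
  rw [← map_mul, h2, map_mul, h1, one_mul, map_mul]

end FixedPointFree

/-! ### The configuration `(U, D, S, W, T)` and fixed points on sections of `S` -/

section PivotData

variable {G : Type*} [Group G]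

/-- An approximate group `A` generating `G`, a nilpotent normal subgroup `U` with a filtration `W`,
a normal subgroup `D` which is central modulo `S ≤ U ⊓ D`, and a set `T ⊆ A ^ 4` of elements of
`U * D` whose quotients act without fixed points on all steps of the filtration on which `D` acts
nontrivially. -/
structure PivotData (n r e q : ℕ) (A : Set G) (K : ℝ) (U D S : Subgroup G) (W : ℕ → Subgroup G)
    (T : Set G) : Prop where
  closure_eq : Subgroup.closure A = ⊤
  inv_eq : A⁻¹ = A
  growth : SmallGrowth (A ^ 2) K
  two_le : 2 ≤ K
  normal_U : U.Normal
  normal_D : D.Normal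
  normal_S : S.Normal
  S_le_U : S ≤ U
  S_le_D : S ≤ D
  D_central : ⁅D, (⊤ : Subgroup G)⁆ ≤ S
  S_le : S ≤ ⁅S, D⁆
  nilp : U.lowerCentralSeries n = ⊥
  W_zero : W 0 = U
  W_last : W r = ⊥
  W_conj : ∀ k, ∀ d ∈ D, ∀ x ∈ W k, d * x * d⁻¹ ∈ W k
  W_comm : ∀ k, ∀ u ∈ U, ∀ x ∈ W k, ⁅u, x⁆ ∈ W (k + 1)
  W_anti : ∀ k, W (k + 1) ≤ W k
  pow_mem : ∀ d ∈ D, d ^ q ∈ S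
  pow_eq : ∀ u ∈ U, u ^ e = 1
  coprime : e.Coprime q
  T_sub : T ⊆ (A ^ 2) ^ 2
  T_fac : ∀ t ∈ T, ∃ u ∈ U, ∃ d ∈ D, t = u * d
  rich : ∀ t ∈ T, ∀ t' ∈ T, t ≠ t' → ∀ k < r, (∀ d ∈ D, ∀ x ∈ W k, ⁅d, x⁆ ∈ W (k + 1)) ∨
    (∀ x ∈ W k, ⁅t⁻¹ * t', x⁆ ∈ W (k + 1) → x ∈ W (k + 1))

namespace PivotData

variable {n r e q : ℕ} {A : Set G} {K : ℝ} {U D S : Subgroup G} {W : ℕ → Subgroup G} {T : Set G}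

theorem W_le (P : PivotData n r e q A K U D S W T) (k : ℕ) : W k ≤ U := by
  induction k with
  | zero => exact P.W_zero.le
  | succ k ih => exact (P.W_anti k).trans ih

theorem commutator_mul_mem (P : PivotData n r e q A K U D S W T) {u d : G} (hu : u ∈ U)
    (hd : d ∈ D) (g : G) : ⁅u * d, g⁆ ∈ U := by
  have h := P.normal_U
  have h1 : ⁅u * d, g⁆ = u * ⁅d, g⁆ * u⁻¹ * (u * (g * u⁻¹ * g⁻¹)) := by
    simp only [commutatorElement_def]; group
  rw [h1]
  exact U.mul_mem (h.conj_mem _ (P.S_le_U (P.D_central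
    (Subgroup.commutator_mem_commutator hd (Subgroup.mem_top g)))) _)
    (U.mul_mem hu (h.conj_mem _ (U.inv_mem hu) _))

theorem commutator_T_mem (P : PivotData n r e q A K U D S W T) {t : G} (ht : t ∈ T) (g : G) :
    ⁅t, g⁆ ∈ U := by
  obtain ⟨u, hu, d, hd, rfl⟩ := P.T_fac t ht
  exact P.commutator_mul_mem hu hd g

theorem isMulCommutative_map (H H' : Subgroup G) [H'.Normal] (h : ⁅H, H⁆ ≤ H') :
    IsMulCommutative (H.map (QuotientGroup.mk' H')) := by
  rw [← Subgroup.commutator_self_eq_bot_iff, ← Subgroup.map_commutator,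
    Subgroup.map_eq_bot_iff, QuotientGroup.ker_mk']
  exact h

/-- Elements of `D` acting without fixed points on the steps of the filtration where `D` acts
nontrivially have no fixed points on `D`-perfect sections of `S`. -/
theorem mem_of_commutator_mem [Finite G] (P : PivotData n r e q A K U D S W T) {H H' : Subgroup G}
    [H.Normal] [H'.Normal] (hHS : H ≤ S) (hHS' : ⁅H, S⁆ ≤ H')
    (hHD : H ≤ ⁅H, D⁆ ⊔ H') {d : G} (hd : d ∈ D)
    (hrich : ∀ k < r, (∀ d ∈ D, ∀ x ∈ W k, ⁅d, x⁆ ∈ W (k + 1)) ∨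
      (∀ x ∈ W k, ⁅d, x⁆ ∈ W (k + 1) → x ∈ W (k + 1))) :
    ∀ x ∈ H, ⁅d, x⁆ ∈ H' → x ∈ H' := by
  set π := QuotientGroup.mk' H' with hπ
  set M := H.map π with hM
  have hHH : ⁅H, H⁆ ≤ H' := (Subgroup.commutator_mono le_rfl hHS).trans hHS'
  have hMc : IsMulCommutative M := isMulCommutative_map H H' hHH
  have hMn : M.Normal := Subgroup.Normal.map inferInstance _ (QuotientGroup.mk'_surjective H')
  have hmemM : ∀ x : Additive M, ∃ h ∈ H, π h = x.toMul := fun x => x.toMul.2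
  have hcomm : ∀ d' ∈ D, Commute (conjEnd M (π d)) (conjEnd M (π d')) := by
    intro d' _
    refine commute_conjEnd M ?_
    rintro _ ⟨h, hh, rfl⟩
    rw [← map_commutatorElement, ← map_commutatorElement, ← MonoidHom.mem_ker,
      QuotientGroup.ker_mk', ← inv_mem_iff, commutatorElement_inv]
    exact hHS' (Subgroup.commutator_mem_commutator hh (P.D_central
      (Subgroup.commutator_mem_commutator hd (Subgroup.mem_top _))))
  have hsurj := surjective_sub_one_of_filtration (V := Additive M)
    (𝒟 := (fun g => conjEnd M (π g)) '' D) (e := conjEnd M (π d))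
    (by rintro _ ⟨d', hd', rfl⟩; exact hcomm d' hd')
    (fun k => Subgroup.toAddSubgroup (((H ⊓ W k).map π).subgroupOf M)) r
    (by
      rw [P.W_zero, inf_eq_left.2 (hHS.trans P.S_le_U), ← hM, Subgroup.subgroupOf_self]
      rfl)
    (by
      rw [P.W_last, inf_bot_eq, Subgroup.map_bot, Subgroup.bot_subgroupOf]; rfl)
    (by
      intro N hN
      set N₀ : Subgroup (G ⧸ H') := (AddSubgroup.toSubgroup' N).map M.subtype with hN₀
      have hle : M ≤ N₀ := by
        rw [hM, Subgroup.map_le_iff_le_comap]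
        refine hHD.trans (sup_le ?_ ?_)
        · rw [Subgroup.commutator_le]
          intro h hh d' hd'
          rw [Subgroup.mem_comap, ← inv_mem_iff, ← map_inv, commutatorElement_inv]
          have := hN _ ⟨d', hd', rfl⟩ (Additive.ofMul (⟨π h, h, hh, rfl⟩ : M))
          refine ⟨_, this, ?_⟩
          change (((conjEnd M (π d')) _ - _).toMul : G ⧸ H') = _
          rw [coe_conjEnd_sub, map_commutatorElement]
          rfl
        · intro x hx
          have : π x = 1 := by rwa [← MonoidHom.mem_ker, QuotientGroup.ker_mk']
          rw [Subgroup.mem_comap, this]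
          exact N₀.one_mem
      rw [eq_top_iff]
      intro x _
      obtain ⟨y, hy, hyx⟩ := hle x.toMul.2
      have : y = x.toMul := Subtype.ext hyx
      rw [this] at hy
      exact hy)
    (by
      intro k hk
      rcases hrich k hk with h | h
      · left
        rintro _ ⟨d', hd', rfl⟩ x ⟨y, hy, hyx⟩
        refine ⟨⁅d', y⁆, ⟨?_, h d' hd' y hy.2⟩, ?_⟩
        · exact H.mul_mem (Subgroup.Normal.conj_mem inferInstance y hy.1 d') (H.inv_mem hy.1)
        · rw [map_commutatorElement]
          refine Eq.trans ?_ (coe_conjEnd_sub M (π d') x).symm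
          rw [hyx]
          rfl
      · right
        rintro x ⟨y, hy, hyx⟩
        -- Absence of fixed points restricts to `H ⊓ W k`. By finiteness it becomes surjectivity,
        -- which survives passage to the quotient by `H'`.
        obtain ⟨z, hz, hzy⟩ := exists_commutator_inv_mul_mem (S := H ⊓ W k) (S₁ := H ⊓ W (k + 1))
          (d := d)
          (fun w hw => ⟨Subgroup.Normal.conj_mem inferInstance w hw.1 d, P.W_conj k d hd w hw.2⟩)
          (by
            rw [Subgroup.commutator_le]
            intro a ha b hb
            exact ⟨H.mul_mem (H.mul_mem (H.mul_mem ha.1 hb.1) (H.inv_mem ha.1)) (H.inv_mem hb.1),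
              P.W_comm k a (P.W_le k ha.2) b hb.2⟩)
          (fun w hw => ⟨Subgroup.Normal.conj_mem inferInstance w hw.1 d,
            P.W_conj (k + 1) d hd w hw.2⟩)
          (fun w hw hdw => ⟨hw.1, h w hw.2 hdw.2⟩) y hy
        refine ⟨Additive.ofMul (⟨π z, z, hz.1, rfl⟩ : M), ⁅d, z⁆ * y⁻¹, ?_, ?_⟩
        · have h1 : ⁅d, z⁆ * y⁻¹ = ⁅⁅d, z⁆, (⁅d, z⁆⁻¹ * y)⁻¹⁆ * (⁅d, z⁆⁻¹ * y)⁻¹ := by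
            simp only [commutatorElement_def]; group
          have h2 : ⁅d, z⁆ ∈ H ⊓ W k :=
            (H ⊓ W k).mul_mem ⟨Subgroup.Normal.conj_mem inferInstance z hz.1 d,
              P.W_conj k d hd z hz.2⟩ ((H ⊓ W k).inv_mem hz)
          rw [h1]
          have h3 := (H ⊓ W (k + 1)).inv_mem hzy
          refine (H ⊓ W (k + 1)).mul_mem ⟨?_, ?_⟩ h3
          · exact H.mul_mem (H.mul_mem (H.mul_mem h2.1 h3.1) (H.inv_mem h2.1)) (H.inv_mem h3.1)
          · exact P.W_comm k _ (P.W_le k h2.2) _ (P.W_anti k h3.2)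
        · rw [map_mul, map_commutatorElement, map_inv, hyx]
          rw [sub_eq_add_neg _ x]
          exact congrArg (· * (x.toMul : G ⧸ H')⁻¹) (coe_conjEnd_sub M (π d)
            (Additive.ofMul (⟨π z, z, hz.1, rfl⟩ : M))).symm)
  have hinj : Function.Injective (conjEnd M (π d) - 1 : AddMonoid.End (Additive M)) :=
    Finite.injective_iff_surjective.2 hsurj
  intro x hx hdx
  have h0 : (conjEnd M (π d) - 1 : AddMonoid.End (Additive M))
      (Additive.ofMul (⟨π x, x, hx, rfl⟩ : M)) = 0 := by
    apply Additive.toMul.injective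
    apply Subtype.ext
    refine (coe_conjEnd_sub M (π d) _).trans ?_
    change ⁅π d, π x⁆ = 1
    rw [← map_commutatorElement, ← MonoidHom.mem_ker, QuotientGroup.ker_mk']
    exact hdx
  have h1 := hinj (h0.trans (map_zero _).symm)
  have h2 : π x = 1 := congrArg (fun y : Additive M => (y.toMul : G ⧸ H')) h1
  rwa [← MonoidHom.mem_ker, QuotientGroup.ker_mk'] at h2

end PivotData

end PivotData

/-! ### Coprime exponents -/

section Coprime

variable {G : Type*} [Group G]

theorem Subgroup.mem_of_pow_mem_of_coprime (H : Subgroup G) {x : G} {e q : ℕ} (h : e.Coprime q)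
    (he : x ^ e ∈ H) (hq : x ^ q ∈ H) : x ∈ H := by
  have h1 : x = (x ^ e) ^ (e.gcdA q) * (x ^ q) ^ (e.gcdB q) := by
    rw [← zpow_natCast, ← zpow_natCast, ← zpow_mul, ← zpow_mul, ← zpow_add, ← Nat.gcd_eq_gcd_ab,
      h.gcd_eq_one]
    simp
  rw [h1]
  exact H.mul_mem (H.zpow_mem he _) (H.zpow_mem hq _)

theorem eq_one_of_pow_eq_one_of_coprime {x : G} {e q : ℕ} (h : e.Coprime q)
    (he : x ^ e = 1) (hq : x ^ q = 1) : x = 1 := by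
  rw [← Subgroup.mem_bot] at *
  exact Subgroup.mem_of_pow_mem_of_coprime ⊥ h he hq

theorem Subgroup.mul_pow_mul_inv_pow_mem {U : Subgroup G} [U.Normal] {u : G} (hu : u ∈ U) (d : G)
    (e : ℕ) : (u * d) ^ e * (d ^ e)⁻¹ ∈ U := by
  rw [← QuotientGroup.eq_one_iff]
  have : (QuotientGroup.mk u : G ⧸ U) = 1 := (QuotientGroup.eq_one_iff u).2 hu
  simp [this]

/-- If `w = ⁅τ, h⁆` lies in a normal subgroup of exponent `e` which contains `τ ^ q`, with `e`
and `q` coprime, then `τ ^ e` commutes with `h` as soon as it commutes with `w`. -/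
theorem commute_pow_of_commute_commutator {U : Subgroup G} [U.Normal] {e q : ℕ}
    (hU : ∀ u ∈ U, u ^ e = 1) (heq : e.Coprime q) {τ h : G} (hτ : τ ^ q ∈ U)
    (hw : ⁅τ, h⁆ ∈ U) (hc : Commute (τ ^ e) ⁅τ, h⁆) : Commute (τ ^ e) h := by
  set w := ⁅τ, h⁆ with hwdef
  have h1 : h * τ * h⁻¹ = w⁻¹ * τ := by rw [hwdef, commutatorElement_def]; group
  have h2 : h * τ ^ e * h⁻¹ = (w⁻¹ * τ) ^ e := by rw [← conj_pow, h1]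
  have hcy : Commute (τ ^ e) ((w⁻¹ * τ) ^ e) :=
    ((hc.inv_right).mul_right (Commute.pow_self τ e)).pow_right e
  -- This element is the quotient of `h * τ ^ e * h⁻¹` by `τ ^ e`. It is killed by `e`, being in
  -- `U`, and by `q`, since its two factors commute and each has `q`-th power `1`.
  have hz : (w⁻¹ * τ) ^ e * (τ ^ e)⁻¹ ∈ U :=
    Subgroup.mul_pow_mul_inv_pow_mem (U.inv_mem hw) τ e
  have hz2 : ((w⁻¹ * τ) ^ e * (τ ^ e)⁻¹) ^ q = 1 := by
    rw [(hcy.symm.inv_right).mul_pow, inv_pow, ← pow_mul, ← pow_mul, mul_comm e q, pow_mul,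
      pow_mul, hU _ hτ, inv_one, mul_one]
    apply hU
    rw [← h1, conj_pow]
    exact Subgroup.Normal.conj_mem inferInstance _ hτ _
  have h3 := eq_one_of_pow_eq_one_of_coprime heq (hU _ hz) hz2
  rw [mul_inv_eq_one, ← h2] at h3
  change _ * _ = _ * _
  rw [← mul_inv_eq_iff_eq_mul.1 h3]

theorem Subgroup.normal_of_forall_conj_mem {A : Set G} (hA : Subgroup.closure A = ⊤)
    (hinv : A⁻¹ = A) {C : Subgroup G} (h : ∀ a ∈ A, ∀ x ∈ C, a * x * a⁻¹ ∈ C) : C.Normal := by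
  rw [← Subgroup.normalizer_eq_top_iff, eq_top_iff, ← hA, Subgroup.closure_le]
  intro a ha
  rw [SetLike.mem_coe, Subgroup.mem_normalizer_iff]
  intro x
  refine ⟨h a ha x, fun hx => ?_⟩
  have := h a⁻¹ (by rw [← hinv]; exact Set.inv_mem_inv.2 ha) _ hx
  simpa [mul_assoc] using this

/-- Conjugating by an element of `A` rather than of `A ^ 2` costs one extra factor `A ^ 2`, split
between the two ends. -/
theorem conj_mem_sq_pow {A : Set G} (hinv : A⁻¹ = A) {a x : G} {j : ℕ} (ha : a ∈ A)
    (hx : x ∈ (A ^ 2) ^ j) : a * x * a⁻¹ ∈ (A ^ 2) ^ (j + 1) := by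
  have ha' : a⁻¹ ∈ A := by rw [← hinv]; exact Set.inv_mem_inv.2 ha
  have : (A ^ 2) ^ (j + 1) = A * (A ^ 2) ^ j * A := by
    rw [← pow_mul, ← pow_mul, ← pow_succ', ← pow_succ]
    congr 1
  rw [this]
  exact Set.mul_mem_mul (Set.mul_mem_mul ha hx) ha'

end Coprime

/-! ### Coprime action of `D`, and generation of sections by bounded powers -/

namespace PivotData

variable {G : Type*} [Group G]
variable {n r e q : ℕ} {A : Set G} {K : ℝ} {U D S : Subgroup G} {W : ℕ → Subgroup G} {T : Set G}

/-- `U` acts trivially on the steps of `W`, so `t⁻¹ * t'` and its `D`-part `d⁻¹ * d'` act there in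
the same way. -/
theorem rich_of_eq (P : PivotData n r e q A K U D S W T) {t t' u u' d d' : G} (ht : t ∈ T)
    (ht' : t' ∈ T) (hne : t ≠ t') (hu : u ∈ U) (hu' : u' ∈ U)
    (htu : t = u * d) (htu' : t' = u' * d') :
    ∀ k < r, (∀ d ∈ D, ∀ x ∈ W k, ⁅d, x⁆ ∈ W (k + 1)) ∨
      (∀ x ∈ W k, ⁅d⁻¹ * d', x⁆ ∈ W (k + 1) → x ∈ W (k + 1)) := by
  intro k hk
  refine (P.rich t ht t' ht' hne k hk).imp_right fun h x hx hdx => h x hx ?_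
  have hU := P.normal_U
  set v : G := d⁻¹ * (u⁻¹ * u') * d with hv
  have hvU : v ∈ U := by
    have := hU.conj_mem _ (U.mul_mem (U.inv_mem hu) hu') d⁻¹
    rwa [inv_inv] at this
  have h1 : t⁻¹ * t' = v * (d⁻¹ * d') := by rw [htu, htu', hv]; group
  have h2 : ⁅v * (d⁻¹ * d'), x⁆ = ⁅v, ⁅d⁻¹ * d', x⁆⁆ * ⁅d⁻¹ * d', x⁆ * ⁅v, x⁆ := by
    simp only [commutatorElement_def]; group
  rw [h1, h2]
  exact (W (k + 1)).mul_mem ((W (k + 1)).mul_mem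
    (P.W_anti _ (P.W_comm (k + 1) v hvU _ hdx)) hdx) (P.W_comm k v hvU x hx)

/-- `D` acts on sections of `S` like a group of order prime to that of `U`. -/
theorem commutator_le_commutator_commutator (P : PivotData n r e q A K U D S W T)
    {H H' : Subgroup G} [H.Normal] [H'.Normal] (hHS : H ≤ S) (hHS' : ⁅H, S⁆ ≤ H') :
    ⁅H, D⁆ ≤ ⁅⁅H, D⁆, D⁆ ⊔ H' := by
  have hD := P.normal_D
  set N : Subgroup G := ⁅⁅H, D⁆, D⁆ ⊔ H' with hN
  rw [Subgroup.commutator_le]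
  intro h hh d hd
  have hz : ⁅h, d⁆ ∈ ⁅H, D⁆ := Subgroup.commutator_mem_commutator hh hd
  have hzU : ⁅h, d⁆ ∈ U := P.S_le_U (hHS (Subgroup.commutator_le_left H D hz))
  rw [← QuotientGroup.ker_mk' N, MonoidHom.mem_ker]
  set π := QuotientGroup.mk' N with hπ
  have hker : ∀ x ∈ N, π x = 1 := fun x hx => by
    rwa [← MonoidHom.mem_ker, QuotientGroup.ker_mk']
  refine eq_one_of_pow_eq_one_of_coprime P.coprime
    (by rw [← map_pow, P.pow_eq _ hzU, map_one]) ?_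
  have hcomm : Commute (π ⁅h, d⁆) (π d) := by
    rw [← commutatorElement_eq_one_iff_commute, ← map_commutatorElement]
    exact hker _ (Subgroup.mem_sup_left (Subgroup.commutator_mem_commutator hz hd))
  have h1 : π h * π d * (π h)⁻¹ = π ⁅h, d⁆ * π d := by
    rw [← map_mul, ← map_inv, ← map_mul, ← map_mul, commutatorElement_def]
    congr 1; group
  -- The commutator commutes with `d` modulo `N`. As `d ^ q ∈ S` is centralized by `h` modulo `H'`,
  -- its `q`-th power vanishes, as does its `e`-th.
  have h2 : π h * π d ^ q * (π h)⁻¹ = π ⁅h, d⁆ ^ q * π d ^ q := by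
    rw [← conj_pow, h1, hcomm.mul_pow]
  have h3 : π h * π d ^ q * (π h)⁻¹ = π d ^ q := by
    have : π ⁅h, d ^ q⁆ = 1 := hker _ (Subgroup.mem_sup_right
      (hHS' (Subgroup.commutator_mem_commutator hh (P.pow_mem d hd))))
    rw [map_commutatorElement, commutatorElement_eq_one_iff_mul_comm, map_pow] at this
    rw [this, mul_inv_cancel_right]
  rw [h3] at h2
  exact mul_eq_right.1 h2.symm

/-- If `S` is covered modulo `H ≤ ⁅S, U⁆` by a power of `A`, then `H` is generated modulo `⁅H, U⁆`
by the normal closure of its intersection with a power of `A`. -/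
theorem le_of_covers (P : PivotData n r e q A K U D S W T) {H N : Subgroup G} [H.Normal]
    [N.Normal] {m : ℕ} (hHSU : H ≤ ⁅S, U⁆) (hHU : ⁅H, U⁆ ≤ N)
    (hcov : ∀ x ∈ S, ∃ b ∈ (A ^ 2) ^ m, b⁻¹ * x ∈ H)
    (hN : ∀ x ∈ (A ^ 2) ^ (3 * m + 1), x ∈ H → x ∈ N) : H ≤ N := by
  have hS := P.normal_S
  have hU := P.normal_U
  have hB := P.growth
  have hHS : H ≤ S := hHSU.trans (Subgroup.commutator_le_left S U)
  -- The products of `(A ^ 2) ^ m ∩ S` with `N ⊓ H` form a normal subgroup: rewriting a product or a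
  -- conjugate by a representative leaves an error in `H` of length at most `3 * m + 1`, hence in
  -- `N`. Since `⁅H, U⁆ ≤ N`, it contains `⁅S, U⁆ ≥ H`, and its elements in `H` lie in `N`.
  let C : Subgroup G :=
    { carrier := {x | ∃ b ∈ (A ^ 2) ^ m, b ∈ S ∧ ∃ z ∈ N ⊓ H, x = b * z}
      one_mem' := ⟨1, hB.one_mem_pow m, S.one_mem, 1, (N ⊓ H).one_mem, by simp⟩
      mul_mem' := by
        rintro _ _ ⟨b, hb, hbS, z, hz, rfl⟩ ⟨b', hb', hbS', z', hz', rfl⟩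
        obtain ⟨c, hc, hcH⟩ := hcov (b * b') (S.mul_mem hbS hbS')
        have hcN : c⁻¹ * (b * b') ∈ N ⊓ H := by
          refine ⟨hN _ ?_ hcH, hcH⟩
          exact hB.pow_mono (by lia : m + (m + m) ≤ 3 * m + 1)
            (SmallGrowth.mul_mem (hB.inv_mem hc) (SmallGrowth.mul_mem hb hb'))
        refine ⟨c, hc, ?_, c⁻¹ * (b * b') * (b'⁻¹ * z * b') * z', ?_, by group⟩
        · have : c = (b * b') * (c⁻¹ * (b * b'))⁻¹ := by group
          rw [this]
          exact S.mul_mem (S.mul_mem hbS hbS') (S.inv_mem (hHS hcH))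
        · refine mul_mem (mul_mem hcN ?_) hz'
          have := (inferInstance : (N ⊓ H).Normal).conj_mem z hz b'⁻¹
          rwa [inv_inv] at this
      inv_mem' := by
        rintro _ ⟨b, hb, hbS, z, hz, rfl⟩
        exact ⟨b⁻¹, hB.inv_mem hb, S.inv_mem hbS, b * z⁻¹ * b⁻¹,
          (inferInstance : (N ⊓ H).Normal).conj_mem _ (inv_mem hz) b, by group⟩ }
  have hCn : C.Normal := by
    refine Subgroup.normal_of_forall_conj_mem P.closure_eq P.inv_eq ?_
    rintro a ha _ ⟨b, hb, hbS, z, hz, rfl⟩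
    have hb1 := conj_mem_sq_pow P.inv_eq ha hb
    have hbS1 : a * b * a⁻¹ ∈ S := hS.conj_mem b hbS a
    obtain ⟨c, hc, hcH⟩ := hcov _ hbS1
    have hcN : c⁻¹ * (a * b * a⁻¹) ∈ N ⊓ H := by
      refine ⟨hN _ ?_ hcH, hcH⟩
      exact hB.pow_mono (by lia : m + (m + 1) ≤ 3 * m + 1)
        (SmallGrowth.mul_mem (hB.inv_mem hc) hb1)
    refine ⟨c, hc, ?_, c⁻¹ * (a * b * a⁻¹) * (a * z * a⁻¹), ?_, by group⟩
    · have : c = (a * b * a⁻¹) * (c⁻¹ * (a * b * a⁻¹))⁻¹ := by group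
      rw [this]
      exact S.mul_mem hbS1 (S.inv_mem (hHS hcH))
    · exact mul_mem hcN ((inferInstance : (N ⊓ H).Normal).conj_mem z hz a)
  have hNC : ∀ z ∈ N ⊓ H, z ∈ C := fun z hz =>
    ⟨1, hB.one_mem_pow m, S.one_mem, z, hz, by simp⟩
  have hSUC : ⁅S, U⁆ ≤ C := by
    rw [Subgroup.commutator_le]
    intro s hs u hu
    obtain ⟨b, hb, hbH⟩ := hcov s hs
    have hbC : b ∈ C := ⟨b, hb, by
      have : b = s * (b⁻¹ * s)⁻¹ := by group
      rw [this]; exact S.mul_mem hs (S.inv_mem (hHS hbH)), 1, (N ⊓ H).one_mem, by simp⟩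
    have h1 : ⁅s, u⁆ = b * ⁅b⁻¹ * s, u⁆ * b⁻¹ * (b * (u * b⁻¹ * u⁻¹)) := by
      simp only [commutatorElement_def]; group
    rw [h1]
    refine C.mul_mem (hCn.conj_mem _ (hNC _ ⟨?_, ?_⟩) b)
      (C.mul_mem hbC (hCn.conj_mem _ (C.inv_mem hbC) u))
    · exact hHU (Subgroup.commutator_mem_commutator hbH hu)
    · exact Subgroup.commutator_le_left H U (Subgroup.commutator_mem_commutator hbH hu)
  intro x hx
  obtain ⟨b, hb, hbS, z, hz, hxz⟩ := hSUC (hHSU hx)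
  have hbH : b ∈ H := by
    have : b = x * z⁻¹ := by rw [hxz]; group
    rw [this]; exact H.mul_mem hx (H.inv_mem hz.2)
  rw [hxz]
  exact N.mul_mem (hN b (hB.pow_mono (by lia : m ≤ 3 * m + 1) hb) hbH) hz.1

end PivotData

namespace PivotData

variable {G : Type*} [Group G]
variable {n r e q : ℕ} {A : Set G} {K : ℝ} {U D S : Subgroup G} {W : ℕ → Subgroup G} {T : Set G}

theorem commutator_mem_sup (P : PivotData n r e q A K U D S W T) {u d x : G} (hu : u ∈ U)
    (hd : d ∈ D) {j : ℕ} (hx : x ∈ U.lowerCentralSeries j ⊔ S) :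
    ⁅u * d, x⁆ ∈ U.lowerCentralSeries (j + 1) ⊔ S := by
  have hU := P.normal_U
  have hS := P.normal_S
  have hx' : x ∈ ((U.lowerCentralSeries j ⊔ S : Subgroup G) : Set G) := hx
  rw [Subgroup.mul_normal] at hx'
  obtain ⟨y, hy, s, hs, rfl⟩ := hx'
  have h1 : ⁅u * d, y * s⁆ = u * ⁅d, y * s⁆ * u⁻¹ * ((⁅y, u⁆)⁻¹ *
      (y * (u * s * u⁻¹ * s⁻¹) * y⁻¹)) := by
    simp only [commutatorElement_def]; group
  change ⁅u * d, y * s⁆ ∈ _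
  rw [h1]
  refine mul_mem (Subgroup.mem_sup_right (hS.conj_mem _ (P.D_central
    (Subgroup.commutator_mem_commutator hd (Subgroup.mem_top _))) u))
    (mul_mem (Subgroup.mem_sup_left (inv_mem (Subgroup.commutator_mem_commutator hy hu)))
    (Subgroup.mem_sup_right (hS.conj_mem _ (S.mul_mem (hS.conj_mem s hs u) (S.inv_mem hs)) y)))

/-- `S` is generated modulo `⁅S, U⁆` by the normal closure of its intersection with a power
of `A`. -/
theorem le_of_pow_inter_le [Finite G] (P : PivotData n r e q A K U D S W T) {N : Subgroup G}
    [N.Normal] (hSU : ⁅S, U⁆ ≤ N) {t t' : G} (ht : t ∈ T) (ht' : t' ∈ T) (hne : t ≠ t')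
    (hN : ∀ x ∈ (A ^ 2) ^ (17 * 2 ^ n), x ∈ S → x ∈ N) : S ≤ N := by
  have hS := P.normal_S
  have hU := P.normal_U
  have hB := P.growth
  obtain ⟨u₁, hu₁, d₁, hd₁, htu⟩ := P.T_fac t ht
  obtain ⟨u₂, hu₂, d₂, hd₂, htu'⟩ := P.T_fac t' ht'
  set d := d₁⁻¹ * d₂ with hd
  have hdD : d ∈ D := D.mul_mem (D.inv_mem hd₁) hd₂
  have hrich := P.rich_of_eq ht ht' hne hu₁ hu₂ htu htu'
  set τ := t⁻¹ * t' with hτ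
  obtain ⟨v, hv, hτv⟩ : ∃ v ∈ U, τ = v * d := by
    refine ⟨d₁⁻¹ * (u₁⁻¹ * u₂) * d₁, ?_, by rw [hτ, htu, htu', hd]; group⟩
    have := hU.conj_mem _ (U.mul_mem (U.inv_mem hu₁) hu₂) d₁⁻¹
    rwa [inv_inv] at this
  have hτB : τ ∈ (A ^ 2) ^ 4 := SmallGrowth.mul_mem (hB.inv_mem (P.T_sub ht)) (P.T_sub ht')
  set π := QuotientGroup.mk' N with hπ
  have hker : ∀ x, π x = 1 ↔ x ∈ N := fun x => by
    rw [← MonoidHom.mem_ker, QuotientGroup.ker_mk']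
  have hcentral : ∀ g ∈ A, Commute (π τ ^ e) (π g) := by
    intro g hg
    -- Iterated commutators descend the lower central series of `U` modulo `S`, so `h (n + 1)` is in
    -- `S`, has bounded length and hence lies in `N`. Climbing back with
    -- `commute_pow_of_commute_commutator` shows that `τ ^ e` commutes with `g` modulo `N`.
    set h : ℕ → G := fun j => (fun x => ⁅τ, x⁆)^[j] g with hh
    have hsucc : ∀ j, h (j + 1) = ⁅τ, h j⁆ := fun j => Function.iterate_succ_apply' _ _ _
    have h1B : h 1 ∈ (A ^ 2) ^ 9 := by
      have : h 1 = τ * (g * τ⁻¹ * g⁻¹) := by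
        rw [hsucc 0]; simp only [hh, Function.iterate_zero, id, commutatorElement_def]; group
      rw [this]
      exact SmallGrowth.mul_mem hτB (conj_mem_sq_pow P.inv_eq hg (hB.inv_mem hτB))
    -- The lengths start at `9` and satisfy `k ↦ 2 * k + 8`, so `k + 8` doubles.
    have hjB : ∀ j, ∃ k, k + 8 = 17 * 2 ^ j ∧ h (j + 1) ∈ (A ^ 2) ^ k := by
      intro j
      induction j with
      | zero => exact ⟨9, by norm_num, h1B⟩
      | succ j ih =>
        obtain ⟨k, hk, hkB⟩ := ih
        refine ⟨4 + k + 4 + k, by rw [pow_succ]; lia, ?_⟩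
        rw [hsucc (j + 1)]
        exact hB.commutator_mem hτB hkB
    have hjU : ∀ j, h (j + 1) ∈ U.lowerCentralSeries j ⊔ S := by
      intro j
      induction j with
      | zero =>
        rw [hsucc 0, hτv]
        exact Subgroup.mem_sup_left (P.commutator_mul_mem hv hdD _)
      | succ j ih =>
        rw [hsucc (j + 1), hτv]
        exact P.commutator_mem_sup hv hdD ih
    have hlast : h (n + 1) ∈ N := by
      obtain ⟨k, hk, hkB⟩ := hjB n
      refine hN _ (hB.pow_mono (by lia : k ≤ 17 * 2 ^ n) hkB) ?_
      have := hjU n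
      rwa [P.nilp, bot_sup_eq] at this
    have hdesc : ∀ j ≤ n + 1, Commute (π τ ^ e) (π (h (n + 1 - j))) := by
      intro j
      induction j with
      | zero =>
        intro _
        rw [Nat.sub_zero, (hker _).2 hlast]
        exact Commute.one_right _
      | succ j ih =>
        intro hj
        have ih := ih (by lia)
        set i := n + 1 - (j + 1) with hi
        have hi1 : n + 1 - j = i + 1 := by lia
        rw [hi1, hsucc i, map_commutatorElement] at ih
        have hUn : (U.map π).Normal := hU.map _ (QuotientGroup.mk'_surjective N)
        refine commute_pow_of_commute_commutator (U := U.map π) (q := q) ?_ P.coprime ?_ ?_ ih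
        · rintro _ ⟨u, hu, rfl⟩
          rw [← map_pow, P.pow_eq u hu, map_one]
        · refine ⟨τ ^ q, ?_, map_pow _ _ _⟩
          have h1 := Subgroup.mul_pow_mul_inv_pow_mem hv d q
          rw [← hτv] at h1
          have h2 := U.mul_mem h1 (P.S_le_U (P.pow_mem d hdD))
          rwa [inv_mul_cancel_right] at h2
        · rw [← map_commutatorElement]
          refine ⟨_, ?_, rfl⟩
          rw [hτv]
          exact P.commutator_mul_mem hv hdD _
    have := hdesc (n + 1) le_rfl
    rwa [Nat.sub_self] at this
  have hcentral' : ∀ g, Commute (π τ ^ e) (π g) := by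
    intro g
    have hle : Subgroup.closure A ≤ (Subgroup.centralizer {π τ ^ e}).comap π := by
      rw [Subgroup.closure_le]
      intro g hg
      rw [SetLike.mem_coe, Subgroup.mem_comap, Subgroup.mem_centralizer_singleton_iff]
      exact (hcentral g hg).eq.symm
    have := hle (P.closure_eq ▸ Subgroup.mem_top g : g ∈ Subgroup.closure A)
    rw [Subgroup.mem_comap, Subgroup.mem_centralizer_singleton_iff] at this
    exact this.symm
  intro x hx
  refine P.mem_of_commutator_mem le_rfl ((Subgroup.commutator_mono le_rfl P.S_le_U).trans hSU)
    (P.S_le.trans le_sup_left) hdD hrich x hx ?_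
  rw [← hker, map_commutatorElement, commutatorElement_eq_one_iff_commute]
  have hSS : ⁅S, S⁆ ≤ N := (Subgroup.commutator_mono le_rfl P.S_le_U).trans hSU
  have hmem : ∀ g, g ∈ (Subgroup.centralizer {π x}).comap π ↔ Commute (π g) (π x) := fun g => by
    rw [Subgroup.mem_comap, Subgroup.mem_centralizer_singleton_iff]; rfl
  rw [← hmem]
  -- `d ^ e` differs from the central `τ ^ e` by an element of `U`, and `d ^ q ∈ S`; both centralize
  -- `S` modulo `N`. So `d` does too, although it has no fixed points on `S / (S ⊓ N)`.
  refine Subgroup.mem_of_pow_mem_of_coprime _ P.coprime ?_ ?_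
  · rw [hmem]
    have hw := Subgroup.mul_pow_mul_inv_pow_mem hv d e
    rw [← hτv] at hw
    have h1 : Commute (π (τ ^ e * (d ^ e)⁻¹)) (π x) := by
      rw [← commutatorElement_eq_one_iff_commute, ← map_commutatorElement, hker, ← inv_mem_iff,
        commutatorElement_inv]
      exact hSU (Subgroup.commutator_mem_commutator hx hw)
    have h2 : π (d ^ e) = (π (τ ^ e * (d ^ e)⁻¹))⁻¹ * π τ ^ e := by
      rw [← map_pow, ← map_inv, ← map_mul]; congr 1; group
    rw [h2]
    exact h1.inv_left.mul_left (hcentral' x)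
  · rw [hmem, ← commutatorElement_eq_one_iff_commute, ← map_commutatorElement, hker]
    exact hSS (Subgroup.commutator_mem_commutator (P.pow_mem d hdD) hx)

end PivotData

/-! ### Covering sections with fixed-point-free action -/

namespace PivotData

variable {G : Type*} [Group G]
variable {n r e q : ℕ} {A : Set G} {K : ℝ} {U D S : Subgroup G} {W : ℕ → Subgroup G} {T : Set G}

theorem mem_of_commutator_T_mem [Finite G] (P : PivotData n r e q A K U D S W T)
    {H H' : Subgroup G} [H.Normal] [H'.Normal] (hHS : H ≤ S) (hHU : ⁅H, U⁆ ≤ H')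
    (hHD : H ≤ ⁅H, D⁆ ⊔ H') {t t' : G} (ht : t ∈ T) (ht' : t' ∈ T) (hne : t ≠ t') :
    ∀ x ∈ H, ⁅t⁻¹ * t', x⁆ ∈ H' → x ∈ H' := by
  intro x hx hxt
  have hU := P.normal_U
  obtain ⟨u₁, hu₁, d₁, hd₁, htu⟩ := P.T_fac t ht
  obtain ⟨u₂, hu₂, d₂, hd₂, htu'⟩ := P.T_fac t' ht'
  refine P.mem_of_commutator_mem hHS ((Subgroup.commutator_mono le_rfl P.S_le_U).trans hHU) hHD
    (D.mul_mem (D.inv_mem hd₁) hd₂) (P.rich_of_eq ht ht' hne hu₁ hu₂ htu htu') x hx ?_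
  set d := d₁⁻¹ * d₂ with hd
  set v := d₁⁻¹ * (u₁⁻¹ * u₂) * d₁ with hv
  have hvU : v ∈ U := by
    have := hU.conj_mem _ (U.mul_mem (U.inv_mem hu₁) hu₂) d₁⁻¹
    rwa [inv_inv] at this
  have h1 : t⁻¹ * t' = v * d := by rw [htu, htu', hv, hd]; group
  rw [h1] at hxt
  have h2 : ⁅d, x⁆ = v⁻¹ * (⁅v * d, x⁆ * ⁅x, v⁆) * v⁻¹⁻¹ := by
    simp only [commutatorElement_def]; group
  rw [h2]
  exact Subgroup.Normal.conj_mem inferInstance _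
    (H'.mul_mem hxt (hHU (Subgroup.commutator_mem_commutator hx hvU))) _

/-- The part of the `j`-th power of `A ^ 2` in the section `H / H'`. -/
noncomputable def sectionPow (A : Set G) (H H' : Subgroup G) [H'.Normal] [Finite G] (j : ℕ) :
    Finset (Additive (H.map (QuotientGroup.mk' H'))) :=
  (Set.toFinite {x | ∃ b ∈ (A ^ 2) ^ j, b ∈ H ∧
    QuotientGroup.mk' H' b = ((x.toMul : H.map (QuotientGroup.mk' H')) : G ⧸ H')}).toFinset

theorem mem_sectionPow [Finite G] {H H' : Subgroup G} [H'.Normal] {j : ℕ}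
    {x : Additive (H.map (QuotientGroup.mk' H'))} :
    x ∈ sectionPow A H H' j ↔ ∃ b ∈ (A ^ 2) ^ j, b ∈ H ∧ QuotientGroup.mk' H' b = x.toMul := by
  rw [sectionPow, Set.Finite.mem_toFinset]; rfl

/-- Because `H' ≤ H`, these sets are the intersections of powers of the image of `A ^ 2` with the
subgroup `H / H'`, and that image grows with constant `K ^ 3`. -/
theorem card_sectionPow_le [Finite G] (P : PivotData n r e q A K U D S W T) {H H' : Subgroup G}
    [H'.Normal] (hle : H' ≤ H) (j : ℕ) :
    ((sectionPow A H H' j).card : ℝ) ≤ (K ^ 3) ^ (j + 1) * (sectionPow A H H' 2).card := by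
  have key : ∀ j, (sectionPow A H H' j).card =
      ((QuotientGroup.mk' H' '' (A ^ 2)) ^ j ∩ H.map (QuotientGroup.mk' H') : Set _).ncard := by
    intro j
    rw [← Set.ncard_coe_finset, ← Set.ncard_image_of_injective (sectionPow A H H' j : Set _)
      (f := fun x => ((x.toMul : H.map (QuotientGroup.mk' H')) : G ⧸ H'))
      (fun x y h => Additive.toMul.injective (Subtype.ext h))]
    congr 1
    ext y
    rw [← Set.image_pow]
    constructor
    · rintro ⟨x, hx, rfl⟩
      obtain ⟨b, hb, hbH, hbx⟩ := mem_sectionPow.1 hx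
      exact ⟨⟨b, hb, hbx⟩, x.toMul.2⟩
    · rintro ⟨⟨b, hb, rfl⟩, hbM⟩
      refine ⟨Additive.ofMul ⟨_, hbM⟩, ?_, rfl⟩
      refine mem_sectionPow.2 ⟨b, hb, ?_, rfl⟩
      obtain ⟨h, hh, hhb⟩ := hbM
      have : h⁻¹ * b ∈ H' := QuotientGroup.eq.1 hhb
      have := H.mul_mem hh (hle this)
      rwa [mul_inv_cancel_left] at this
  rw [key, key]
  exact (P.growth.image _).ncard_image_pow_inter_le _ j

theorem sectionPow_mono [Finite G] (P : PivotData n r e q A K U D S W T) {H H' : Subgroup G}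
    [H'.Normal] : Monotone (sectionPow A H H') := by
  intro i j hij x hx
  obtain ⟨b, hb, hbH, hbx⟩ := mem_sectionPow.1 hx
  exact mem_sectionPow.2 ⟨b, P.growth.pow_mono hij hb, hbH, hbx⟩

/-- The constant controlling the size of `T` in the fixed point free step. -/
def fpfExponent (m : ℕ) : ℕ := 6 + 18 * (20 * (m + 4 + 1) + 1)

/-- A `D`-perfect section of `S` on which `U` acts trivially, and which is generated by a power of
`A`, is covered by a power of `A`. -/
theorem covers_of_fixedPointFree [Finite G] (P : PivotData n r e q A K U D S W T)
    {H H' : Subgroup G} [H.Normal] [H'.Normal] (hHS : H ≤ S) (hH' : H' ≤ H) (hHU : ⁅H, U⁆ ≤ H')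
    (hHD : H ≤ ⁅H, D⁆ ⊔ H') {m : ℕ} (hm : 2 ≤ m)
    (hgen : ∀ N : Subgroup G, N.Normal → H' ≤ N → (∀ x ∈ (A ^ 2) ^ m, x ∈ H → x ∈ N) → H ≤ N)
    (hT : K ^ fpfExponent m < T.ncard) :
    ∀ x ∈ H, ∃ b ∈ (A ^ 2) ^ (6 * m + 4), b⁻¹ * x ∈ H' := by
  classical
  have hB := P.growth
  by_cases hHH : H ≤ H'
  · intro x hx
    exact ⟨1, hB.one_mem_pow _, by simpa using hHH hx⟩
  set π := QuotientGroup.mk' H' with hπ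
  have hker : ∀ x, π x = 1 ↔ x ∈ H' := fun x => by
    rw [← MonoidHom.mem_ker, QuotientGroup.ker_mk']
  set M := H.map π with hM
  have hMc : IsMulCommutative M := isMulCommutative_map H H'
    ((Subgroup.commutator_mono le_rfl (hHS.trans P.S_le_U)).trans hHU)
  have hMn : M.Normal := Subgroup.Normal.map inferInstance _ (QuotientGroup.mk'_surjective H')
  let _ : Fintype (Additive M) := Fintype.ofFinite _
  set φ : G → AddMonoid.End (Additive M) := fun g => conjEnd M (π g) with hφ
  have hφcoe : ∀ g h (hh : h ∈ H), φ g (Additive.ofMul (⟨π h, h, hh, rfl⟩ : M)) =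
      Additive.ofMul (⟨π (g * h * g⁻¹), _, Subgroup.Normal.conj_mem inferInstance h hh g, rfl⟩ :
        M) := by
    intro g h hh
    apply Additive.toMul.injective
    apply Subtype.ext
    change π g * π h * (π g)⁻¹ = π (g * h * g⁻¹)
    rw [map_mul, map_mul, map_inv]
  have hrep : ∀ x : Additive M, ∃ h, ∃ hh : h ∈ H, x = Additive.ofMul (⟨π h, h, hh, rfl⟩ : M) := by
    rintro x
    obtain ⟨h, hh, hhx⟩ := x.toMul.2
    exact ⟨h, hh, Additive.toMul.injective (Subtype.ext hhx.symm)⟩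
  have hinjT : ∀ t ∈ T, ∀ t' ∈ T, t ≠ t' →
      Function.Injective (φ t - φ t' : AddMonoid.End (Additive M)) := by
    intro t ht t' ht' hne
    rw [injective_iff_map_eq_zero]
    intro x hx
    obtain ⟨h, hh, rfl⟩ := hrep x
    have h1 : φ t (Additive.ofMul (⟨π h, h, hh, rfl⟩ : M)) =
      φ t' (Additive.ofMul (⟨π h, h, hh, rfl⟩ : M)) := sub_eq_zero.1 hx
    rw [hφcoe t h hh, hφcoe t' h hh] at h1
    have h2 : π (t * h * t⁻¹) = π (t' * h * t'⁻¹) :=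
      congrArg (fun y : Additive M => (y.toMul : G ⧸ H')) h1
    have h3 : ⁅t⁻¹ * t', h⁆ ∈ H' := by
      rw [← hker]
      have : ⁅t⁻¹ * t', h⁆ = t⁻¹ * (t' * h * t'⁻¹) * (t * h * t⁻¹)⁻¹ * t := by
        simp only [commutatorElement_def]; group
      rw [this, map_mul, map_mul, map_mul, ← h2, map_inv π (t * h * t⁻¹), mul_inv_cancel_right,
        map_inv, inv_mul_cancel]
    have h4 := P.mem_of_commutator_T_mem hHS hHU hHD ht ht' hne h hh h3
    apply Additive.toMul.injective
    apply Subtype.ext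
    exact (hker h).2 h4
  have hφinj : Set.InjOn φ T := by
    intro t ht t' ht' heq
    by_contra hne
    apply hHH
    intro x hx
    have h1 := hinjT t ht t' ht' hne
    rw [heq, sub_self] at h1
    have h2 := @h1 (Additive.ofMul (⟨π x, x, hx, rfl⟩ : M)) 0 rfl
    exact (hker x).1 (congrArg (fun y : Additive M => (y.toMul : G ⧸ H')) h2)
  set T' : Finset (AddMonoid.End (Additive M)) := (Set.toFinite (φ '' T)).toFinset with hT'
  have hmemT' : ∀ τ, τ ∈ T' ↔ ∃ t ∈ T, φ t = τ := fun τ => by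
    rw [hT', Set.Finite.mem_toFinset]; rfl
  have hT'card : T'.card = T.ncard := by
    rw [← Set.ncard_coe_finset, hT', Set.Finite.coe_toFinset, hφinj.ncard_image]
  set Ψ : Set (AddMonoid.End (Additive M)) := φ '' A with hΨ
  -- `⁅t, g⁆ ∈ U` acts trivially on `H / H'`, so `T` acts by endomorphisms of the `G`-module.
  have hcommute : ∀ t ∈ T, ∀ g, Commute (φ t) (φ g) := by
    intro t ht g
    refine commute_conjEnd M ?_
    rintro _ ⟨h, hh, rfl⟩
    rw [← map_commutatorElement, ← map_commutatorElement, hker, ← inv_mem_iff,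
      commutatorElement_inv]
    exact hHU (Subgroup.commutator_mem_commutator hh (P.commutator_T_mem ht g))
  have hA : A.Nonempty := by
    have h1 : A ^ 2 ≠ ∅ := Set.nonempty_iff_ne_empty.1 ⟨1, hB.one_mem⟩
    rw [Set.nonempty_iff_ne_empty]
    rintro rfl
    exact h1 (by simp [sq])
  have hpow64 : (64 : ℝ) ≤ K ^ 6 := by
    calc (64 : ℝ) = 2 ^ 6 := by norm_num
      _ ≤ K ^ 6 := by gcongr; exact P.two_le
  have hK0 : 0 ≤ K := by linarith [P.two_le]
  have hgen' : ∀ N : Set (Additive M), 0 ∈ N →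
      (∀ ψ ∈ Ψ, ∀ y ∈ N, ∀ x ∈ sectionPow A H H' m, ψ y + x ∈ N) → N = Set.univ := by
    intro N h0 h
    refine eq_univ_of_add_mem (Ψ := Ψ) (X := (sectionPow A H H' m : Set _)) ?_ (hA.image φ) ?_ ?_
      ?_ h0 h
    · rintro _ ⟨a, ha, rfl⟩
      refine ⟨φ a⁻¹, ⟨a⁻¹, ?_, rfl⟩, ?_, ?_⟩
      · rw [← P.inv_eq]; exact Set.inv_mem_inv.2 ha
      · change conjEnd M (π a) * conjEnd M (π a⁻¹) = 1
        rw [← map_mul, ← map_mul, mul_inv_cancel, map_one, map_one]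
      · change conjEnd M (π a⁻¹) * conjEnd M (π a) = 1
        rw [← map_mul, ← map_mul, inv_mul_cancel, map_one, map_one]
    · exact mem_sectionPow.2 ⟨1, hB.one_mem_pow m, H.one_mem, map_one _⟩
    · intro x hx
      obtain ⟨b, hb, hbH, hbx⟩ := mem_sectionPow.1 hx
      exact mem_sectionPow.2 ⟨b⁻¹, hB.inv_mem hb, H.inv_mem hbH, by rw [map_inv, hbx]; rfl⟩
    · intro N' hN' hXN'
      set N₀ : Subgroup G := ((AddSubgroup.toSubgroup' N').map M.subtype).comap π with hN₀
      have hmemN₀ : ∀ g, g ∈ N₀ ↔ ∃ x ∈ N', ((x.toMul : M) : G ⧸ H') = π g := fun g => Iff.rfl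
      have hN₀n : N₀.Normal := by
        refine Subgroup.normal_of_forall_conj_mem P.closure_eq P.inv_eq ?_
        intro a ha g hg
        rw [hmemN₀] at hg ⊢
        obtain ⟨x, hx, hxg⟩ := hg
        refine ⟨φ a x, hN' _ ⟨a, ha, rfl⟩ x hx, ?_⟩
        rw [map_mul, map_mul, map_inv, ← hxg]
        rfl
      have hle : H ≤ N₀ := by
        refine hgen N₀ hN₀n (fun g hg => ?_) (fun g hg hgH => ?_)
        · rw [hmemN₀, (hker g).2 hg]
          exact ⟨0, N'.zero_mem, rfl⟩
        · rw [hmemN₀]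
          exact ⟨Additive.ofMul (⟨π g, g, hgH, rfl⟩ : M),
            hXN' (mem_sectionPow.2 ⟨g, hg, hgH, rfl⟩), rfl⟩
      rw [eq_top_iff]
      intro x _
      obtain ⟨h, hh, rfl⟩ := hrep x
      obtain ⟨y, hy, hyh⟩ := (hmemN₀ h).1 (hle hh)
      have : y = Additive.ofMul (⟨π h, h, hh, rfl⟩ : M) :=
        Additive.toMul.injective (Subtype.ext hyh)
      exact this ▸ hy
  have key := eq_univ_of_pivot (V := Additive M) (T := T') (Ψ := Ψ)
    (by
      intro τ hτ τ' hτ' hne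
      obtain ⟨t, ht, rfl⟩ := (hmemT' τ).1 hτ
      obtain ⟨t', ht', rfl⟩ := (hmemT' τ').1 hτ'
      exact hinjT t ht t' ht' (fun h => hne (by rw [h])))
    (by
      intro τ hτ τ' hτ'
      obtain ⟨t, ht, rfl⟩ := (hmemT' τ).1 hτ
      obtain ⟨t', ht', rfl⟩ := (hmemT' τ').1 hτ'
      exact hcommute t ht t')
    (by
      rintro τ hτ _ ⟨a, ha, rfl⟩
      obtain ⟨t, ht, rfl⟩ := (hmemT' τ).1 hτ
      exact hcommute t ht a)
    -- The shift is `4` because conjugation by `t ∈ (A ^ 2) ^ 2` uses two factors `A ^ 2` on each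
    -- side.
    (sectionPow A H H') 4 m P.sectionPow_mono
    (fun j => mem_sectionPow.2 ⟨1, hB.one_mem_pow j, H.one_mem, map_one _⟩)
    (by
      intro j x hx
      obtain ⟨b, hb, hbH, hbx⟩ := mem_sectionPow.1 hx
      exact mem_sectionPow.2 ⟨b⁻¹, hB.inv_mem hb, H.inv_mem hbH, by rw [map_inv, hbx]; rfl⟩)
    (by
      intro i j x hx y hy
      obtain ⟨b, hb, hbH, hbx⟩ := mem_sectionPow.1 hx
      obtain ⟨c, hc, hcH, hcy⟩ := mem_sectionPow.1 hy
      exact mem_sectionPow.2 ⟨b * c, SmallGrowth.mul_mem hb hc, H.mul_mem hbH hcH, by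
        rw [map_mul, hbx, hcy]; rfl⟩)
    (by
      intro τ hτ j x hx
      obtain ⟨t, ht, rfl⟩ := (hmemT' τ).1 hτ
      obtain ⟨b, hb, hbH, hbx⟩ := mem_sectionPow.1 hx
      refine mem_sectionPow.2 ⟨t * b * t⁻¹, ?_, Subgroup.Normal.conj_mem inferInstance b hbH t, ?_⟩
      · exact hB.pow_mono (by lia : 2 + j + 2 ≤ j + 4) (SmallGrowth.mul_mem
          (SmallGrowth.mul_mem (P.T_sub ht) hb) (hB.inv_mem (P.T_sub ht)))
      · rw [map_mul, map_mul, map_inv, hbx]; rfl)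
    (by
      rintro _ ⟨a, ha, rfl⟩ j x hx
      obtain ⟨b, hb, hbH, hbx⟩ := mem_sectionPow.1 hx
      refine mem_sectionPow.2 ⟨a * b * a⁻¹, conj_mem_sq_pow P.inv_eq ha hb,
        Subgroup.Normal.conj_mem inferInstance b hbH a, ?_⟩
      rw [map_mul, map_mul, map_inv, hbx]; rfl)
    hgen' (L := (K ^ 3) ^ (20 * (m + 4 + 1) + 1))
    (one_le_pow₀ (one_le_pow₀ (by linarith [P.two_le])))
    (by
      refine (P.card_sectionPow_le hH' _).trans ?_
      gcongr
      exact P.sectionPow_mono hm)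
    (by
      rw [hT'card]
      refine lt_of_le_of_lt ?_ hT
      calc 64 * ((K ^ 3) ^ (20 * (m + 4 + 1) + 1)) ^ 6
          ≤ K ^ 6 * ((K ^ 3) ^ (20 * (m + 4 + 1) + 1)) ^ 6 := by gcongr
        _ = K ^ fpfExponent m := by
          rw [← pow_mul, ← pow_mul, ← pow_add]
          exact congrArg (fun k : ℕ => K ^ k) (by rw [fpfExponent]; ring))
  intro x hx
  obtain ⟨b, hb, hbH, hbx⟩ := mem_sectionPow.1 (key (Additive.ofMul (⟨π x, x, hx, rfl⟩ : M)))
  exact ⟨b, hb, QuotientGroup.eq.1 hbx⟩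

end PivotData

/-! ### Covering sections centralized by `D` -/

namespace PivotData

variable {G : Type*} [Group G]
variable {n r e q : ℕ} {A : Set G} {K : ℝ} {U D S : Subgroup G} {W : ℕ → Subgroup G} {T : Set G}

/-- A proper subgroup of `S` containing `⁅S, S⁆` and normalised by `D` has index at least `|T|`. -/
theorem card_mul_ncard_le [Finite G] (P : PivotData n r e q A K U D S W T) {V : Subgroup G}
    (hVS : V ≤ S) (hSV : ⁅S, S⁆ ≤ V) (hVD : ∀ d ∈ D, ∀ x ∈ V, d * x * d⁻¹ ∈ V) (hne : ¬ S ≤ V) :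
    Nat.card V * T.ncard ≤ Nat.card S := by
  have hS := P.normal_S
  obtain ⟨x₀, hx₀, hx₀V⟩ := Set.not_subset.1 hne
  have hex : ∀ t : T, ∃ u ∈ U, ∃ d ∈ D, (t : G) = u * d := fun t => P.T_fac t t.2
  choose u hu d hd htud using hex
  rw [← Nat.card_coe_set_eq T, ← Nat.card_prod]
  -- The conjugates of `x₀ ∉ V` by the `D`-parts of `T` lie in distinct cosets of `V`: otherwise
  -- some `d t⁻¹ * d t'` would fix `x₀` modulo `V`.
  refine Nat.card_le_card_of_injective (fun p : V × T => (⟨d p.2 * x₀ * (d p.2)⁻¹ * p.1,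
    S.mul_mem (hS.conj_mem _ hx₀ _) (hVS p.1.2)⟩ : S)) ?_
  rintro ⟨v, t⟩ ⟨v', t'⟩ heq
  have h1 : d t * x₀ * (d t)⁻¹ * v = d t' * x₀ * (d t')⁻¹ * v' := congrArg Subtype.val heq
  by_cases htt : t = t'
  · subst htt
    rw [mul_right_inj] at h1
    rw [Subtype.ext h1]
  · exfalso
    apply hx₀V
    set δ := (d t)⁻¹ * d t' with hδ
    have hδD : δ ∈ D := D.mul_mem (D.inv_mem (hd t)) (hd t')
    have hfpf := P.mem_of_commutator_mem (H := S) (H' := ⁅S, S⁆) le_rfl le_rfl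
      (P.S_le.trans le_sup_left) hδD
      (P.rich_of_eq t.2 t'.2 (fun h => htt (Subtype.ext h)) (hu t) (hu t') (htud t) (htud t'))
    refine commutator_mem_imp_mem_of_le hSV hVS le_rfl
      (fun x hx => Subgroup.Normal.conj_mem inferInstance x hx δ) (hVD δ hδD) hfpf x₀ hx₀ ?_
    have h2 : x₀⁻¹ * (δ * x₀ * δ⁻¹) ∈ V := by
      have h3 : x₀⁻¹ * (δ * x₀ * δ⁻¹) = (d t)⁻¹ * (v * (v' : G)⁻¹) * (d t)⁻¹⁻¹ := by
        have h4 : (v : G) = (d t * x₀ * (d t)⁻¹)⁻¹ * (d t' * x₀ * (d t')⁻¹ * v') := by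
          rw [← h1]; group
        rw [h4, hδ]; group
      rw [h3]
      exact hVD _ (D.inv_mem (hd t)) _ (V.mul_mem v.2 (V.inv_mem v'.2))
    have h5 : ⁅δ, x₀⁆ = x₀ * (x₀⁻¹ * (δ * x₀ * δ⁻¹)) * x₀⁻¹ := by
      rw [commutatorElement_def]; group
    rw [h5]
    exact hVD x₀ (P.S_le_D hx₀) _ h2

/-- The constant controlling the size of `T` in the bilinear step. -/
def bilinExponent (m : ℕ) : ℕ := 3 * (4 * m + 3) + 1

/-- If `S` is covered modulo `H = ⁅H₀, S⁆` by a power of `A`, then so is `H` modulo `⁅H, D⁆`. -/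
theorem covers_of_bilinear [Finite G] (P : PivotData n r e q A K U D S W T)
    {H₀ H H' : Subgroup G} [H₀.Normal] [H.Normal] [H'.Normal] (hH₀ : H₀ ≤ S)
    (hH : H = ⁅H₀, S⁆) (hH' : H' ≤ H) (hHD : ⁅H, D⁆ ≤ H') {m : ℕ}
    (hcov : ∀ x ∈ S, ∃ b ∈ (A ^ 2) ^ m, b⁻¹ * x ∈ H)
    (hT : K ^ bilinExponent m < T.ncard) :
    ∀ x ∈ H, ∃ b ∈ (A ^ 2) ^ (4 * m + 4), b⁻¹ * x ∈ H' := by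
  classical
  have hB := P.growth
  have hS := P.normal_S
  have hHS : H ≤ S := hH ▸ (Subgroup.commutator_mono hH₀ le_rfl).trans
    (Subgroup.commutator_le_left S S)
  have hHS' : ⁅H, S⁆ ≤ H' := (Subgroup.commutator_mono le_rfl P.S_le_D).trans hHD
  set π := QuotientGroup.mk' H' with hπ
  have hker : ∀ x, π x = 1 ↔ x ∈ H' := fun x => by
    rw [← MonoidHom.mem_ker, QuotientGroup.ker_mk']
  set M := H.map π with hM
  have hMc : IsMulCommutative M := isMulCommutative_map H H'
    ((Subgroup.commutator_mono le_rfl hHS).trans hHS')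
  let _ : Fintype (Additive M) := Fintype.ofFinite _
  let _ : Fintype S := Fintype.ofFinite _
  let _ : Fintype H₀ := Fintype.ofFinite _
  have hcomm : ∀ h ∈ H, ∀ g ∈ D, Commute (π h) (π g) := fun h hh g hg => by
    rw [← commutatorElement_eq_one_iff_commute, ← map_commutatorElement, hker]
    exact hHD (Subgroup.commutator_mem_commutator hh hg)
  have hyx : ∀ y ∈ H₀, ∀ x ∈ S, ⁅y, x⁆ ∈ H := fun y hy x hx => by
    rw [hH]; exact Subgroup.commutator_mem_commutator hy hx
  have hc₁ : ∀ y x x' : G, ⁅y, x * x'⁆ = ⁅y, x⁆ * (x * ⁅y, x'⁆ * x⁻¹) := fun y x x' => by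
    simp only [commutatorElement_def]; group
  have hc₂ : ∀ y y' x : G, ⁅y * y', x⁆ = y * ⁅y', x⁆ * y⁻¹ * ⁅y, x⁆ := fun y y' x => by
    simp only [commutatorElement_def]; group
  have hc₃ : ∀ y x d : G, ⁅y, d * x * d⁻¹⁆ = d * ⁅d⁻¹ * y * d, x⁆ * d⁻¹ := fun y x d => by
    simp only [commutatorElement_def]; group
  -- `D` contains `S` and centralizes `H / H'`, so the commutator identities become bilinearity.
  let βr : ∀ y : H₀, S →* M := fun y => MonoidHom.mk'
    (fun x => ⟨π ⁅(y : G), (x : G)⁆, _, hyx y y.2 x x.2, rfl⟩) (by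
      intro x x'
      apply Subtype.ext
      change π ⁅(y : G), (x : G) * x'⁆ = π ⁅(y : G), (x : G)⁆ * π ⁅(y : G), (x' : G)⁆
      have h2 := hcomm _ (hyx y y.2 x' x'.2) x (P.S_le_D x.2)
      rw [hc₁, map_mul, map_mul, map_mul, map_inv, ← h2.eq, mul_inv_cancel_right])
  let β : H₀ →* S →* M := MonoidHom.mk' βr (by
    intro y y'
    ext x
    change π ⁅(y : G) * y', (x : G)⁆ = π ⁅(y : G), (x : G)⁆ * π ⁅(y' : G), (x : G)⁆
    have h2 := hcomm _ (hyx y' y'.2 x x.2) y (P.S_le_D (hH₀ y.2))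
    have h3 := hcomm _ (hyx y' y'.2 x x.2) _ (P.S_le_D (hHS (hyx y y.2 x x.2)))
    rw [hc₂, map_mul, map_mul, map_mul, map_inv, ← h2.eq, mul_inv_cancel_right, h3.eq])
  have hβ : ∀ y x, ((β y x : M) : G ⧸ H') = π ⁅(y : G), (x : G)⁆ := fun _ _ => rfl
  set Φ : S × H₀ → Additive M := fun p => Additive.ofMul (β p.2 p.1) with hΦ
  have hTpos : (0 : ℝ) < T.ncard := lt_of_le_of_lt (pow_nonneg (by linarith [P.two_le]) _) hT
  have hchar : ∀ ξ : AddChar (Additive M) ℂ, ξ ≠ 0 →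
      ‖∑ p, ξ (Φ p)‖ ≤ (1 / T.ncard) * Fintype.card (S × H₀) := by
    intro ξ hξ
    let χ : M →* ℂ :=
      { toFun := fun g => ξ (Additive.ofMul g)
        map_one' := ξ.map_zero_eq_one
        map_mul' := fun g h => ξ.map_add_eq_mul _ _ }
    let γ : S →* H₀ →* ℂ :=
      { toFun := fun x => χ.comp (β.flip x)
        map_one' := by rw [map_one, MonoidHom.comp_one]
        map_mul' := fun x y => by rw [map_mul, MonoidHom.comp_mul] }
    have hγ : ∀ x y, γ x y = χ (β y x) := fun _ _ => rfl
    have hsum : ∑ p, ξ (Φ p) = (Nat.card γ.ker : ℂ) * Fintype.card H₀ := by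
      rw [Fintype.sum_prod_type]
      -- For fixed `x`, the inner sum runs over a character of `H₀` and vanishes unless that
      -- character is trivial.
      have h1 : ∀ x : S, ∑ y : H₀, ξ (Φ (x, y)) =
          if x ∈ γ.ker then (Fintype.card H₀ : ℂ) else 0 := by
        intro x
        have := sum_hom_units (γ x)
        refine Eq.trans ?_ (this.trans ?_)
        · rfl
        · simp only [MonoidHom.mem_ker]
          push_cast
          split_ifs <;> rfl
      rw [Finset.sum_congr rfl fun x _ => h1 x, ← Finset.sum_filter, Finset.sum_const,
        nsmul_eq_mul, show Nat.card γ.ker = (Finset.univ.filter (· ∈ γ.ker)).card from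
          Nat.subtype_card _ fun x => by rw [Finset.mem_filter_univ]]
    have hker_card : Nat.card (γ.ker.map S.subtype) = Nat.card γ.ker :=
      Nat.card_congr (γ.ker.equivMapOfInjective _ S.subtype_injective).symm.toEquiv
    -- The kernel contains `⁅S, S⁆`. It is `D`-invariant, since conjugation by `d` can be moved from
    -- `x` to `y`, and proper, since `ξ ≠ 0` and commutators generate `H`.
    have hVcard : Nat.card (γ.ker.map S.subtype) * T.ncard ≤ Nat.card S := by
      refine P.card_mul_ncard_le ?_ ?_ ?_ ?_
      · rintro _ ⟨x, -, rfl⟩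
        exact x.2
      · rw [Subgroup.commutator_le]
        intro a ha b hb
        refine ⟨⁅(⟨a, ha⟩ : S), ⟨b, hb⟩⁆, ?_, rfl⟩
        have : β.flip ⁅(⟨a, ha⟩ : S), ⟨b, hb⟩⁆ = 1 := by
          rw [map_commutatorElement, commutatorElement_eq_one_iff_commute]
          exact Commute.all _ _
        rw [SetLike.mem_coe, MonoidHom.mem_ker]
        change χ.comp (β.flip _) = 1
        rw [this, MonoidHom.comp_one]
      · rintro d hd _ ⟨x, hx, rfl⟩
        refine ⟨⟨d * x * d⁻¹, hS.conj_mem x x.2 d⟩, ?_, rfl⟩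
        rw [SetLike.mem_coe, MonoidHom.mem_ker] at hx ⊢
        ext y
        have hy' : d⁻¹ * y * d ∈ H₀ := by
          have := (inferInstance : H₀.Normal).conj_mem y y.2 d⁻¹
          rwa [inv_inv] at this
        have h1 : β y ⟨d * x * d⁻¹, hS.conj_mem x x.2 d⟩ = β ⟨d⁻¹ * y * d, hy'⟩ x := by
          apply Subtype.ext
          rw [hβ, hβ]
          change π ⁅(y : G), d * x * d⁻¹⁆ = π ⁅d⁻¹ * y * d, (x : G)⁆
          rw [hc₃, map_mul, map_mul, map_inv, ← (hcomm _ (hyx _ hy' x x.2) d hd).eq,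
            mul_inv_cancel_right]
        rw [hγ, h1, ← hγ, hx]
        rfl
      · intro hSV
        apply hξ
        have hall : ∀ y x, χ (β y x) = 1 := by
          intro y x
          obtain ⟨x', hx', hxx'⟩ := hSV x.2
          rw [show x' = x from Subtype.ext hxx', SetLike.mem_coe, MonoidHom.mem_ker] at hx'
          rw [← hγ, hx']; rfl
        have hHN : H ≤ (χ.ker.map M.subtype).comap π := by
          conv_lhs => rw [hH]
          rw [Subgroup.commutator_le]
          intro y hy x hx
          exact ⟨β ⟨y, hy⟩ ⟨x, hx⟩, hall _ _, rfl⟩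
        ext z
        obtain ⟨h, hh, hhz⟩ := z.toMul.2
        obtain ⟨w, hw, hwh⟩ := hHN hh
        have : w = z.toMul := Subtype.ext (hwh.trans hhz)
        rw [this] at hw
        exact hw
    rw [hsum, ← hker_card, norm_mul, Complex.norm_natCast, Complex.norm_natCast,
      Fintype.card_prod, Nat.cast_mul, ← mul_assoc]
    refine mul_le_mul_of_nonneg_right ?_ (Nat.cast_nonneg _)
    rw [one_div, ← div_eq_inv_mul, le_div_iff₀ hTpos, ← Nat.card_eq_fintype_card]
    exact_mod_cast hVcard
  -- The bilinear map depends only on its arguments modulo `H`, so both can be replaced by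
  -- representatives from `(A ^ 2) ^ m`.
  have hΦpow : ∀ p, Φ p ∈ sectionPow A H H' (4 * m) := by
    rintro ⟨x, y⟩
    obtain ⟨b, hb, hbx⟩ := hcov x x.2
    obtain ⟨b', hb', hby⟩ := hcov y (hH₀ y.2)
    have hbS : b ∈ S := by
      have := S.mul_mem x.2 (S.inv_mem (hHS hbx))
      rwa [mul_inv_rev, inv_inv, mul_inv_cancel_left] at this
    have hbH₀ : b' ∈ H₀ := by
      have := H₀.mul_mem y.2 (H₀.inv_mem ((hH.le.trans (Subgroup.commutator_le_left H₀ S)) hby))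
      rwa [mul_inv_rev, inv_inv, mul_inv_cancel_left] at this
    refine mem_sectionPow.2 ⟨⁅b', b⁆, hB.pow_mono (by lia)
      (hB.commutator_mem hb' hb), hyx b' hbH₀ b hbS, ?_⟩
    change π ⁅b', b⁆ = π ⁅(y : G), (x : G)⁆
    have h1 : π ⁅b'⁻¹ * y, (x : G)⁆ = 1 := by
      rw [map_commutatorElement, commutatorElement_eq_one_iff_commute]
      exact hcomm _ hby _ (P.S_le_D x.2)
    have h2 : π ⁅b', b⁻¹ * (x : G)⁆ = 1 := by
      rw [map_commutatorElement, commutatorElement_eq_one_iff_commute]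
      exact (hcomm _ hbx _ (P.S_le_D (hH₀ hbH₀))).symm
    have h3 : π ⁅(y : G), (x : G)⁆ = π ⁅b', (x : G)⁆ := by
      conv_lhs => rw [← mul_inv_cancel_left b' (y : G), hc₂, map_mul, map_mul, map_mul, h1]
      rw [map_inv, mul_one, mul_inv_cancel, one_mul]
    rw [h3]
    conv_rhs => rw [← mul_inv_cancel_left b (x : G), hc₁, map_mul, map_mul, map_mul, h2]
    rw [map_inv, mul_one, mul_inv_cancel, mul_one]
  have hK1 : 1 ≤ K := by linarith [P.two_le]
  set L : ℝ := (K ^ 3) ^ (4 * m + 3) with hL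
  have hL1 : 1 ≤ L := one_le_pow₀ (one_le_pow₀ hK1)
  have hLT : 2 * L < T.ncard := by
    refine lt_of_le_of_lt ?_ hT
    rw [bilinExponent, pow_succ, pow_mul, mul_comm]
    gcongr
    exact P.two_le
  have h0X : (0 : Additive M) ∈ sectionPow A H H' 2 :=
    mem_sectionPow.2 ⟨1, hB.one_mem_pow 2, H.one_mem, map_one _⟩
  have : Nonempty (S × H₀) := ⟨(1, 1)⟩
  have hcard := card_le_of_charSum_le hchar ⟨0, h0X⟩ (W := sectionPow A H H' (4 * m + 2))
    (by
      intro x hx i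
      obtain ⟨a, ha, haH, hax⟩ := mem_sectionPow.1 hx
      obtain ⟨b, hb, hbH, hbx⟩ := mem_sectionPow.1 (hΦpow i)
      exact mem_sectionPow.2 ⟨a * b, hB.pow_mono (by lia) (SmallGrowth.mul_mem ha hb),
        H.mul_mem haH hbH, by rw [map_mul, hax, hbx]; rfl⟩)
    (P.card_sectionPow_le hH' (4 * m + 2))
  have hZ : (0 : ℝ) < Fintype.card (Additive M) := by exact_mod_cast Fintype.card_pos
  -- Otherwise `hcard` gives `|M| ≤ 2 * L * |M| / |T|`, against `2 * L < |T|`. This density lets the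
  -- same character sums represent every element.
  have hlt : 1 / (T.ncard : ℝ) * Fintype.card (Additive M) < (sectionPow A H H' 2).card := by
    by_contra! hle
    set Z : ℝ := (Fintype.card (Additive M) : ℝ)
    set t : ℝ := 1 / T.ncard with ht
    have ht0 : 0 < t := one_div_pos.2 hTpos
    have hLt : 2 * L * t < 1 := by rw [ht, mul_one_div, div_lt_one hTpos]; exact hLT
    have ht1 : t < 1 := lt_of_le_of_lt (by nlinarith) hLt
    have h1 : L * ((sectionPow A H H' 2).card + t ^ 2 * Z) ≤ L * (t * Z + t * Z) := by
      have h2 : t ^ 2 * Z ≤ t * Z := by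
        rw [sq]; gcongr; exact mul_le_of_le_one_left ht0.le ht1.le
      gcongr
    have h3 : L * (t * Z + t * Z) = (2 * L * t) * Z := by ring
    have h4 : (2 * L * t) * Z < 1 * Z := by gcongr
    linarith
  intro x hx
  obtain ⟨u, hu, v, hv, i, huv⟩ := exists_sub_add_eq_of_charSum_le hchar
    (one_div_nonneg.2 hTpos.le) hlt (Additive.ofMul (⟨π x, x, hx, rfl⟩ : M))
  obtain ⟨a, ha, haH, hau⟩ := mem_sectionPow.1 hu
  obtain ⟨b, hb, hbH, hbv⟩ := mem_sectionPow.1 hv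
  obtain ⟨d, hd, hdH, hdi⟩ := mem_sectionPow.1 (hΦpow i)
  refine ⟨a * b⁻¹ * d, hB.pow_mono (by lia : 2 + 2 + 4 * m ≤ 4 * m + 4)
    (SmallGrowth.mul_mem (SmallGrowth.mul_mem ha (hB.inv_mem hb)) hd), QuotientGroup.eq.1 ?_⟩
  change π (a * b⁻¹ * d) = π x
  rw [map_mul, map_mul, map_inv, hau, hbv, hdi]
  have h5 := congrArg (fun w : Additive M => ((w.toMul : M) : G ⧸ H')) huv
  rw [sub_eq_add_neg] at h5
  exact h5

end PivotData

/-! ### The two inductions exhausting `S` -/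

theorem Subgroup.sup_commutator_le {G : Type*} [Group G] (A Z U : Subgroup G) [A.Normal]
    [Z.Normal] [U.Normal] : ⁅A ⊔ Z, U⁆ ≤ ⁅A, U⁆ ⊔ Z := by
  rw [Subgroup.commutator_le]
  intro x hx u hu
  rw [← SetLike.mem_coe, Subgroup.mul_normal] at hx
  obtain ⟨a, ha, z, hz, rfl⟩ := hx
  have h1 : ⁅a * z, u⁆ = a * ⁅z, u⁆ * a⁻¹ * ⁅a, u⁆ := by
    simp only [commutatorElement_def]; group
  rw [h1]
  refine Subgroup.mul_mem _ (Subgroup.mem_sup_right (Subgroup.Normal.conj_mem inferInstance _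
    (Subgroup.commutator_le_left Z U (Subgroup.commutator_mem_commutator hz hu)) a))
    (Subgroup.mem_sup_left (Subgroup.commutator_mem_commutator ha hu))

/-- The three subgroups lemma modulo a normal subgroup. -/
theorem Subgroup.commutator_commutator_le_of_rotate {G : Type*} [Group G] {H₁ H₂ H₃ : Subgroup G}
    (N : Subgroup G) [N.Normal] (h1 : ⁅⁅H₂, H₃⁆, H₁⁆ ≤ N) (h2 : ⁅⁅H₃, H₁⁆, H₂⁆ ≤ N) :
    ⁅⁅H₁, H₂⁆, H₃⁆ ≤ N := by
  have key : ∀ X Y Z : Subgroup G, ⁅⁅X, Y⁆, Z⁆ ≤ N ↔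
      ⁅⁅X.map (QuotientGroup.mk' N), Y.map (QuotientGroup.mk' N)⁆,
        Z.map (QuotientGroup.mk' N)⁆ = ⊥ := by
    intro X Y Z
    rw [← Subgroup.map_commutator, ← Subgroup.map_commutator, Subgroup.map_eq_bot_iff,
      QuotientGroup.ker_mk']
  rw [key] at h1 h2 ⊢
  exact Subgroup.commutator_commutator_eq_bot_of_rotate h1 h2

/-- The descending chain obtained from `H` by iterating `X ↦ ⁅X, U⁆ ⊔ Z`. -/
def relativeSeries {G : Type*} [Group G] (H U Z : Subgroup G) : ℕ → Subgroup G
  | 0 => H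
  | j + 1 => ⁅relativeSeries H U Z j, U⁆ ⊔ Z

section RelativeSeries

variable {G : Type*} [Group G] {H U Z : Subgroup G}

theorem relativeSeries_normal [H.Normal] [U.Normal] [Z.Normal] (j : ℕ) :
    (relativeSeries H U Z j).Normal := by
  induction j with
  | zero => assumption
  | succ j ih => exact Subgroup.sup_normal _ _

theorem le_relativeSeries (h : Z ≤ H) (j : ℕ) : Z ≤ relativeSeries H U Z j := by
  cases j with
  | zero => exact h
  | succ j => exact le_sup_right

theorem relativeSeries_succ_le [H.Normal] [U.Normal] [Z.Normal] (h : Z ≤ H) (j : ℕ) :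
    relativeSeries H U Z (j + 1) ≤ relativeSeries H U Z j := by
  have := relativeSeries_normal (H := H) (U := U) (Z := Z) j
  exact sup_le (Subgroup.commutator_le_left _ _) (le_relativeSeries h j)

theorem relativeSeries_le [H.Normal] [U.Normal] [Z.Normal] (h : Z ≤ H) (j : ℕ) :
    relativeSeries H U Z j ≤ H := by
  induction j with
  | zero => exact le_rfl
  | succ j ih => exact (relativeSeries_succ_le h j).trans ih

/-- Nilpotency of `U` therefore brings the series down to `Z` after `n` steps. -/
theorem relativeSeries_le_lowerCentralSeries [U.Normal] [Z.Normal] (h : H ≤ U) (j : ℕ) :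
    relativeSeries H U Z j ≤ U.lowerCentralSeries j ⊔ Z := by
  induction j with
  | zero => exact h.trans le_sup_left
  | succ j ih =>
    exact sup_le ((Subgroup.commutator_mono ih le_rfl).trans
      (Subgroup.sup_commutator_le _ _ _)) le_sup_right

end RelativeSeries

namespace PivotData

/-- Perfection under `D` is inherited through the three subgroups lemma: for `X = ⁅X, D⁆` modulo
`Z`, the term `⁅⁅D, U⁆, X⁆` lies in `⁅S, X⁆ ≤ Z`, which leaves `⁅⁅U, X⁆, D⁆`. -/
theorem relativeSeries_le_commutator_sup {G : Type*} [Group G]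
    {n r e q : ℕ} {A : Set G} {K : ℝ} {U D S : Subgroup G} {W : ℕ → Subgroup G} {T : Set G}
    (P : PivotData n r e q A K U D S W T) {H Z : Subgroup G}
    [H.Normal] [Z.Normal] (hZ : Z ≤ H) (hHS : ⁅H, S⁆ ≤ Z) (hHD : H ≤ ⁅H, D⁆ ⊔ Z) (j : ℕ) :
    relativeSeries H U Z j ≤ ⁅relativeSeries H U Z j, D⁆ ⊔ Z := by
  have hU := P.normal_U
  have hD := P.normal_D
  induction j with
  | zero => exact hHD
  | succ j ih =>
    have h1 := relativeSeries_normal (H := H) (U := U) (Z := Z) j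
    have h2 := relativeSeries_normal (H := H) (U := U) (Z := Z) (j + 1)
    have hRS : ⁅relativeSeries H U Z j, S⁆ ≤ Z :=
      (Subgroup.commutator_mono (relativeSeries_le hZ j) le_rfl).trans hHS
    refine sup_le ?_ le_sup_right
    refine (Subgroup.commutator_mono ih le_rfl).trans
      ((Subgroup.sup_commutator_le _ _ _).trans (sup_le ?_ le_sup_right))
    apply Subgroup.commutator_commutator_le_of_rotate
    · refine le_trans ?_ le_sup_right
      rw [Subgroup.commutator_comm]
      exact (Subgroup.commutator_mono le_rfl ((Subgroup.commutator_mono le_rfl le_top).trans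
        P.D_central)).trans hRS
    · refine le_trans (Subgroup.commutator_mono ?_ le_rfl) le_sup_left
      rw [Subgroup.commutator_comm]
      exact le_sup_left

/-- The inner induction: a `D`-perfect section of `S` is exhausted by powers of `A`. -/
theorem exists_covers_relativeSeries (n m₀ j : ℕ) : ∃ m M : ℕ,
    ∀ {G : Type u} [Group G] [Finite G] {r e q : ℕ} {A : Set G} {K : ℝ} {U D S : Subgroup G}
      {W : ℕ → Subgroup G} {T : Set G}, PivotData n r e q A K U D S W T → K ^ M < T.ncard →
      ∀ {H Z : Subgroup G} [H.Normal] [Z.Normal], Z ≤ H → H ≤ S → Z ≤ ⁅S, U⁆ → ⁅H, S⁆ ≤ Z →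
      H ≤ ⁅H, D⁆ ⊔ Z → (H = S ∨ H ≤ ⁅S, U⁆) → (∀ x ∈ S, ∃ b ∈ (A ^ 2) ^ m₀, b⁻¹ * x ∈ H) →
      ∀ x ∈ S, ∃ b ∈ (A ^ 2) ^ m, b⁻¹ * x ∈ relativeSeries H U Z j := by
  induction j with
  | zero => exact ⟨m₀, 0, fun _ _ _ _ _ _ _ _ _ _ _ _ h => h⟩
  | succ j ih =>
    obtain ⟨m, M, h⟩ := ih
    refine ⟨m + (6 * (17 * 2 ^ n + (3 * m + 1)) + 4),
      max M (fpfExponent (17 * 2 ^ n + (3 * m + 1))), ?_⟩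
    intro G _ _ r e q A K U D S W T P hT H Z _ _ hZH hHS hZ hHSZ hHD hor hcov
    have hU := P.normal_U
    have hS := P.normal_S
    have hK1 : 1 ≤ K := by linarith [P.two_le]
    have hB := P.growth
    have hcov' := h P (lt_of_le_of_lt (pow_le_pow_right₀ hK1 (le_max_left _ _)) hT) hZH hHS hZ
      hHSZ hHD hor hcov
    have h1 := relativeSeries_normal (H := H) (U := U) (Z := Z) j
    have h2 := relativeSeries_normal (H := H) (U := U) (Z := Z) (j + 1)
    have hRS := (relativeSeries_le (U := U) hZH j).trans hHS
    have hUle : ⁅relativeSeries H U Z j, U⁆ ≤ relativeSeries H U Z (j + 1) := le_sup_left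
    -- The alternative decides the source of generators: `le_of_pow_inter_le` for `S` itself,
    -- `le_of_covers` inside `⁅S, U⁆`. The length `17 * 2 ^ n + (3 * m + 1)` serves both.
    have hor' : relativeSeries H U Z j = S ∨ relativeSeries H U Z j ≤ ⁅S, U⁆ := by
      cases j with
      | zero => exact hor
      | succ j => exact Or.inr (sup_le (Subgroup.commutator_mono
          ((relativeSeries_le hZH j).trans hHS) le_rfl) hZ)
    have hTtwo : 1 < T.ncard := by
      have : (1 : ℝ) < T.ncard := lt_of_le_of_lt (one_le_pow₀ hK1) hT
      exact_mod_cast this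
    obtain ⟨t, ht, t', ht', hne⟩ := (Set.one_lt_ncard (Set.toFinite T)).1 hTtwo
    have key := P.covers_of_fixedPointFree (H := relativeSeries H U Z j)
      (H' := relativeSeries H U Z (j + 1)) hRS (relativeSeries_succ_le hZH j) hUle
      ((P.relativeSeries_le_commutator_sup hZH hHSZ hHD j).trans
        (sup_le_sup_left (le_relativeSeries hZH (j + 1)) _))
      (m := 17 * 2 ^ n + (3 * m + 1)) (by have := Nat.one_le_two_pow (n := n); lia)
      (by
        intro N _ hN hgen
        rcases hor' with heq | hle
        · rw [heq] at hUle hgen ⊢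
          exact P.le_of_pow_inter_le (hUle.trans hN) ht ht' hne
            fun x hx => hgen x (hB.pow_mono (Nat.le_add_right _ _) hx)
        · exact P.le_of_covers hle (hUle.trans hN) hcov'
            fun x hx => hgen x (hB.pow_mono (Nat.le_add_left _ _) hx))
      (lt_of_le_of_lt (pow_le_pow_right₀ hK1 (le_max_right _ _)) hT)
    intro x hx
    obtain ⟨b, hb, hbx⟩ := hcov' x hx
    obtain ⟨b', hb', hbx'⟩ := key _ hbx
    refine ⟨b * b', SmallGrowth.mul_mem hb hb', ?_⟩
    rwa [mul_inv_rev, mul_assoc]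

/-- The outer induction along the lower central series of `S`. -/
theorem exists_covers_lowerCentralSeries (n i : ℕ) : ∃ m M : ℕ,
    ∀ {G : Type u} [Group G] [Finite G] {r e q : ℕ} {A : Set G} {K : ℝ} {U D S : Subgroup G}
      {W : ℕ → Subgroup G} {T : Set G}, PivotData n r e q A K U D S W T → K ^ M < T.ncard →
      ∀ x ∈ S, ∃ b ∈ (A ^ 2) ^ m, b⁻¹ * x ∈ S.lowerCentralSeries i := by
  induction i with
  | zero =>
    exact ⟨0, 0, fun P _ x hx => ⟨1, by rw [pow_zero]; rfl, by simpa using hx⟩⟩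
  | succ i ih =>
    obtain ⟨m, M, h⟩ := ih
    obtain ⟨m', M', h'⟩ := exists_covers_relativeSeries.{u} n (m + (4 * m + 4)) n
    refine ⟨m', max (max M (bilinExponent m)) M', ?_⟩
    intro G _ _ r e q A K U D S W T P hT
    have hU := P.normal_U
    have hS := P.normal_S
    have hD := P.normal_D
    have hB := P.growth
    have hK1 : 1 ≤ K := by linarith [P.two_le]
    have hcov := h P (lt_of_le_of_lt (pow_le_pow_right₀ hK1
      ((le_max_left _ _).trans (le_max_left _ _))) hT)
    have hle : ∀ i, S.lowerCentralSeries i ≤ S := S.lowerCentralSeries_le_self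
    have hsucc : S.lowerCentralSeries (i + 1) ≤ ⁅S, U⁆ := by
      rw [Subgroup.lowerCentralSeries_succ]
      exact Subgroup.commutator_mono (hle i) P.S_le_U
    suffices hstep : ∃ H : Subgroup G, H.Normal ∧ S.lowerCentralSeries (i + 1) ≤ H ∧ H ≤ S ∧
        ⁅H, S⁆ ≤ S.lowerCentralSeries (i + 1) ∧ H ≤ ⁅H, D⁆ ⊔ S.lowerCentralSeries (i + 1) ∧
        (H = S ∨ H ≤ ⁅S, U⁆) ∧ ∀ x ∈ S, ∃ b ∈ (A ^ 2) ^ (m + (4 * m + 4)), b⁻¹ * x ∈ H by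
      obtain ⟨H, hHn, h1, h2, h3, h4, h5, h6⟩ := hstep
      intro x hx
      obtain ⟨b, hb, hbx⟩ := h' P (lt_of_le_of_lt (pow_le_pow_right₀ hK1 (le_max_right _ _)) hT)
        h1 h2 hsucc h3 h4 h5 h6 x hx
      refine ⟨b, hb, ?_⟩
      have := relativeSeries_le_lowerCentralSeries (h2.trans P.S_le_U) n hbx
      rwa [P.nilp, bot_sup_eq] at this
    -- The top section `S / ⁅S, S⁆` is already perfect under `D`. Below it, the bilinear step first
    -- covers `Sᵢ / ⁅Sᵢ, D⁆`, and `⁅Sᵢ, D⁆` is perfect modulo the next term by coprimality.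
    rcases i with _ | k
    · exact ⟨S, hS, Subgroup.lowerCentralSeries_le_self _ _, le_rfl, le_rfl,
        P.S_le.trans le_sup_left, Or.inl rfl,
        fun x hx => ⟨1, hB.one_mem_pow _, by simpa using hx⟩⟩
    · have key := P.covers_of_bilinear (H₀ := S.lowerCentralSeries k)
        (H := S.lowerCentralSeries (k + 1)) (H' := ⁅S.lowerCentralSeries (k + 1), D⁆) (hle k) rfl
        (Subgroup.commutator_le_left _ _) le_rfl hcov
        (lt_of_le_of_lt (pow_le_pow_right₀ hK1 ((le_max_right _ _).trans (le_max_left _ _))) hT)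
      have hHle : ⁅S.lowerCentralSeries (k + 1), D⁆ ≤ S.lowerCentralSeries (k + 1) :=
        Subgroup.commutator_le_left _ _
      refine ⟨⁅S.lowerCentralSeries (k + 1), D⁆, inferInstance, ?_, hHle.trans (hle _), ?_, ?_,
        Or.inr ?_, ?_⟩
      · exact Subgroup.commutator_mono le_rfl P.S_le_D
      · exact Subgroup.commutator_mono hHle le_rfl
      · exact P.commutator_le_commutator_commutator (hle _) le_rfl
      · refine hHle.trans ?_
        exact Subgroup.commutator_mono (hle _) P.S_le_U
      · intro x hx
        obtain ⟨b, hb, hbx⟩ := hcov x hx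
        obtain ⟨b', hb', hbx'⟩ := key _ hbx
        refine ⟨b * b', SmallGrowth.mul_mem hb hb', ?_⟩
        rwa [mul_inv_rev, mul_assoc]

/-- If `T` is large, then `S` is contained in a bounded power of `A`. -/
theorem exists_subset_pow (n : ℕ) : ∃ m M : ℕ,
    ∀ {G : Type u} [Group G] [Finite G] {r e q : ℕ} {A : Set G} {K : ℝ} {U D S : Subgroup G}
      {W : ℕ → Subgroup G} {T : Set G}, PivotData n r e q A K U D S W T → K ^ M < T.ncard →
      (S : Set G) ⊆ (A ^ 2) ^ m := by
  obtain ⟨m, M, h⟩ := exists_covers_lowerCentralSeries.{u} n n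
  refine ⟨m, M, fun P hT x hx => ?_⟩
  obtain ⟨b, hb, hbx⟩ := h P hT x hx
  have h1 := Subgroup.lowerCentralSeries_mono n P.S_le_U hbx
  beta_reduce at h1
  rw [P.nilp, Subgroup.mem_bot] at h1
  rwa [← inv_mul_eq_one.1 h1]

end PivotData

/-! ### Choice of the separated set `T` and of the centralizer `Δ` -/

/-- If `B ^ 2 ∩ Δ` meets many cosets of each of finitely many subgroups, then it contains many
elements which lie in pairwise distinct cosets of all of these subgroups. -/
theorem SmallGrowth.exists_pairwise_separated {G : Type*} [Group G] [Finite G] {B : Set G} {K : ℝ}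
    (hB : SmallGrowth B K) (Δ : Subgroup G) (C : ℕ → Subgroup G) {I : Finset ℕ} (hI : I.Nonempty)
    {M : ℕ} (hM : ∀ k ∈ I, K ^ M < cosetCount (B ^ 2 ∩ Δ) (C k)) :
    ∃ T ⊆ B ^ 2 ∩ (Δ : Set G), (∀ t ∈ T, ∀ t' ∈ T, t ≠ t' → ∀ k ∈ I, t⁻¹ * t' ∉ C k) ∧
      K ^ M ≤ K ^ 7 * I.card * T.ncard := by
  classical
  have hK : 0 < K := by linarith [hB.one_le]
  set F : Finset G := (Set.toFinite (B ^ 2 ∩ (Δ : Set G))).toFinset with hF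
  have hmemF : ∀ x, x ∈ F ↔ x ∈ B ^ 2 ∩ (Δ : Set G) := fun x => by
    rw [hF, Set.Finite.mem_toFinset]
  have hFcard : (F.card : ℝ) = (B ^ 2 ∩ (Δ : Set G)).ncard := by
    rw [hF, Set.ncard_eq_toFinset_card _ (Set.toFinite _)]
  have hFpos : (0 : ℝ) < F.card := by
    exact_mod_cast Finset.card_pos.2 ⟨1, (hmemF 1).2 ⟨hB.one_mem_pow 2, Δ.one_mem⟩⟩
  obtain ⟨T, hT, hmax⟩ := Finset.exists_max_image
    (F.powerset.filter fun T => ∀ t ∈ T, ∀ t' ∈ T, t ≠ t' → ∀ k ∈ I, t⁻¹ * t' ∉ C k)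
    Finset.card ⟨∅, by simp⟩
  rw [Finset.mem_filter, Finset.mem_powerset] at hT
  obtain ⟨hTF, hsep⟩ := hT
  -- More than `K ^ M` disjoint translates of this set fit into `B ^ 6 ∩ Δ`, of size at most `K ^ 7
  -- * |F|`.
  have hcard : ∀ k ∈ I, ((B ^ 4 ∩ Δ ∩ C k : Set G).ncard : ℝ) ≤ K ^ 7 * F.card / K ^ M := by
    intro k hk
    rw [le_div_iff₀ (pow_pos hK M)]
    have h1 := ncard_mul_ncard_image_le (mk_eq_mk_iff_mem (C k)) (B ^ 4 ∩ Δ ∩ C k) (B ^ 2 ∩ Δ)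
      Set.inter_subset_right
    have h2 : ((B ^ 2 ∩ Δ) * (B ^ 4 ∩ Δ ∩ C k) : Set G).ncard ≤ (B ^ 6 ∩ Δ : Set G).ncard := by
      refine Set.ncard_le_ncard ?_ (Set.toFinite _)
      rintro _ ⟨x, hx, y, hy, rfl⟩
      exact ⟨SmallGrowth.mul_mem hx.1 hy.1.1, Δ.mul_mem hx.2 hy.1.2⟩
    calc ((B ^ 4 ∩ Δ ∩ C k : Set G).ncard : ℝ) * K ^ M
        ≤ (B ^ 4 ∩ Δ ∩ C k : Set G).ncard * cosetCount (B ^ 2 ∩ Δ) (C k) := by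
          gcongr; exact (hM k hk).le
      _ ≤ (B ^ 6 ∩ Δ : Set G).ncard := by exact_mod_cast h1.trans h2
      _ ≤ K ^ 7 * F.card := by rw [hFcard]; exact hB.ncard_image_pow_inter_le Δ 6
  -- By maximality of `T`, every `x ∈ F` shares a coset of some `C k` with some `t ∈ T`.
  have hcover : F ⊆ (I ×ˢ T).biUnion fun p =>
      (Set.toFinite (B ^ 4 ∩ Δ ∩ C p.1 : Set G)).toFinset.image (p.2 * ·) := by
    intro x hx
    have hmemT : ∀ t ∈ T, t ∈ B ^ 2 ∩ (Δ : Set G) := fun t ht => (hmemF t).1 (hTF ht)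
    obtain ⟨k, hk, t, ht, htx⟩ : ∃ k ∈ I, ∃ t ∈ T, t⁻¹ * x ∈ C k := by
      by_cases hxT : x ∈ T
      · obtain ⟨k, hk⟩ := hI
        exact ⟨k, hk, x, hxT, by rw [inv_mul_cancel]; exact (C k).one_mem⟩
      · by_contra! hcon
        have h1 := hmax (insert x T) (by
          rw [Finset.mem_filter, Finset.mem_powerset]
          refine ⟨Finset.insert_subset hx hTF, ?_⟩
          intro t ht t' ht' hne k hk
          rcases Finset.mem_insert.1 ht with h | h <;> rcases Finset.mem_insert.1 ht' with h' | h'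
          · exact absurd (h.trans h'.symm) hne
          · rw [h, ← (C k).inv_mem_iff, mul_inv_rev, inv_inv]
            exact hcon k hk t' h'
          · rw [h']
            exact hcon k hk t h
          · exact hsep t h t' h' hne k hk)
        rw [Finset.card_insert_of_notMem hxT] at h1
        lia
    rw [Finset.mem_biUnion]
    refine ⟨(k, t), Finset.mem_product.2 ⟨hk, ht⟩, Finset.mem_image.2 ⟨t⁻¹ * x, ?_, by simp⟩⟩
    rw [Set.Finite.mem_toFinset]
    have hx' := (hmemF x).1 hx
    exact ⟨⟨SmallGrowth.mul_mem (hB.inv_mem (hmemT t ht).1) hx'.1,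
      Δ.mul_mem (Δ.inv_mem (hmemT t ht).2) hx'.2⟩, htx⟩
  have hle : F.card ≤ (I ×ˢ T).card * ⌊K ^ 7 * F.card / K ^ M⌋₊ := by
    refine (Finset.card_le_card hcover).trans (Finset.card_biUnion_le_card_mul _ _ _ ?_)
    rintro ⟨k, t⟩ hp
    refine Finset.card_image_le.trans (Nat.le_floor ?_)
    rw [← Set.ncard_eq_toFinset_card]
    exact hcard k (Finset.mem_product.1 hp).1
  refine ⟨T, fun t ht => (hmemF t).1 (hTF ht), hsep, ?_⟩
  rw [Set.ncard_coe_finset]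
  have h2 : (F.card : ℝ) ≤ I.card * T.card * (K ^ 7 * F.card / K ^ M) := by
    calc (F.card : ℝ) ≤ ((I ×ˢ T).card * ⌊K ^ 7 * F.card / K ^ M⌋₊ : ℕ) := by exact_mod_cast hle
      _ ≤ I.card * T.card * (K ^ 7 * F.card / K ^ M) := by
        rw [Finset.card_product]
        push_cast
        gcongr
        exact Nat.floor_le (by positivity)
  rw [mul_div_assoc', le_div_iff₀ (pow_pos hK M)] at h2
  refine le_of_mul_le_mul_right ?_ hFpos
  linarith

/-- An approximate group `A` generating `G`, with a subgroup `Γ` having a normal nilpotent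
subgroup `U` of coprime index and a filtration `W` of `U` such that each element of `Γ` acts either
trivially or without fixed points on each step of the filtration. -/
structure TorusData {G : Type*} [Group G] (n r e q : ℕ) (A : Set G) (K : ℝ) (Γ U : Subgroup G)
    (W : ℕ → Subgroup G) : Prop where
  closure_eq : Subgroup.closure A = ⊤
  inv_eq : A⁻¹ = A
  growth : SmallGrowth (A ^ 2) K
  two_le : 2 ≤ K
  normal_U : U.Normal
  U_le : U ≤ Γ
  commutator_le : ⁅Γ, (⊤ : Subgroup G)⁆ ≤ U
  nilp : U.lowerCentralSeries n = ⊥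
  W_zero : W 0 = U
  W_last : W r = ⊥
  W_conj : ∀ k, ∀ d ∈ Γ, ∀ x ∈ W k, d * x * d⁻¹ ∈ W k
  W_comm : ∀ k, ∀ u ∈ U, ∀ x ∈ W k, ⁅u, x⁆ ∈ W (k + 1)
  W_anti : ∀ k, W (k + 1) ≤ W k
  pow_mem : ∀ d ∈ Γ, d ^ q ∈ U
  pow_eq : ∀ u ∈ U, u ^ e = 1
  coprime : e.Coprime q
  dichotomy : ∀ d ∈ Γ, ∀ k < r, (∀ x ∈ W k, ⁅d, x⁆ ∈ W (k + 1)) ∨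
    (∀ x ∈ W k, ⁅d, x⁆ ∈ W (k + 1) → x ∈ W (k + 1))

namespace TorusData

variable {G : Type*} [Group G]
variable {n r e q : ℕ} {A : Set G} {K : ℝ} {Γ U : Subgroup G} {W : ℕ → Subgroup G}

/-- The elements of `Γ` acting trivially on the `k`-th step of the filtration. -/
def stepCentralizer (P : TorusData n r e q A K Γ U W) (k : ℕ) : Subgroup G where
  carrier := {d | d ∈ Γ ∧ ∀ x ∈ W k, ⁅d, x⁆ ∈ W (k + 1)}
  one_mem' := ⟨Γ.one_mem, fun x _ => by
    rw [commutatorElement_one_left]; exact (W (k + 1)).one_mem⟩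
  mul_mem' := by
    rintro a b ⟨ha, ha'⟩ ⟨hb, hb'⟩
    refine ⟨Γ.mul_mem ha hb, fun x hx => ?_⟩
    have h1 : ⁅a * b, x⁆ = a * ⁅b, x⁆ * a⁻¹ * ⁅a, x⁆ := by
      simp only [commutatorElement_def]; group
    rw [h1]
    exact (W (k + 1)).mul_mem (P.W_conj _ a ha _ (hb' x hx)) (ha' x hx)
  inv_mem' := by
    rintro a ⟨ha, ha'⟩
    refine ⟨Γ.inv_mem ha, fun x hx => ?_⟩
    have h1 : ⁅a⁻¹, x⁆ = a⁻¹ * ⁅a, x⁆⁻¹ * a⁻¹⁻¹ := by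
      simp only [commutatorElement_def]; group
    rw [h1]
    exact P.W_conj _ _ (Γ.inv_mem ha) _ ((W (k + 1)).inv_mem (ha' x hx))

/-- The elements of `Γ` acting trivially on the steps of the filtration indexed by `J`. -/
def multiCentralizer (P : TorusData n r e q A K Γ U W) (J : Finset ℕ) : Subgroup G :=
  Γ ⊓ ⨅ k ∈ J, P.stepCentralizer k

theorem multiCentralizer_insert (P : TorusData n r e q A K Γ U W) (J : Finset ℕ) (k : ℕ) :
    P.multiCentralizer (insert k J) = P.multiCentralizer J ⊓ P.stepCentralizer k := by
  rw [multiCentralizer, multiCentralizer, Finset.iInf_insert, inf_assoc,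
    inf_comm (P.stepCentralizer k)]

theorem le_multiCentralizer (P : TorusData n r e q A K Γ U W) (J : Finset ℕ) :
    U ≤ P.multiCentralizer J :=
  le_inf P.U_le (le_iInf₂ fun k _ _ hu => ⟨P.U_le hu, fun x hx => P.W_comm k _ hu x hx⟩)

theorem multiCentralizer_le (P : TorusData n r e q A K Γ U W) (J : Finset ℕ) :
    P.multiCentralizer J ≤ Γ := inf_le_left

/-- Every subgroup between `U` and `Γ` is normal, because `⁅Γ, G⁆ ≤ U`. -/
theorem multiCentralizer_normal (P : TorusData n r e q A K Γ U W) (J : Finset ℕ) :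
    (P.multiCentralizer J).Normal := by
  refine ⟨fun x hx g => ?_⟩
  have h1 : g * x * g⁻¹ = ⁅x, g⁆⁻¹ * x := by simp only [commutatorElement_def]; group
  rw [h1]
  exact Subgroup.mul_mem _ (Subgroup.inv_mem _ (P.le_multiCentralizer J (P.commutator_le
    (Subgroup.commutator_mem_commutator (P.multiCentralizer_le J hx) (Subgroup.mem_top g))))) hx

/-- Take `J` of maximal size satisfying the first bound. A step `k` violating the second could be
added to `J`, multiplying the coset count by at most `K ^ M`. -/
theorem exists_multiCentralizer [Finite G] (P : TorusData n r e q A K Γ U W) (M : ℕ) :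
    ∃ J ⊆ Finset.range r,
      (cosetCount (A ^ 2 ∩ Γ) (P.multiCentralizer J) : ℝ) ≤ K ^ (M * J.card) ∧
      ∀ k < r, k ∉ J → K ^ M <
        cosetCount ((A ^ 2) ^ 2 ∩ (P.multiCentralizer J : Set G)) (P.stepCentralizer k) := by
  classical
  have hK : 0 < K := by linarith [P.two_le]
  obtain ⟨J, hJ, hmax⟩ := Finset.exists_max_image
    ((Finset.range r).powerset.filter fun J =>
      (cosetCount (A ^ 2 ∩ Γ) (P.multiCentralizer J) : ℝ) ≤ K ^ (M * J.card)) Finset.card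
    ⟨∅, by
      rw [Finset.mem_filter]
      refine ⟨Finset.empty_mem_powerset _, ?_⟩
      rw [Finset.card_empty, mul_zero, pow_zero]
      have : cosetCount (A ^ 2 ∩ Γ) (P.multiCentralizer ∅) ≤ 1 := by
        refine Set.ncard_le_one (Set.toFinite _) |>.2 ?_
        rintro _ ⟨x, hx, rfl⟩ _ ⟨y, hy, rfl⟩
        refine QuotientGroup.eq.2 ?_
        rw [multiCentralizer]
        simpa using Γ.mul_mem (Γ.inv_mem hx.2) hy.2
      exact_mod_cast this⟩
  rw [Finset.mem_filter, Finset.mem_powerset] at hJ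
  refine ⟨J, hJ.1, hJ.2, fun k hk hkJ => ?_⟩
  by_contra! hle
  have h1 := hmax (insert k J) (by
    rw [Finset.mem_filter, Finset.mem_powerset]
    refine ⟨Finset.insert_subset (Finset.mem_range.2 hk) hJ.1, ?_⟩
    rw [multiCentralizer_insert, Finset.card_insert_of_notMem hkJ]
    have h2 := cosetCount_inf_le (A ^ 2 ∩ Γ) (P.multiCentralizer J) (P.stepCentralizer k)
    have h3 : ((A ^ 2 ∩ Γ : Set G)⁻¹ * (A ^ 2 ∩ Γ) ∩ P.multiCentralizer J : Set G) ⊆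
        (A ^ 2) ^ 2 ∩ (P.multiCentralizer J : Set G) := by
      refine Set.inter_subset_inter_left _ ?_
      rw [sq (A ^ 2)]
      refine Set.mul_subset_mul (fun x hx => ?_) Set.inter_subset_left
      rw [← P.growth.inv_eq]
      exact Set.inv_mem_inv.2 hx.1 |> fun h => by rwa [inv_inv] at h
    have h4 := h2.trans (Nat.mul_le_mul_left _ (cosetCount_mono h3 _))
    calc (cosetCount (A ^ 2 ∩ Γ) (P.multiCentralizer J ⊓ P.stepCentralizer k) : ℝ)
        ≤ cosetCount (A ^ 2 ∩ Γ) (P.multiCentralizer J) *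
          cosetCount ((A ^ 2) ^ 2 ∩ (P.multiCentralizer J : Set G)) (P.stepCentralizer k) := by
          exact_mod_cast h4
      _ ≤ K ^ (M * J.card) * K ^ M := by gcongr; exact hJ.2
      _ = K ^ (M * (J.card + 1)) := by rw [← pow_add, mul_add, mul_one])
  rw [Finset.card_insert_of_notMem hkJ] at h1
  lia

end TorusData

/-! ### The subgroup `D` of `e`-th powers and the intersection `S = D ∩ U` -/

/-- The subgroup generated by the `e`-th powers of the elements of `Δ`. -/
def Subgroup.powClosure {G : Type*} [Group G] (Δ : Subgroup G) (e : ℕ) : Subgroup G :=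
  Subgroup.closure ((· ^ e) '' (Δ : Set G))

namespace Subgroup

variable {G : Type*} [Group G] (Δ : Subgroup G) (e : ℕ)

theorem powClosure_le : Δ.powClosure e ≤ Δ := by
  rw [powClosure, closure_le]
  rintro _ ⟨t, ht, rfl⟩
  exact Δ.pow_mem ht e

theorem pow_mem_powClosure {t : G} (ht : t ∈ Δ) : t ^ e ∈ Δ.powClosure e :=
  subset_closure ⟨t, ht, rfl⟩

instance powClosure_normal [Δ.Normal] : (Δ.powClosure e).Normal := by
  rw [← normalizer_eq_top_iff, powClosure, eq_top_iff]
  have key : ∀ g : G, ∀ x ∈ closure ((· ^ e) '' (Δ : Set G)),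
      g * x * g⁻¹ ∈ closure ((· ^ e) '' (Δ : Set G)) := by
    intro g x hx
    induction hx using closure_induction with
    | mem x hx =>
      obtain ⟨t, ht, rfl⟩ := hx
      refine subset_closure ⟨g * t * g⁻¹, Normal.conj_mem inferInstance t ht g, ?_⟩
      simp only [conj_pow]
    | one => rw [mul_one, mul_inv_cancel]; exact one_mem _
    | mul x y _ _ hx hy =>
      have h1 : g * (x * y) * g⁻¹ = g * x * g⁻¹ * (g * y * g⁻¹) := by group
      rw [h1]; exact mul_mem hx hy
    | inv x _ hx =>
      have h1 : g * x⁻¹ * g⁻¹ = (g * x * g⁻¹)⁻¹ := by group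
      rw [h1]; exact inv_mem hx
  intro g _
  rw [mem_normalizer_iff]
  refine fun x => ⟨key g x, fun hx => ?_⟩
  have := key g⁻¹ _ hx
  simpa [mul_assoc] using this

end Subgroup

namespace TorusData

variable {G : Type*} [Group G]
variable {n r e q : ℕ} {A : Set G} {K : ℝ} {Γ U : Subgroup G} {W : ℕ → Subgroup G}

/-- Modulo `⁅D ⊓ U, D⁆` the subgroup `D ⊓ U` is central in `D`. Commutators with the generators `t ^
e`, which are killed by `q`, then have exponents dividing both `e` and `q`. So `D` becomes abelian
of exponent dividing `q`, and `D ⊓ U`, of exponent dividing `e`, dies. -/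
theorem le_commutator_powClosure (P : TorusData n r e q A K Γ U W) {Δ : Subgroup G}
    (hΔ : Δ.Normal) (hΔΓ : Δ ≤ Γ) :
    Δ.powClosure e ⊓ U ≤ ⁅Δ.powClosure e ⊓ U, Δ.powClosure e⁆ := by
  have hU := P.normal_U
  set D := Δ.powClosure e with hD
  set N : Subgroup G := ⁅D ⊓ U, D⁆ with hN
  have hDΓ : D ≤ Γ := (Δ.powClosure_le e).trans hΔΓ
  have hDD : ∀ x ∈ D, ∀ y ∈ D, ⁅x, y⁆ ∈ D ⊓ U := fun x hx y hy =>
    ⟨D.mul_mem (D.mul_mem (D.mul_mem hx hy) (D.inv_mem hx)) (D.inv_mem hy),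
      P.commutator_le (Subgroup.commutator_mem_commutator (hDΓ hx) (Subgroup.mem_top y))⟩
  set π := QuotientGroup.mk' N with hπ
  have hker : ∀ x, π x = 1 ↔ x ∈ N := fun x => by
    rw [← MonoidHom.mem_ker, QuotientGroup.ker_mk']
  have hq : ∀ t ∈ Δ, (t ^ e) ^ q = 1 := fun t ht => by
    rw [← pow_mul, mul_comm, pow_mul]; exact P.pow_eq _ (P.pow_mem t (hΔΓ ht))
  have hcent : ∀ z ∈ D ⊓ U, ∀ d ∈ D, Commute (π z) (π d) := fun z hz d hd => by
    rw [← commutatorElement_eq_one_iff_commute, ← map_commutatorElement, hker]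
    exact Subgroup.commutator_mem_commutator hz hd
  have hcomm : ∀ x ∈ (· ^ e) '' (Δ : Set G), ∀ y ∈ D, Commute (π x) (π y) := by
    rintro _ ⟨t, ht, rfl⟩ y hy
    have hx := Δ.pow_mem_powClosure e ht
    set x := t ^ e
    have hz := hDD x hx y hy
    have h1 : π y * π x * (π y)⁻¹ = (π ⁅x, y⁆)⁻¹ * π x := by
      rw [map_commutatorElement, commutatorElement_def]; group
    have h2 : (π ⁅x, y⁆) ^ q = 1 := by
      have h3 : (π y * π x * (π y)⁻¹) ^ q = 1 := by
        rw [conj_pow, ← map_pow, hq t ht, map_one, mul_one, mul_inv_cancel]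
      rw [h1, (hcent _ hz x hx).inv_left.mul_pow, ← map_pow π x, hq t ht, map_one, mul_one,
        inv_pow, inv_eq_one] at h3
      exact h3
    have h4 : (π ⁅x, y⁆) ^ e = 1 := by rw [← map_pow, P.pow_eq _ hz.2, map_one]
    rw [← commutatorElement_eq_one_iff_commute, ← map_commutatorElement]
    exact eq_one_of_pow_eq_one_of_coprime P.coprime h4 h2
  have hcomm' : ∀ x ∈ D, ∀ y ∈ D, Commute (π x) (π y) := by
    intro x hx
    induction hx using Subgroup.closure_induction with
    | mem x hx => exact hcomm x hx
    | one => intro y _; rw [map_one]; exact Commute.one_left _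
    | mul x x' _ _ h h' => intro y hy; rw [map_mul]; exact (h y hy).mul_left (h' y hy)
    | inv x _ h => intro y hy; rw [map_inv]; exact (h y hy).inv_left
  have hpow : ∀ x ∈ D, π x ^ q = 1 := by
    intro x hx
    induction hx using Subgroup.closure_induction with
    | mem x hx =>
      obtain ⟨t, ht, rfl⟩ := hx
      dsimp only
      rw [← map_pow, hq t ht, map_one]
    | one => rw [map_one, one_pow]
    | mul x y hx hy ihx ihy =>
      rw [map_mul, (hcomm' x hx y hy).mul_pow, ihx, ihy, one_mul]
    | inv x _ ih => rw [map_inv, inv_pow, ih, inv_one]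
  intro s hs
  rw [← hker]
  exact eq_one_of_pow_eq_one_of_coprime P.coprime
    (by rw [← map_pow, P.pow_eq _ hs.2, map_one]) (hpow s hs.1)

theorem pivotData (P : TorusData n r e q A K Γ U W) {J : Finset ℕ} {T : Set G}
    (hT : T ⊆ (A ^ 2) ^ 2 ∩ (P.multiCentralizer J : Set G))
    (hsep : ∀ t ∈ T, ∀ t' ∈ T, t ≠ t' → ∀ k < r, k ∉ J → t⁻¹ * t' ∉ P.stepCentralizer k) :
    PivotData n r e q A K U ((P.multiCentralizer J).powClosure e)
      ((P.multiCentralizer J).powClosure e ⊓ U) W T := by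
  have hn := P.multiCentralizer_normal J
  have hU := P.normal_U
  have hle := P.multiCentralizer_le J
  have hDle := (P.multiCentralizer J).powClosure_le e
  have htriv : ∀ k ∈ J, ∀ d ∈ P.multiCentralizer J, ∀ x ∈ W k, ⁅d, x⁆ ∈ W (k + 1) := by
    intro k hk d hd
    exact ((Subgroup.mem_iInf.1 ((Subgroup.mem_iInf.1 hd.2) k)) hk).2
  refine
    { closure_eq := P.closure_eq
      inv_eq := P.inv_eq
      growth := P.growth
      two_le := P.two_le
      normal_U := hU
      normal_D := inferInstance
      normal_S := inferInstance
      S_le_U := inf_le_right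
      S_le_D := inf_le_left
      D_central := le_inf (Subgroup.commutator_le_left _ _)
        ((Subgroup.commutator_mono (hDle.trans hle) le_rfl).trans P.commutator_le)
      S_le := P.le_commutator_powClosure hn hle
      nilp := P.nilp
      W_zero := P.W_zero
      W_last := P.W_last
      W_conj := fun k d hd => P.W_conj k d (hle (hDle hd))
      W_comm := P.W_comm
      W_anti := P.W_anti
      pow_mem := fun d hd => ⟨Subgroup.pow_mem _ hd q, P.pow_mem d (hle (hDle hd))⟩
      pow_eq := P.pow_eq
      coprime := P.coprime
      T_sub := hT.trans Set.inter_subset_left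
      T_fac := fun t ht => ?_
      rich := fun t ht t' ht' hne k hk => ?_ }
  -- Bézout splits `t` into a power of `t ^ q ∈ U` and a power of `t ^ e ∈ D`.
  · refine ⟨(t ^ q) ^ (e.gcdB q), U.zpow_mem (P.pow_mem t (hle (hT ht).2)) _,
      (t ^ e) ^ (e.gcdA q), Subgroup.zpow_mem _ (Subgroup.pow_mem_powClosure _ e (hT ht).2) _, ?_⟩
    rw [← zpow_natCast, ← zpow_natCast, ← zpow_mul, ← zpow_mul, ← zpow_add, add_comm,
      ← Nat.gcd_eq_gcd_ab, P.coprime.gcd_eq_one]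
    simp
  · by_cases hkJ : k ∈ J
    · exact Or.inl fun d hd => htriv k hkJ d (hDle hd)
    · have hmem : t⁻¹ * t' ∈ Γ := Γ.mul_mem (Γ.inv_mem (hle (hT ht).2)) (hle (hT ht').2)
      refine Or.inr ((P.dichotomy _ hmem k hk).resolve_left fun h => ?_)
      exact hsep t ht t' ht' hne k hk hkJ ⟨hmem, h⟩

end TorusData

namespace PivotData

variable {G : Type*} [Group G]
variable {n r e q : ℕ} {A : Set G} {K : ℝ} {U D S : Subgroup G} {W : ℕ → Subgroup G} {T : Set G}

/-- When `D` acts trivially on every step, even `d = 1` meets the richness condition. Having no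
fixed points then means `S ≤ ⁅S, S⁆`, and `S` is nilpotent. -/
theorem eq_bot_of_trivial [Finite G] (P : PivotData n r e q A K U D S W T)
    (h : ∀ k < r, ∀ d ∈ D, ∀ x ∈ W k, ⁅d, x⁆ ∈ W (k + 1)) : S = ⊥ := by
  have hS := P.normal_S
  have hle : S ≤ ⁅S, S⁆ := fun x hx => P.mem_of_commutator_mem le_rfl le_rfl
    (P.S_le.trans le_sup_left) D.one_mem (fun k hk => Or.inl (h k hk)) x hx (by
      rw [commutatorElement_one_left]; exact Subgroup.one_mem _)
  have hall : ∀ i, S ≤ S.lowerCentralSeries i := by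
    intro i
    induction i with
    | zero => exact le_rfl
    | succ i ih => exact hle.trans (Subgroup.commutator_mono ih le_rfl)
  rw [eq_bot_iff, ← P.nilp]
  exact (hall n).trans (Subgroup.lowerCentralSeries_mono n P.S_le_U)

/-- Modulo `S`, the lower central series of `U * D` is that of `U`. -/
theorem lowerCentralSeries_le_sup (P : PivotData n r e q A K U D S W T) {Δ : Subgroup G}
    (hΔ : ∀ t ∈ Δ, ∃ u ∈ U, ∃ d ∈ D, t = u * d) (i : ℕ) :
    Δ.lowerCentralSeries (i + 1) ≤ U.lowerCentralSeries (i + 1) ⊔ S := by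
  have hS := P.normal_S
  have hU := P.normal_U
  induction i with
  | zero =>
    rw [Subgroup.lowerCentralSeries_succ, Subgroup.commutator_le]
    intro x hx y hy
    obtain ⟨u, hu, d, hd, rfl⟩ := hΔ x hx
    obtain ⟨u', hu', d', hd', rfl⟩ := hΔ y hy
    have h1 : ⁅u * d, u' * d'⁆ = ⁅u * d, u'⁆ * (u' * ⁅d', u * d⁆⁻¹ * u'⁻¹) := by
      simp only [commutatorElement_def]; group
    rw [h1]
    refine Subgroup.mul_mem _ (P.commutator_mem_sup hu hd (j := 0) (Subgroup.mem_sup_left hu'))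
      (Subgroup.mem_sup_right (hS.conj_mem _ (S.inv_mem (P.D_central
        (Subgroup.commutator_mem_commutator hd' (Subgroup.mem_top _)))) _))
  | succ i ih =>
    rw [Subgroup.lowerCentralSeries_succ, Subgroup.commutator_le]
    intro x hx y hy
    obtain ⟨u, hu, d, hd, rfl⟩ := hΔ y hy
    rw [← Subgroup.inv_mem_iff, commutatorElement_inv]
    exact P.commutator_mem_sup hu hd (ih hx)

theorem lowerCentralSeries_le (P : PivotData n r e q A K U D S W T) {Δ : Subgroup G}
    (hΔ : ∀ t ∈ Δ, ∃ u ∈ U, ∃ d ∈ D, t = u * d) (hn : 1 ≤ n) :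
    Δ.lowerCentralSeries n ≤ S := by
  obtain ⟨i, rfl⟩ := Nat.exists_eq_add_of_le' hn
  have := P.lowerCentralSeries_le_sup hΔ i
  rwa [P.nilp, bot_sup_eq] at this

end PivotData

/-- The main theorem for finite groups with a filtered normal subgroup. -/
theorem TorusData.exists_normal_subgroup (n r c : ℕ) (hn : 1 ≤ n) : ∃ C m : ℕ,
    ∀ {G : Type u} [Group G] [Finite G] {e q : ℕ} {A : Set G} {K : ℝ} {Γ U : Subgroup G}
      {W : ℕ → Subgroup G}, TorusData n r e q A K Γ U W → (cosetCount A Γ : ℝ) ≤ K ^ c →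
      ∃ Δ ≤ Γ, Δ.Normal ∧ (cosetCount A Δ : ℝ) ≤ K ^ C ∧
        (Δ.lowerCentralSeries n : Set G) ⊆ (A ^ 2) ^ m := by
  classical
  obtain ⟨m, M₀, hmM⟩ := PivotData.exists_subset_pow.{u} n
  -- The separation lemma loses `K ^ 7` and the number of steps, at most `r ≤ 2 ^ r ≤ K ^ r`. The
  -- last unit makes the inequality strict.
  set M := M₀ + r + 8 with hM
  refine ⟨c + M * r, m, ?_⟩
  intro G _ _ e q A K Γ U W P hc
  have hB := P.growth
  have hK1 : 1 ≤ K := hB.one_le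
  have hK0 : 0 < K := by linarith
  obtain ⟨J, hJr, hJ, hJmax⟩ := P.exists_multiCentralizer M
  set Δ := P.multiCentralizer J with hΔ
  have hcount : (cosetCount A Δ : ℝ) ≤ K ^ (c + M * r) := by
    have h1 := cosetCount_inf_le A Γ Δ
    rw [inf_eq_right.2 (P.multiCentralizer_le J), P.inv_eq, ← sq] at h1
    calc (cosetCount A Δ : ℝ) ≤ cosetCount A Γ * cosetCount (A ^ 2 ∩ Γ) Δ := by exact_mod_cast h1
      _ ≤ K ^ c * K ^ (M * J.card) := by gcongr
      _ ≤ K ^ (c + M * r) := by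
        rw [← pow_add]
        refine pow_le_pow_right₀ hK1 ?_
        have := Finset.card_le_card hJr
        rw [Finset.card_range] at this
        gcongr
  have hfac : ∀ t ∈ Δ, ∃ u ∈ U, ∃ d ∈ Δ.powClosure e, t = u * d := by
    intro t ht
    refine ⟨(t ^ q) ^ (e.gcdB q), U.zpow_mem (P.pow_mem t (P.multiCentralizer_le J ht)) _,
      (t ^ e) ^ (e.gcdA q), Subgroup.zpow_mem _ (Subgroup.pow_mem_powClosure _ e ht) _, ?_⟩
    rw [← zpow_natCast, ← zpow_natCast, ← zpow_mul, ← zpow_mul, ← zpow_add, add_comm,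
      ← Nat.gcd_eq_gcd_ab, P.coprime.gcd_eq_one]
    simp
  refine ⟨Δ, P.multiCentralizer_le J, P.multiCentralizer_normal J, hcount, ?_⟩
  rcases (Finset.range r \ J).eq_empty_or_nonempty with hI | hI
  · have Q := P.pivotData (J := J) (T := ∅) (Set.empty_subset _) (fun t ht => absurd ht (by simp))
    have hbot := Q.eq_bot_of_trivial (fun k hk d hd => ((Subgroup.mem_iInf.1
      ((Subgroup.mem_iInf.1 ((Subgroup.powClosure_le _ e hd).2) k))
        (Finset.sdiff_eq_empty_iff_subset.1 hI (Finset.mem_range.2 hk))).2))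
    intro x hx
    have h1 := Q.lowerCentralSeries_le hfac hn hx
    rw [hbot, Subgroup.mem_bot] at h1
    rw [h1]
    exact hB.one_mem_pow m
  · obtain ⟨T, hT, hsep, hcard⟩ := hB.exists_pairwise_separated Δ P.stepCentralizer hI (M := M)
      (fun k hk => hJmax k (Finset.mem_range.1 (Finset.mem_sdiff.1 hk).1)
        (Finset.mem_sdiff.1 hk).2)
    have Q := P.pivotData (J := J) hT (fun t ht t' ht' hne k hk hkJ =>
      hsep t ht t' ht' hne k (Finset.mem_sdiff.2 ⟨Finset.mem_range.2 hk, hkJ⟩))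
    refine (SetLike.coe_subset_coe.2 (Q.lowerCentralSeries_le hfac hn)).trans (hmM Q ?_)
    have hIcard : ((Finset.range r \ J).card : ℝ) ≤ K ^ r := by
      calc ((Finset.range r \ J).card : ℝ) ≤ r := by
            have := Finset.card_le_card (Finset.sdiff_subset (s := Finset.range r) (t := J))
            rw [Finset.card_range] at this
            exact_mod_cast this
        _ ≤ 2 ^ r := by exact_mod_cast Nat.lt_two_pow_self.le
        _ ≤ K ^ r := by gcongr; exact P.two_le
    have h1 : K ^ (M₀ + 1) * K ^ (r + 7) ≤ T.ncard * K ^ (r + 7) := by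
      calc K ^ (M₀ + 1) * K ^ (r + 7) = K ^ M := by
            rw [← pow_add]; exact congrArg (fun k : ℕ => K ^ k) (by lia)
        _ ≤ K ^ 7 * (Finset.range r \ J).card * T.ncard := hcard
        _ ≤ K ^ 7 * K ^ r * T.ncard := by gcongr
        _ = _ := by ring
    have h2 := le_of_mul_le_mul_right h1 (pow_pos hK0 _)
    refine lt_of_lt_of_le ?_ h2
    rw [pow_succ]
    have := P.two_le
    nlinarith [pow_pos hK0 M₀]

/-! ### Congruence subgroups of upper triangular groups -/

section Support

variable {n : ℕ} {E : Type*} [Field E]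

/-- The entries of `X` outside the relation `s` vanish. -/
def Matrix.SupportedOn (s : Fin n → Fin n → Prop) (X : Matrix (Fin n) (Fin n) E) : Prop :=
  ∀ i j, ¬ s i j → X i j = 0

/-- A relation defining a two-sided ideal of the algebra of upper triangular matrices. -/
def IsIdealRel (s : Fin n → Fin n → Prop) : Prop :=
  ∀ i i' j' j, i ≤ i' → s i' j' → j' ≤ j → s i j

namespace Matrix.SupportedOn

variable {s t w : Fin n → Fin n → Prop} {X Y : Matrix (Fin n) (Fin n) E}

theorem zero : SupportedOn s (0 : Matrix (Fin n) (Fin n) E) := fun _ _ _ => rfl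

theorem add (hX : SupportedOn s X) (hY : SupportedOn s Y) : SupportedOn s (X + Y) :=
  fun i j h => by rw [Matrix.add_apply, hX i j h, hY i j h, add_zero]

theorem neg (hX : SupportedOn s X) : SupportedOn s (-X) :=
  fun i j h => by rw [Matrix.neg_apply, hX i j h, neg_zero]

theorem sub (hX : SupportedOn s X) (hY : SupportedOn s Y) : SupportedOn s (X - Y) :=
  fun i j h => by rw [Matrix.sub_apply, hX i j h, hY i j h, sub_zero]

theorem mul (h : ∀ i l j, s i l → t l j → w i j) (hX : SupportedOn s X) (hY : SupportedOn t Y) :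
    SupportedOn w (X * Y) := by
  intro i j hij
  rw [Matrix.mul_apply]
  refine Finset.sum_eq_zero fun l _ => ?_
  by_cases hs : s i l
  · rw [hY l j fun ht => hij (h i l j hs ht), mul_zero]
  · rw [hX i l hs, zero_mul]

theorem mono (h : ∀ i j, s i j → t i j) (hX : SupportedOn s X) : SupportedOn t X :=
  fun i j hij => hX i j fun hs => hij (h i j hs)

theorem mul_left (hs : IsIdealRel s) (hX : X.IsUpperTriangular) (hY : SupportedOn s Y) :
    SupportedOn s (X * Y) :=
  mul (s := fun i j => i ≤ j) (fun i l j hil hlj => hs i l j j hil hlj le_rfl)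
    (fun _ _ h => hX (not_le.1 h)) hY

theorem mul_right (hs : IsIdealRel s) (hX : SupportedOn s X) (hY : Y.IsUpperTriangular) :
    SupportedOn s (X * Y) :=
  mul (t := fun i j => i ≤ j) (fun i l j hil hlj => hs i i l j le_rfl hil hlj) hX
    (fun _ _ h => hY (not_le.1 h))

end Matrix.SupportedOn

variable {H : Type*} [Group H] (ρ : H →* GL (Fin n) E) (hρ : ∀ h, ρ h ∈ borelSubgroup n E)

/-- The elements of a group of upper triangular matrices which are congruent to `1` modulo the ideal
defined by the relation `s`. -/
def congruenceSubgroup (s : Fin n → Fin n → Prop) (hs : IsIdealRel s) : Subgroup H where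
  carrier := {h | ((ρ h : Matrix (Fin n) (Fin n) E) - 1).SupportedOn s}
  one_mem' := by
    change Matrix.SupportedOn s _
    rw [map_one, Units.val_one, sub_self]; exact Matrix.SupportedOn.zero
  mul_mem' := by
    intro a b ha hb
    have h1 : ((ρ (a * b) : GL (Fin n) E) : Matrix (Fin n) (Fin n) E) - 1 =
        ((ρ a : Matrix (Fin n) (Fin n) E) - 1) * ρ b + ((ρ b : Matrix (Fin n) (Fin n) E) - 1) := by
      rw [map_mul, Units.val_mul]; noncomm_ring
    change Matrix.SupportedOn s _
    rw [h1]
    exact (Matrix.SupportedOn.mul_right hs ha (hρ b)).add hb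
  inv_mem' := by
    intro a ha
    have h1 : ((ρ a⁻¹ : GL (Fin n) E) : Matrix (Fin n) (Fin n) E) - 1 =
        -(((ρ a : Matrix (Fin n) (Fin n) E) - 1) * ρ a⁻¹) := by
      rw [sub_mul, ← Units.val_mul, ← map_mul, mul_inv_cancel, map_one, Units.val_one, one_mul,
        neg_sub]
    change Matrix.SupportedOn s _
    rw [h1]
    exact (Matrix.SupportedOn.mul_right hs ha (hρ a⁻¹)).neg

variable {ρ hρ} {s t w : Fin n → Fin n → Prop} {hs : IsIdealRel s} {ht : IsIdealRel t}
  {hw : IsIdealRel w}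

theorem mem_congruenceSubgroup {h : H} : h ∈ congruenceSubgroup ρ hρ s hs ↔
    ((ρ h : Matrix (Fin n) (Fin n) E) - 1).SupportedOn s := Iff.rfl

theorem congruenceSubgroup_mono (h : ∀ i j, s i j → t i j) :
    congruenceSubgroup ρ hρ s hs ≤ congruenceSubgroup ρ hρ t ht :=
  fun _ hx => Matrix.SupportedOn.mono h hx

instance congruenceSubgroup_normal : (congruenceSubgroup ρ hρ s hs).Normal := by
  refine ⟨fun x hx g => ?_⟩
  have h1 : ((ρ (g * x * g⁻¹) : GL (Fin n) E) : Matrix (Fin n) (Fin n) E) - 1 =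
      ρ g * ((ρ x : Matrix (Fin n) (Fin n) E) - 1) * ρ g⁻¹ := by
    rw [mul_sub, sub_mul, mul_one, ← Units.val_mul, ← Units.val_mul, ← Units.val_mul, ← map_mul,
      ← map_mul, ← map_mul, mul_inv_cancel, map_one, Units.val_one]
  rw [mem_congruenceSubgroup, h1]
  exact Matrix.SupportedOn.mul_right hs (Matrix.SupportedOn.mul_left hs (hρ g) hx) (hρ g⁻¹)

/-- For matrices, `⁅a, b⁆ - 1 = ((a - 1) * (b - 1) - (b - 1) * (a - 1)) * a⁻¹ * b⁻¹`. -/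
theorem commutator_mem_congruenceSubgroup (h : ∀ i l j, s i l → t l j → w i j)
    (h' : ∀ i l j, t i l → s l j → w i j) {a b : H} (ha : a ∈ congruenceSubgroup ρ hρ s hs)
    (hb : b ∈ congruenceSubgroup ρ hρ t ht) : ⁅a, b⁆ ∈ congruenceSubgroup ρ hρ w hw := by
  have h1 : ((ρ ⁅a, b⁆ : GL (Fin n) E) : Matrix (Fin n) (Fin n) E) - 1 =
      (((ρ a : Matrix (Fin n) (Fin n) E) - 1) * ((ρ b : Matrix (Fin n) (Fin n) E) - 1) -
      ((ρ b : Matrix (Fin n) (Fin n) E) - 1) * ((ρ a : Matrix (Fin n) (Fin n) E) - 1)) *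
        ρ (a⁻¹ * b⁻¹) := by
    have h2 : ((ρ a : Matrix (Fin n) (Fin n) E) - 1) * ((ρ b : Matrix (Fin n) (Fin n) E) - 1) -
        ((ρ b : Matrix (Fin n) (Fin n) E) - 1) * ((ρ a : Matrix (Fin n) (Fin n) E) - 1) =
        ρ a * ρ b - ρ b * ρ a := by noncomm_ring
    rw [h2, sub_mul, ← Units.val_mul, ← Units.val_mul, ← Units.val_mul, ← Units.val_mul,
      ← map_mul, ← map_mul, ← map_mul, ← map_mul, show b * a * (a⁻¹ * b⁻¹) = 1 by group,
      map_one, Units.val_one, commutatorElement_def, mul_assoc (a * b)]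
  rw [mem_congruenceSubgroup, h1]
  exact Matrix.SupportedOn.mul_right hw ((Matrix.SupportedOn.mul h ha hb).sub
    (Matrix.SupportedOn.mul h' hb ha)) (hρ _)

theorem congruenceSubgroup_eq_bot (hinj : Function.Injective ρ) (h : ∀ i j, ¬ s i j) :
    congruenceSubgroup ρ hρ s hs = ⊥ := by
  rw [eq_bot_iff]
  intro x hx
  rw [Subgroup.mem_bot]
  apply hinj
  apply Units.ext
  rw [map_one, Units.val_one, ← sub_eq_zero]
  ext i j
  exact hx i j (h i j)

end Support

/-! ### An ordering of the entries above the diagonal -/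

/-- The position of the `(i, j)` entry in the filtration of strictly upper triangular matrices by
ideals of codimension one. -/
def entryPos (n : ℕ) (i j : Fin n) : ℤ := (j : ℤ) * n - (i : ℤ) * (n - 1)

/-- The relation defining the `k`-th term of the filtration. -/
def posRel (n k : ℕ) (i j : Fin n) : Prop := (n : ℤ) + k ≤ entryPos n i j

/-- The relation defining the filtration by distance from the diagonal. -/
def degRel (n d : ℕ) (i j : Fin n) : Prop := (i : ℕ) + d ≤ j

section Relations

variable {n : ℕ}

theorem posRel_isIdealRel (k : ℕ) : IsIdealRel (posRel n k) := by
  intro i i' j' j hi h hj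
  have hn : (1 : ℤ) ≤ n := by exact_mod_cast i.pos
  have hi' : (i : ℤ) ≤ i' := by exact_mod_cast hi
  have hj' : (j' : ℤ) ≤ j := by exact_mod_cast hj
  unfold posRel entryPos at *
  nlinarith [mul_le_mul_of_nonneg_right hi' (sub_nonneg.2 hn),
    mul_le_mul_of_nonneg_right hj' (by linarith : (0 : ℤ) ≤ n)]

theorem degRel_isIdealRel (d : ℕ) : IsIdealRel (degRel n d) := by
  intro i i' j' j hi h hj
  unfold degRel at *
  have hi' : (i : ℕ) ≤ i' := hi
  have hj' : (j' : ℕ) ≤ j := hj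
  lia

theorem posRel_zero_iff {i j : Fin n} : posRel n 0 i j ↔ i < j := by
  have hn : (1 : ℤ) ≤ n := by exact_mod_cast i.pos
  have hi : (i : ℤ) < n := by exact_mod_cast i.2
  have hi0 : (0 : ℤ) ≤ i := by positivity
  unfold posRel entryPos
  rw [← Fin.val_fin_lt]
  constructor
  · intro h
    by_contra! hle
    have hle' : (j : ℤ) ≤ i := by exact_mod_cast hle
    have := mul_le_mul_of_nonneg_right hle' (by linarith : (0 : ℤ) ≤ n)
    push_cast at h
    nlinarith
  · intro h
    have h' : (i : ℤ) + 1 ≤ j := by exact_mod_cast h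
    have := mul_le_mul_of_nonneg_right h' (by linarith : (0 : ℤ) ≤ n)
    push_cast
    nlinarith

theorem degRel_one_iff {i j : Fin n} : degRel n 1 i j ↔ i < j := Iff.rfl

/-- Moving up one row raises the position by `n - 1`, and moving right one column raises it by `n`.
Both are positive since `n ≥ 2`. -/
theorem posRel_succ_of_lt_left (hn : 2 ≤ n) {k : ℕ} {i l j : Fin n} (hil : i < l)
    (hlj : posRel n k l j) : posRel n (k + 1) i j := by
  unfold posRel entryPos at *
  have h' : (i : ℤ) + 1 ≤ l := by exact_mod_cast hil
  have hn' : (2 : ℤ) ≤ n := by exact_mod_cast hn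
  have := mul_le_mul_of_nonneg_right h' (by linarith : (0 : ℤ) ≤ n - 1)
  push_cast
  nlinarith

theorem posRel_succ_of_lt_right (hn : 2 ≤ n) {k : ℕ} {i l j : Fin n} (hil : posRel n k i l)
    (hlj : l < j) : posRel n (k + 1) i j := by
  unfold posRel entryPos at *
  have h' : (l : ℤ) + 1 ≤ j := by exact_mod_cast hlj
  have hn' : (2 : ℤ) ≤ n := by exact_mod_cast hn
  have := mul_le_mul_of_nonneg_right h' (by linarith : (0 : ℤ) ≤ n)
  push_cast
  nlinarith

theorem posRel_of_succ {k : ℕ} {i j : Fin n} (h : posRel n (k + 1) i j) : posRel n k i j := by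
  unfold posRel at *
  push_cast at h
  linarith

theorem not_posRel_sq (i j : Fin n) : ¬ posRel n (n ^ 2) i j := by
  unfold posRel entryPos
  have hn : (1 : ℤ) ≤ n := by exact_mod_cast i.pos
  have hj : (j : ℤ) + 1 ≤ n := by exact_mod_cast j.2
  have hi0 : (0 : ℤ) ≤ i := by positivity
  have := mul_le_mul_of_nonneg_right hj (by linarith : (0 : ℤ) ≤ n)
  have h2 := mul_nonneg hi0 (by linarith : (0 : ℤ) ≤ n - 1)
  push_cast
  nlinarith

/-- The position equals `i + n * (j - i)`, so `i` is its residue modulo `n`. Hence each step of the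
filtration carries at most one entry. -/
theorem entryPos_injective {i j i' j' : Fin n} (h : entryPos n i j = entryPos n i' j') :
    i = i' ∧ j = j' := by
  have hmod : ∀ i j : Fin n, entryPos n i j % n = i := by
    intro i j
    have h1 : entryPos n i j = (i : ℤ) + ((j : ℤ) - i) * n := by unfold entryPos; ring
    rw [h1, Int.add_mul_emod_self_right]
    exact Int.emod_eq_of_lt (by positivity) (by exact_mod_cast i.2)
  have hi : (i : ℤ) = i' := by rw [← hmod i j, h, hmod]
  have hn : (0 : ℤ) < n := by exact_mod_cast i.pos
  refine ⟨Fin.ext (by exact_mod_cast hi), Fin.ext ?_⟩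
  unfold entryPos at h
  rw [hi] at h
  have h2 : (j : ℤ) * n = j' * n := by linarith
  exact_mod_cast mul_right_cancel₀ hn.ne' h2

theorem eq_of_posRel_of_not_posRel_succ {k : ℕ} {i j : Fin n} (h : posRel n k i j)
    (h' : ¬ posRel n (k + 1) i j) : entryPos n i j = n + k := by
  unfold posRel at *
  push_cast at h'
  lia

end Relations

/-! ### The filtration of the unipotent part and the action on its steps -/

section Triangular

variable {n : ℕ} {E : Type*} [Field E] {H : Type*} [Group H]

theorem Matrix.IsUpperTriangular.mul_apply_self {X Y : Matrix (Fin n) (Fin n) E}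
    (hX : X.IsUpperTriangular) (hY : Y.IsUpperTriangular) (i : Fin n) :
    (X * Y) i i = X i i * Y i i := by
  rw [Matrix.mul_apply]
  refine Finset.sum_eq_single i (fun l _ hl => ?_) (fun h => absurd (Finset.mem_univ i) h)
  rcases lt_or_gt_of_ne hl with h | h
  · rw [hX h, zero_mul]
  · rw [hY h, mul_zero]

/-- The `i`-th diagonal character of a group of upper triangular matrices. -/
def diagonalCharacter (ρ : H →* GL (Fin n) E) (hρ : ∀ h, ρ h ∈ borelSubgroup n E) (i : Fin n) :
    H →* E where
  toFun h := (ρ h : Matrix (Fin n) (Fin n) E) i i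
  map_one' := by rw [map_one, Units.val_one, Matrix.one_apply_eq]
  map_mul' a b := by
    rw [map_mul, Units.val_mul, Matrix.IsUpperTriangular.mul_apply_self (hρ a) (hρ b)]

variable {ρ : H →* GL (Fin n) E} {hρ : ∀ h, ρ h ∈ borelSubgroup n E}

variable (ρ hρ) in
/-- The filtration of the unipotent part of a group of upper triangular matrices. -/
def unipotentFiltration (k : ℕ) : Subgroup H :=
  congruenceSubgroup ρ hρ (posRel n k) (posRel_isIdealRel k)

instance unipotentFiltration_normal (k : ℕ) : (unipotentFiltration ρ hρ k).Normal :=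
  congruenceSubgroup_normal

theorem unipotentFiltration_succ_le (k : ℕ) :
    unipotentFiltration ρ hρ (k + 1) ≤ unipotentFiltration ρ hρ k :=
  congruenceSubgroup_mono fun _ _ => posRel_of_succ

theorem unipotentFiltration_antitone : Antitone (unipotentFiltration ρ hρ) :=
  antitone_nat_of_succ_le unipotentFiltration_succ_le

theorem commutator_mem_unipotentFiltration (hn : 2 ≤ n) {k : ℕ} {u x : H}
    (hu : u ∈ unipotentFiltration ρ hρ 0) (hx : x ∈ unipotentFiltration ρ hρ k) :
    ⁅u, x⁆ ∈ unipotentFiltration ρ hρ (k + 1) :=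
  commutator_mem_congruenceSubgroup (s := posRel n 0) (t := posRel n k) (w := posRel n (k + 1))
    (fun _ _ _ h h' => posRel_succ_of_lt_left hn (posRel_zero_iff.1 h) h')
    (fun _ _ _ h h' => posRel_succ_of_lt_right hn h (posRel_zero_iff.1 h')) hu hx

/-- The one-entry filtration is too long to give class `n - 1`; the coarser filtration by distance
from the diagonal does. -/
theorem lowerCentralSeries_unipotentFiltration (hn : 2 ≤ n) (hinj : Function.Injective ρ) :
    (unipotentFiltration ρ hρ 0).lowerCentralSeries (n - 1) = ⊥ := by
  have key : ∀ i, (unipotentFiltration ρ hρ 0).lowerCentralSeries i ≤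
      congruenceSubgroup ρ hρ (degRel n (i + 1)) (degRel_isIdealRel _) := by
    intro i
    induction i with
    | zero =>
      exact congruenceSubgroup_mono (hs := posRel_isIdealRel 0)
        fun _ _ h => degRel_one_iff.2 (posRel_zero_iff.1 h)
    | succ i ih =>
      rw [Subgroup.lowerCentralSeries_succ, Subgroup.commutator_le]
      intro x hx y hy
      refine commutator_mem_congruenceSubgroup (fun a b c hab hbc => ?_)
        (fun a b c hab hbc => ?_) (ih hx) hy
      · have := posRel_zero_iff.1 hbc
        rw [← Fin.val_fin_lt] at this
        unfold degRel at *
        lia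
      · have := posRel_zero_iff.1 hab
        rw [← Fin.val_fin_lt] at this
        unfold degRel at *
        lia
  rw [eq_bot_iff]
  refine (key _).trans (congruenceSubgroup_eq_bot hinj fun i j h => ?_).le
  unfold degRel at h
  have := j.2
  lia

theorem pow_eq_one_of_mem_unipotentFiltration {p : ℕ} (hp : p.Prime) [CharP E p] (hn : 2 ≤ n)
    (hinj : Function.Injective ρ) {u : H} (hu : u ∈ unipotentFiltration ρ hρ 0) :
    u ^ p ^ n = 1 := by
  have : Fact p.Prime := ⟨hp⟩
  have : NeZero n := ⟨by lia⟩
  set X : Matrix (Fin n) (Fin n) E := (ρ u : Matrix (Fin n) (Fin n) E) - 1 with hX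
  have hpow : ∀ m, Matrix.SupportedOn (degRel n m) (X ^ m) := by
    intro m
    induction m with
    | zero =>
      intro i j hij
      rw [pow_zero]
      exact Matrix.one_apply_ne fun h => hij (by rw [h]; exact le_rfl)
    | succ m ih =>
      rw [pow_succ]
      refine Matrix.SupportedOn.mul (fun i l j hil hlj => ?_) ih hu
      have := posRel_zero_iff.1 hlj
      rw [← Fin.val_fin_lt] at this
      unfold degRel at *
      lia
  have hzero : X ^ p ^ n = 0 := by
    have h1 : X ^ n = 0 := by
      ext i j
      refine hpow n i j fun h => ?_
      unfold degRel at h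
      have := j.2
      lia
    rw [← Nat.sub_add_cancel (Nat.lt_pow_self hp.one_lt (n := n)).le, pow_add, h1, mul_zero]
  apply hinj
  apply Units.ext
  have h2 : (ρ u : Matrix (Fin n) (Fin n) E) = X + 1 := by rw [hX, sub_add_cancel]
  rw [map_pow, map_one, Units.val_pow_eq_pow_val, h2,
    add_pow_char_pow_of_commute p n (Commute.one_right X), hzero, one_pow, zero_add,
    Units.val_one]

/-- This power has `p`-power order, and in characteristic `p` the only diagonal entry of `p`-power
order is `1`. -/
theorem pow_mem_unipotentFiltration [Finite H] {p : ℕ} (hp : p.Prime) [CharP E p] (h : H) :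
    h ^ (ordCompl[p] (Nat.card H)) ∈ unipotentFiltration ρ hρ 0 := by
  have : Fact p.Prime := ⟨hp⟩
  set g := h ^ (ordCompl[p] (Nat.card H)) with hg
  have hg1 : g ^ (ordProj[p] (Nat.card H)) = 1 := by
    rw [hg, ← pow_mul, mul_comm, Nat.ordProj_mul_ordCompl_eq_self, pow_card_eq_one']
  intro i j hij
  rw [posRel_zero_iff] at hij
  rcases (not_lt.1 hij).lt_or_eq with h1 | rfl
  · rw [Matrix.sub_apply, Matrix.one_apply_ne h1.ne', sub_zero]
    exact hρ g h1
  · have h2 : (diagonalCharacter ρ hρ j g) ^ (ordProj[p] (Nat.card H)) = 1 := by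
      rw [← map_pow, hg1, map_one]
    have h3 : (diagonalCharacter ρ hρ j g) = 1 := by
      have h4 := sub_pow_char_pow (p := p) (n := (Nat.card H).factorization p)
        (diagonalCharacter ρ hρ j g) 1
      rw [h2, one_pow, sub_self] at h4
      exact sub_eq_zero.1 (pow_eq_zero_iff (pow_ne_zero _ hp.ne_zero) |>.1 h4)
    rw [Matrix.sub_apply, Matrix.one_apply_eq, sub_eq_zero]
    exact h3

/-- An automorphism acting on a one-dimensional section as multiplication by a scalar `χ ≠ 1`
has no fixed points on finite images of this section. -/
theorem mem_map_of_commutator_mem_map [Finite H] {Q : Type*} [Group Q] (ψ : H →* Q)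
    {V V' : Subgroup H} [V.Normal] (hV' : V' ≤ V) {f : H → E} {b : H} {χ : E} (hχ : χ ≠ 1)
    (hadd : ∀ v ∈ V, ∀ v' ∈ V, f (v * v') = f v + f v') (hker : ∀ v ∈ V, v ∈ V' ↔ f v = 0)
    (hconj : ∀ v ∈ V, f (b * v * b⁻¹) = χ * f v) {v : H} (hv : v ∈ V)
    (hbv : ψ ⁅b, v⁆ ∈ V'.map ψ) : ψ v ∈ V'.map ψ := by
  have hinv : ∀ v ∈ V, f v⁻¹ = -f v := fun v hv => by
    have h1 := hadd v hv v⁻¹ (V.inv_mem hv)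
    rw [mul_inv_cancel, (hker 1 V.one_mem).1 V'.one_mem] at h1
    exact (neg_eq_of_add_eq_zero_right h1.symm).symm
  have hVc : ∀ v ∈ V, ⁅b, v⁆ ∈ V := fun v hv =>
    V.mul_mem (Subgroup.Normal.conj_mem inferInstance v hv b) (V.inv_mem hv)
  have hcomm : ∀ v ∈ V, f ⁅b, v⁆ = (χ - 1) * f v := fun v hv => by
    rw [commutatorElement_def, hadd _ (Subgroup.Normal.conj_mem inferInstance v hv b) _
      (V.inv_mem hv), hconj v hv, hinv v hv]
    ring
  obtain ⟨w, hw, hwv⟩ := hbv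
  have hχ' : χ - 1 ≠ 0 := sub_ne_zero.2 hχ
  -- The finite set `X` is stable under multiplication by `χ - 1 ≠ 0`, which therefore permutes it.
  -- From `(χ - 1) * f v ∈ X` one gets `f v ∈ X`, so `v` can be corrected into `V'` by an element of
  -- `ψ.ker`.
  set X : Set E := f '' (ψ.ker ⊓ V : Subgroup H) with hX
  have hmaps : Set.MapsTo (fun x => (χ - 1) * x) X X := by
    rintro _ ⟨z, hz, rfl⟩
    refine ⟨⁅b, z⁆, ⟨?_, hVc z hz.2⟩, hcomm z hz.2⟩
    have h1 : ψ z = 1 := hz.1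
    change ψ _ = 1
    rw [map_commutatorElement, h1, commutatorElement_one_right]
  have hsurj : Set.SurjOn (fun x => (χ - 1) * x) X X :=
    (Set.eq_of_subset_of_ncard_le hmaps.image_subset
      (Set.InjOn.ncard_image fun x _ y _ h => mul_left_cancel₀ hχ' h).ge
      ((Set.toFinite _).image f)).ge
  have hz : (χ - 1) * f v ∈ X := by
    refine ⟨w⁻¹ * ⁅b, v⁆, ⟨?_, V.mul_mem (V.inv_mem (hV' hw)) (hVc v hv)⟩, ?_⟩
    · change ψ _ = 1
      rw [map_mul, map_inv, hwv, inv_mul_cancel]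
    · rw [hadd _ (V.inv_mem (hV' hw)) _ (hVc v hv), hinv w (hV' hw), (hker w (hV' hw)).1 hw,
        hcomm v hv, neg_zero, zero_add]
  obtain ⟨_, ⟨z, hz, rfl⟩, hzv⟩ := hsurj hz
  have h1 : f z = f v := mul_left_cancel₀ hχ' hzv
  refine ⟨v * z⁻¹, (hker _ (V.mul_mem hv (V.inv_mem hz.2))).2 ?_, ?_⟩
  · rw [hadd v hv _ (V.inv_mem hz.2), hinv z hz.2, h1, add_neg_cancel]
  · have h2 : ψ z = 1 := hz.1
    rw [map_mul, map_inv, h2, inv_one, mul_one]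

/-- The single entry `(i, j)` at position `n + k`, if there is one, is an additive coordinate on the
step, and `b` multiplies it by `b i i / b j j`. The two cases are ratio `1` and ratio different from
`1`. -/
theorem commutator_mem_or_of_unipotentFiltration [Finite H] (hn : 2 ≤ n) {Q : Type*} [Group Q]
    (ψ : H →* Q) (b : H) (k : ℕ) :
    (∀ v ∈ unipotentFiltration ρ hρ k, ⁅b, v⁆ ∈ unipotentFiltration ρ hρ (k + 1)) ∨
    (∀ v ∈ unipotentFiltration ρ hρ k, ψ ⁅b, v⁆ ∈ (unipotentFiltration ρ hρ (k + 1)).map ψ →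
      ψ v ∈ (unipotentFiltration ρ hρ (k + 1)).map ψ) := by
  by_cases hex : ∃ i j : Fin n, entryPos n i j = n + k
  swap
  · left
    have hle : unipotentFiltration ρ hρ k ≤ unipotentFiltration ρ hρ (k + 1) :=
      congruenceSubgroup_mono fun i j h => by
        by_contra h'
        exact hex ⟨i, j, eq_of_posRel_of_not_posRel_succ h h'⟩
    intro v hv
    exact hle (Subgroup.mul_mem _ (Subgroup.Normal.conj_mem inferInstance v hv b)
      (Subgroup.inv_mem _ hv))
  obtain ⟨i, j, hij⟩ := hex
  have hijk : posRel n k i j := by unfold posRel; rw [hij]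
  have hijk' : ¬ posRel n (k + 1) i j := by unfold posRel; rw [hij]; push_cast; lia
  set f : H → E := fun v => ((ρ v : Matrix (Fin n) (Fin n) E) - 1) i j with hf
  have hadd : ∀ v ∈ unipotentFiltration ρ hρ k, ∀ v' ∈ unipotentFiltration ρ hρ k,
      f (v * v') = f v + f v' := by
    intro v hv v' hv'
    have h1 : ((ρ (v * v') : GL (Fin n) E) : Matrix (Fin n) (Fin n) E) - 1 =
        ((ρ v : Matrix (Fin n) (Fin n) E) - 1) * ((ρ v' : Matrix (Fin n) (Fin n) E) - 1) +
        (((ρ v : Matrix (Fin n) (Fin n) E) - 1) + ((ρ v' : Matrix (Fin n) (Fin n) E) - 1)) := by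
      rw [map_mul, Units.val_mul]; noncomm_ring
    have h2 : Matrix.SupportedOn (posRel n (k + 1))
        (((ρ v : Matrix (Fin n) (Fin n) E) - 1) * ((ρ v' : Matrix (Fin n) (Fin n) E) - 1)) :=
      Matrix.SupportedOn.mul (s := posRel n 0) (t := posRel n k)
        (fun _ _ _ h h' => posRel_succ_of_lt_left hn (posRel_zero_iff.1 h) h')
        (unipotentFiltration_antitone (Nat.zero_le k) hv) hv'
    simp only [hf]
    rw [h1, Matrix.add_apply, h2 i j hijk', zero_add, Matrix.add_apply]
  have hker : ∀ v ∈ unipotentFiltration ρ hρ k,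
      v ∈ unipotentFiltration ρ hρ (k + 1) ↔ f v = 0 := by
    intro v hv
    refine ⟨fun h => h i j hijk', fun h i' j' hij' => ?_⟩
    by_cases h' : posRel n k i' j'
    · obtain ⟨rfl, rfl⟩ := entryPos_injective
        ((eq_of_posRel_of_not_posRel_succ h' hij').trans hij.symm)
      exact h
    · exact hv i' j' h'
  have hb : ∀ l : Fin n, (ρ b : Matrix (Fin n) (Fin n) E) l l ≠ 0 := fun l =>
    ((Group.isUnit b).map (diagonalCharacter ρ hρ l)).ne_zero
  set χ : E := (ρ b : Matrix (Fin n) (Fin n) E) i i / (ρ b : Matrix (Fin n) (Fin n) E) j j with hχ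
  have hconj : ∀ v ∈ unipotentFiltration ρ hρ k, f (b * v * b⁻¹) = χ * f v := by
    intro v hv
    have hv' : b * v * b⁻¹ ∈ unipotentFiltration ρ hρ k :=
      Subgroup.Normal.conj_mem inferInstance v hv b
    have h1 : (((ρ (b * v * b⁻¹) : GL (Fin n) E) : Matrix (Fin n) (Fin n) E) - 1) * ρ b =
        ρ b * ((ρ v : Matrix (Fin n) (Fin n) E) - 1) := by
      rw [sub_mul, mul_sub, one_mul, mul_one, ← Units.val_mul, ← Units.val_mul, ← map_mul,
        ← map_mul, inv_mul_cancel_right]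
    have h2 := congrFun (congrFun h1 i) j
    rw [Matrix.mul_apply, Matrix.mul_apply, Finset.sum_eq_single j, Finset.sum_eq_single i] at h2
    · rw [hχ, div_mul_eq_mul_div, eq_div_iff (hb j)]
      exact h2
    · intro l _ hl
      rcases lt_or_gt_of_ne hl with h | h
      · rw [hρ b h, zero_mul]
      · rw [hv l j fun h' => hijk' (posRel_succ_of_lt_left hn h h'), mul_zero]
    · exact fun h => absurd (Finset.mem_univ i) h
    · intro l _ hl
      rcases lt_or_gt_of_ne hl with h | h
      · rw [hv' i l fun h' => hijk' (posRel_succ_of_lt_right hn h' h), zero_mul]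
      · rw [hρ b h, mul_zero]
    · exact fun h => absurd (Finset.mem_univ j) h
  by_cases hχ1 : χ = 1
  · left
    intro v hv
    have hcv : b * v * b⁻¹ ∈ unipotentFiltration ρ hρ k :=
      Subgroup.Normal.conj_mem inferInstance v hv b
    have h1 : b * v * b⁻¹ = ⁅b, v⁆ * v := by rw [commutatorElement_def]; group
    have h2 : ⁅b, v⁆ ∈ unipotentFiltration ρ hρ k :=
      Subgroup.mul_mem _ hcv (Subgroup.inv_mem _ hv)
    rw [hker _ h2]
    have h3 := hadd _ h2 v hv
    rw [← h1, hconj v hv, hχ1, one_mul] at h3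
    exact left_eq_add.1 (by rw [add_comm]; exact h3)
  · right
    exact fun v hv hbv => mem_map_of_commutator_mem_map ψ (unipotentFiltration_succ_le k) hχ1 hadd
      hker hconj hv hbv

/-- The filtration of the image of a group of upper triangular matrices. -/
theorem torusData_of_upperTriangular [Finite H] {p : ℕ} (hp : p.Prime) [CharP E p] (hn : 2 ≤ n)
    (hinj : Function.Injective ρ) {Q : Type*} [Group Q] (ψ : H →* Q) {A : Set Q} {K : ℝ}
    (hA : Subgroup.closure A = ⊤) (hinv : A⁻¹ = A) (hgrowth : SmallGrowth (A ^ 2) K) (hK : 2 ≤ K)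
    (hnormal : ψ.range.Normal) (hp_elt : ∀ d ∈ ψ.range, ∀ g : Q, ∃ a : ℕ, ⁅d, g⁆ ^ p ^ a = 1) :
    TorusData (n - 1) (n ^ 2) (p ^ n) (ordCompl[p] (Nat.card H)) A K ψ.range
      ((unipotentFiltration ρ hρ 0).map ψ) (fun k => (unipotentFiltration ρ hρ k).map ψ) := by
  have hcop : p.Coprime (ordCompl[p] (Nat.card H)) := Nat.coprime_ordCompl hp Nat.card_pos.ne'
  have hpow : ∀ d ∈ ψ.range, d ^ (ordCompl[p] (Nat.card H)) ∈
      (unipotentFiltration ρ hρ 0).map ψ := by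
    rintro _ ⟨h, rfl⟩
    exact ⟨_, pow_mem_unipotentFiltration hp h, map_pow _ _ _⟩
  have hle : ∀ k, (unipotentFiltration ρ hρ k).map ψ ≤ ψ.range := fun k => by
    rintro _ ⟨h, -, rfl⟩
    exact ⟨h, rfl⟩
  -- A commutator `⁅d, g⁆` has `p`-power order and stays in the normal subgroup `ψ.range`, where a
  -- power prime to `p` falls into the unipotent part.
  have hcomm : ⁅ψ.range, (⊤ : Subgroup Q)⁆ ≤ (unipotentFiltration ρ hρ 0).map ψ := by
    rw [Subgroup.commutator_le]
    intro d hd g _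
    obtain ⟨a, ha⟩ := hp_elt d hd g
    exact Subgroup.mem_of_pow_mem_of_coprime _ (hcop.pow_left a) (by rw [ha]; exact one_mem _)
      (hpow _ (Subgroup.commutator_le_left _ _ (Subgroup.commutator_mem_commutator hd
        (Subgroup.mem_top g))))
  refine
    { closure_eq := hA
      inv_eq := hinv
      growth := hgrowth
      two_le := hK
      normal_U := ⟨fun u hu g => ?_⟩
      U_le := hle 0
      commutator_le := hcomm
      nilp := by
        rw [← Subgroup.map_lowerCentralSeries, lowerCentralSeries_unipotentFiltration hn hinj,
          Subgroup.map_bot]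
      W_zero := rfl
      W_last := by
        rw [unipotentFiltration, congruenceSubgroup_eq_bot hinj not_posRel_sq, Subgroup.map_bot]
      W_conj := ?_
      W_comm := ?_
      W_anti := fun k => Subgroup.map_mono (unipotentFiltration_succ_le k)
      pow_mem := hpow
      pow_eq := ?_
      coprime := hcop.pow_left n
      dichotomy := ?_ }
  · have h1 : g * u * g⁻¹ = ⁅u, g⁆⁻¹ * u := by simp only [commutatorElement_def]; group
    rw [h1]
    exact Subgroup.mul_mem _ (Subgroup.inv_mem _ (hcomm
      (Subgroup.commutator_mem_commutator (hle 0 hu) (Subgroup.mem_top g)))) hu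
  · rintro k _ ⟨d, rfl⟩ _ ⟨x, hx, rfl⟩
    exact ⟨d * x * d⁻¹, Subgroup.Normal.conj_mem inferInstance x hx d, by
      rw [map_mul, map_mul, map_inv]⟩
  · rintro k _ ⟨u, hu, rfl⟩ _ ⟨x, hx, rfl⟩
    exact ⟨⁅u, x⁆, commutator_mem_unipotentFiltration hn hu hx, map_commutatorElement _ _ _⟩
  · rintro _ ⟨u, hu, rfl⟩
    rw [← map_pow, pow_eq_one_of_mem_unipotentFiltration hp hn hinj hu, map_one]
  · rintro _ ⟨b, rfl⟩ k _
    rcases commutator_mem_or_of_unipotentFiltration (ρ := ρ) (hρ := hρ) hn ψ b k with h | h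
    · left
      rintro _ ⟨v, hv, rfl⟩
      exact ⟨⁅b, v⁆, h v hv, map_commutatorElement _ _ _⟩
    · right
      rintro _ ⟨v, hv, rfl⟩ hbv
      rw [← map_commutatorElement] at hbv
      exact h v hv hbv

end Triangular

/-! ### Reduction to `G / P`, and very small tripling -/

theorem Set.ncard_image_le_of_imp {α β γ δ : Type*} {f : α → β} {g : γ → δ} (h : α → γ)
    {s : Set α} {t : Set γ} (ht : (g '' t).Finite) (hst : Set.MapsTo h s t)
    (himp : ∀ a ∈ s, ∀ b ∈ s, g (h a) = g (h b) → f a = f b) :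
    (f '' s).ncard ≤ (g '' t).ncard := by
  rcases s.eq_empty_or_nonempty with rfl | ⟨a₀, -⟩
  · simp
  have : Nonempty α := ⟨a₀⟩
  have hex : ∀ q : β, q ∈ f '' s → ∃ a ∈ s, f a = q := fun q hq => hq
  choose! r hr hrf using hex
  refine Set.ncard_le_ncard_of_injOn (fun q => g (h (r q)))
    (fun q hq => Set.mem_image_of_mem g (hst (hr q hq))) (fun q hq q' hq' heq => ?_) ht
  rw [← hrf q hq, ← hrf q' hq']
  exact himp _ (hr q hq) _ (hr q' hq') heq

section Sections

variable {L : Type u} [Group L]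

theorem conj_mem_of_characteristic {G Γ P : Subgroup L} (hΓ : ∀ g ∈ G, ∀ x ∈ Γ, g * x * g⁻¹ ∈ Γ)
    (hP : P ≤ Γ) [hchar : (P.subgroupOf Γ).Characteristic] :
    ∀ g ∈ G, ∀ x ∈ P, g * x * g⁻¹ ∈ P := by
  intro g hg x hx
  have hΓ' : ∀ y ∈ Γ, g⁻¹ * y * g ∈ Γ := fun y hy => by
    have := hΓ g⁻¹ (G.inv_mem hg) y hy
    rwa [inv_inv] at this
  let φ : Γ ≃* Γ :=
    { toFun := fun y => ⟨g * y * g⁻¹, hΓ g hg y y.2⟩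
      invFun := fun y => ⟨g⁻¹ * y * g, hΓ' y y.2⟩
      left_inv := fun y => Subtype.ext (by simp [mul_assoc])
      right_inv := fun y => Subtype.ext (by simp [mul_assoc])
      map_mul' := fun y z => Subtype.ext (by simp [mul_assoc]) }
  exact Subgroup.characteristic_iff_le_comap.1 hchar φ (show (⟨x, hP hx⟩ : Γ) ∈ _ from hx)

theorem exists_commutator_pow_mem {p : ℕ} {G Γ P : Subgroup L}
    (hΓ : ∀ g ∈ G, ∀ x ∈ Γ, g * x * g⁻¹ ∈ Γ) [(P.subgroupOf Γ).Normal]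
    (h : ActsTriviallyMod G Γ P (pCore p (SectionOf Γ P))) {g x : L} (hg : g ∈ G) (hx : x ∈ Γ) :
    ∃ a : ℕ, ⁅x, g⁆ ^ p ^ a ∈ P := by
  set y : Γ := ⟨g * x * g⁻¹, hΓ g hg x hx⟩ with hy
  have h1 := h g hg ⟨x, hx⟩ y rfl
  have h2 : (QuotientGroup.mk ((⟨x, hx⟩ : Γ) * y⁻¹) : SectionOf Γ P) ∈
      pCore p (SectionOf Γ P) := by
    rw [← QuotientGroup.eq_one_iff]
    change (QuotientGroup.mk (QuotientGroup.mk (⟨x, hx⟩ : Γ) : SectionOf Γ P) :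
      SectionOf Γ P ⧸ pCore p (SectionOf Γ P)) *
      (QuotientGroup.mk (QuotientGroup.mk y : SectionOf Γ P))⁻¹ = 1
    rw [h1, mul_inv_cancel]
  obtain ⟨a, ha⟩ := (pCore_isGreatest p (SectionOf Γ P)).1.2 ⟨_, h2⟩
  refine ⟨a, ?_⟩
  have h3 := congrArg Subtype.val ha
  change (QuotientGroup.mk ((⟨x, hx⟩ : Γ) * y⁻¹) : SectionOf Γ P) ^ p ^ a = 1 at h3
  rw [← QuotientGroup.mk_pow, QuotientGroup.eq_one_iff, Subgroup.mem_subgroupOf] at h3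
  have h4 : ⁅x, g⁆ = x * (g * x * g⁻¹)⁻¹ := by simp only [commutatorElement_def]; group
  rw [h4]
  exact h3

/-- A set of very small tripling is contained in a coset of the subgroup `A ^ 2`. -/
theorem exists_subgroup_eq_sq [Finite L] {A : Set L} {K : ℝ} (hA : A.Nonempty) (hinv : A⁻¹ = A)
    (h : ((A ^ 3).ncard : ℝ) ≤ K * A.ncard) (hK : K < 3 / 2) :
    ∃ H : Subgroup L, (H : Set L) = A ^ 2 := by
  classical
  set F : Finset L := (Set.toFinite A).toFinset with hF
  have hFA : (F : Set L) = A := (Set.toFinite A).coe_toFinset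
  have hApos : (0 : ℝ) < A.ncard := by
    exact_mod_cast (Set.ncard_pos (Set.toFinite _)).2 hA
  obtain ⟨a, ha⟩ := hA
  have hle : (A ^ 2).ncard ≤ (A ^ 3).ncard := by
    rw [← Set.ncard_image_of_injective (A ^ 2) (mul_left_injective a)]
    refine Set.ncard_le_ncard ?_ (Set.toFinite _)
    rintro _ ⟨x, hx, rfl⟩
    rw [pow_succ A 2]
    exact Set.mul_mem_mul hx ha
  have hlt : (((F * F).card : ℕ) : ℝ) < (3 / 2) * F.card := by
    rw [← Set.ncard_coe_finset, ← Set.ncard_coe_finset, Finset.coe_mul, hFA, ← sq]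
    calc ((A ^ 2).ncard : ℝ) ≤ (A ^ 3).ncard := by exact_mod_cast hle
      _ ≤ K * A.ncard := h
      _ < 3 / 2 * A.ncard := by gcongr
  have hlt' : ((F * F).card : ℚ) < (3 / 2 : ℚ) * F.card := by
    have : (((F * F).card : ℚ) : ℝ) < ((3 / 2 : ℚ) * F.card : ℚ) := by push_cast; exact hlt
    exact_mod_cast this
  refine ⟨Finset.invMulSubgroup F hlt', ?_⟩
  rw [Finset.invMulSubgroup_eq_inv_mul, Finset.coe_inv, hFA, hinv, sq]

end Sections

section Reduction

variable {L : Type u} [Group L] [Finite L]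

/-- The case of very small tripling: a subgroup close to `A` does the job. -/
theorem exists_subgroup_of_lt_three_halves {A : Set L} {K : ℝ} (hA : A.Nonempty)
    (hinv : A⁻¹ = A) (h : ((A ^ 3).ncard : ℝ) ≤ K * A.ncard) (hK : K < 3 / 2)
    {Γ P : Subgroup L}
    (hΓ : (Γ.subgroupOf (Subgroup.closure A)).Normal) (hPΓ : P ≤ Γ) (hP : (P : Set L) ⊆ A ^ 6)
    (n m : ℕ) : ∃ Δ : Subgroup L, P ≤ Δ ∧ Δ ≤ Γ ∧ (Δ.subgroupOf (Subgroup.closure A)).Normal ∧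
      cosetCount A Δ ≤ cosetCount A Γ ∧
      (lowerCentralTerm n Δ : Set L) ⊆ A ^ (2 * m + 6) := by
  obtain ⟨H, hH⟩ := exists_subgroup_eq_sq hA hinv h hK
  have hpow : ∀ j : ℕ, 1 ≤ j → A ^ (2 * j) = H := fun j hj => by
    rw [pow_mul, ← hH]; exact coe_set_pow (by lia) H
  have hinvA : ∀ a ∈ A, a⁻¹ ∈ A := fun a ha => by
    rw [← hinv]; exact Set.inv_mem_inv.2 ha
  have hconj : ∀ a ∈ A, ∀ x ∈ H, a * x * a⁻¹ ∈ H := by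
    intro a ha x hx
    rw [← SetLike.mem_coe, ← hpow 2 one_le_two]
    have hx' : x ∈ A ^ 2 := by rw [← hH]; exact hx
    rw [show 2 * 2 = 1 + 2 + 1 from rfl, pow_add, pow_add, pow_one]
    exact Set.mul_mem_mul (Set.mul_mem_mul ha hx') (hinvA a ha)
  have hHG : H ≤ Subgroup.closure A := by
    intro x hx
    have hx' : x ∈ A ^ 2 := by rw [← hH]; exact hx
    rw [sq] at hx'
    obtain ⟨a, ha, b, hb, rfl⟩ := hx'
    exact mul_mem (Subgroup.subset_closure ha) (Subgroup.subset_closure hb)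
  have hHn : (H.subgroupOf (Subgroup.closure A)).Normal := by
    rw [Subgroup.normal_subgroupOf_iff_le_normalizer hHG, Subgroup.closure_le]
    intro a ha
    rw [SetLike.mem_coe, Subgroup.mem_normalizer_iff]
    refine fun x => ⟨hconj a ha x, fun hx => ?_⟩
    have := hconj a⁻¹ (hinvA a ha) _ hx
    simpa [mul_assoc] using this
  -- All positive even powers of `A` equal `H`; in particular `P ⊆ A ^ 6 = H`, and `A` lies in a
  -- single coset of `H`.
  refine ⟨Γ ⊓ H, le_inf hPΓ fun x hx => ?_, inf_le_left, ?_, ?_, ?_⟩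
  · rw [← SetLike.mem_coe, ← hpow 3 (by lia)]
    exact hP hx
  · rw [show (Γ ⊓ H).subgroupOf (Subgroup.closure A) = Γ.subgroupOf (Subgroup.closure A) ⊓
      H.subgroupOf (Subgroup.closure A) from Subgroup.comap_inf _ _ _]
    infer_instance
  · refine (cosetCount_inf_le A Γ H).trans ?_
    have h1 : cosetCount (A⁻¹ * A ∩ Γ) H ≤ 1 := by
      refine (Set.ncard_le_one (Set.toFinite _)).2 ?_
      rintro _ ⟨x, hx, rfl⟩ _ ⟨y, hy, rfl⟩
      rw [hinv, ← sq, ← hH] at hx hy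
      exact QuotientGroup.eq.2 (H.mul_mem (H.inv_mem hx.1) hy.1)
    exact (Nat.mul_le_mul_left _ h1).trans (mul_one _).le
  · refine (SetLike.coe_subset_coe.2 ((Subgroup.lowerCentralSeries_le_self _ _).trans
      inf_le_right)).trans ?_
    rw [show 2 * m + 6 = 2 * (m + 3) by ring, hpow _ (by lia)]

end Reduction

variable {n : ℕ} {F : Type u} [Field F]

/-- An upper triangular form of a trigonalizable subgroup. -/
theorem IsTrigonalizable.exists_hom {B : Subgroup (GL (Fin n) F)} (h : IsTrigonalizable B)
    (p : ℕ) [CharP F p] : ∃ (E : Type u) (_ : Field E) (_ : CharP E p) (ρ : B →* GL (Fin n) E),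
      Function.Injective ρ ∧ ∀ b, ρ b ∈ borelSubgroup n E := by
  obtain ⟨E, _, _, g, hg⟩ := h
  refine ⟨E, inferInstance, charP_of_injective_algebraMap (algebraMap F E).injective p,
    ((MulAut.conj g).toMonoidHom.comp (Matrix.GeneralLinearGroup.map (algebraMap F E))).comp
      B.subtype, ?_, fun b => hg ⟨_, ⟨b, b.2, rfl⟩, rfl⟩⟩
  refine ((MulAut.conj g).injective.comp ?_).comp B.subtype_injective
  intro x y hxy
  apply Units.ext
  ext i j
  have h1 := congrArg (fun z : GL (Fin n) E => (z : Matrix (Fin n) (Fin n) E) i j) hxy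
  exact (algebraMap F E).injective h1

theorem Subgroup.image_val_preimage {L : Type*} [Group L] {G : Subgroup L} {A : Set L}
    (hA : A ⊆ G) : G.subtype '' (Subtype.val ⁻¹' A : Set G) = A :=
  Set.Subset.antisymm (Set.image_subset_iff.2 le_rfl) fun a ha => ⟨⟨a, hA ha⟩, ha, rfl⟩

theorem cosetCount_image_le {L Q : Type*} [Group L] [Group Q] [Finite L] {G : Subgroup L}
    (π : G →* Q) {A : Set L} {Γ : Subgroup L} {Δ : Subgroup Q}
    (h : ∀ x : G, (x : L) ∈ Γ → π x ∈ Δ) :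
    cosetCount (π '' (Subtype.val ⁻¹' A)) Δ ≤ cosetCount A Γ := by
  unfold cosetCount
  rw [Set.image_image]
  refine Set.ncard_image_le_of_imp Subtype.val (Set.toFinite _) (fun x hx => hx) ?_
  intro a _ b _ hab
  rw [QuotientGroup.eq] at hab ⊢
  rw [← map_inv, ← map_mul]
  exact h _ hab

theorem cosetCount_le_image {L Q : Type*} [Group L] [Group Q] [Finite Q] {G : Subgroup L}
    (π : G →* Q) {A : Set L} (hA : A ⊆ G) {Δ : Subgroup Q} :
    cosetCount A ((Δ.comap π).map G.subtype) ≤ cosetCount (π '' (Subtype.val ⁻¹' A)) Δ := by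
  unfold cosetCount
  conv_lhs => rw [← Subgroup.image_val_preimage hA, Set.image_image]
  refine Set.ncard_image_le_of_imp π (Set.toFinite _) (fun x hx => ⟨x, hx, rfl⟩) ?_
  intro a _ b _ hab
  rw [QuotientGroup.eq] at hab ⊢
  rw [← map_inv, ← map_mul] at hab
  exact ⟨a⁻¹ * b, hab, rfl⟩

/-! ### The proposition -/

theorem mainTheorem8 (n : ℕ) (hn : 2 ≤ n) (c : ℕ) :
    ∃ C m : ℕ,
      ∀ (F : Type u) [Field F] [Finite F] (p : ℕ) [CharP F p]
        (A : Set (GL (Fin n) F)) (K : ℝ),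
        A.Finite → A.Nonempty → A⁻¹ = A →
        ((A ^ 3).ncard : ℝ) ≤ K * (A.ncard : ℝ) →
        ∀ (G Γ P : Subgroup (GL (Fin n) F)),
          G = Subgroup.closure A →
          Γ ≤ G → (Γ.subgroupOf G).Normal →
          P ≤ Γ → ∀ _ : (P.subgroupOf Γ).Characteristic,
          (cosetCount A Γ : ℝ) ≤ K ^ c →
          Group.IsSolvable (SectionOf Γ P) →
          (P : Set (GL (Fin n) F)) ⊆ A ^ 6 →
          (∃ B : Subgroup (GL (Fin n) F), B ≤ Γ ∧ IsTrigonalizable B ∧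
            sectionTrace (B : Set (GL (Fin n) F)) Γ P = Set.univ) →
          ActsTriviallyMod G Γ P (pCore p (SectionOf Γ P)) →
          ∃ Δ : Subgroup (GL (Fin n) F),
            P ≤ Δ ∧ Δ ≤ Γ ∧ (Δ.subgroupOf G).Normal ∧
            (cosetCount A Δ : ℝ) ≤ K ^ C ∧
            (lowerCentralTerm n Δ : Set (GL (Fin n) F)) ⊆ A ^ m := by
  obtain ⟨C, m, hmain⟩ := TorusData.exists_normal_subgroup.{u} (n - 1) (n ^ 2) c (by lia)
  -- The growth constant in `G / P` is `K ^ 6`, from `K ^ 2` for `A ^ 2` cubed by the projection;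
  -- the summand `c` serves the case `K < 3 / 2`. Lifting from `G / P` adds an error in `P ⊆ A ^ 6`.
  refine ⟨6 * C + c, 2 * m + 6, ?_⟩
  intro F _ _ p _ A K _ hAne hinv htrip G Γ P hG hΓG hΓn hPΓ hchar hcount _ hPA hB hact
  have hfin : Finite (GL (Fin n) F) := Finite.of_injective _ Units.val_injective
  have hK1 : 1 ≤ K := by
    have hpos : (0 : ℝ) < A.ncard := by
      exact_mod_cast (Set.ncard_pos (Set.toFinite _)).2 hAne
    have hK0 : 0 ≤ K := nonneg_of_mul_nonneg_left ((Nat.cast_nonneg _).trans htrip) hpos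
    exact (one_le_sq_iff₀ hK0).1 (SmallGrowth.of_tripling hAne hinv htrip).one_le
  -- For `K ≥ 3 / 2` the constant `K ^ 6` is at least `2`, as absorbing numerical factors requires.
  rcases lt_or_ge K (3 / 2) with hK | hK
  · subst hG
    obtain ⟨Δ, h1, h2, h3, h4, h5⟩ :=
      exists_subgroup_of_lt_three_halves hAne hinv htrip hK hΓn hPΓ hPA n m
    refine ⟨Δ, h1, h2, h3, ?_, h5⟩
    calc (cosetCount A Δ : ℝ) ≤ cosetCount A Γ := by exact_mod_cast h4
      _ ≤ K ^ c := hcount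
      _ ≤ K ^ (6 * C + c) := pow_le_pow_right₀ hK1 (Nat.le_add_left _ _)
  have hp : p.Prime := CharP.char_is_prime F p
  have hAG : A ⊆ G := by rw [hG]; exact Subgroup.subset_closure
  have hΓconj : ∀ g ∈ G, ∀ x ∈ Γ, g * x * g⁻¹ ∈ Γ := fun g hg x hx =>
    hΓn.conj_mem ⟨x, hΓG hx⟩ hx ⟨g, hg⟩
  have hPconj := conj_mem_of_characteristic hΓconj hPΓ
  have hPn : (P.subgroupOf G).Normal := ⟨fun x hx g => hPconj g g.2 x hx⟩
  set π := QuotientGroup.mk' (P.subgroupOf G) with hπ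
  have hker : ∀ x : G, π x = 1 ↔ (x : GL (Fin n) F) ∈ P := fun x => by
    rw [← MonoidHom.mem_ker, QuotientGroup.ker_mk', Subgroup.mem_subgroupOf]
  have hπeq : ∀ x y : G, π x = π y ↔ (x : GL (Fin n) F)⁻¹ * y ∈ P := fun x y => by
    rw [← inv_mul_eq_one, ← map_inv, ← map_mul, hker]; rfl
  obtain ⟨B, hBΓ, hBtrig, hBsurj⟩ := hB
  obtain ⟨E, _, _, ρ, hρinj, hρ⟩ := hBtrig.exists_hom p
  -- By (iv) the range of `ψ` is `Γ / P`, so the triangular structure of `B` is transported there,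
  -- although `Γ` itself need not be trigonalizable.
  set ψ : B →* G ⧸ P.subgroupOf G := π.comp (Subgroup.inclusion (hBΓ.trans hΓG)) with hψ
  have hrange : ∀ x : G, π x ∈ ψ.range ↔ (x : GL (Fin n) F) ∈ Γ := by
    intro x
    constructor
    · rintro ⟨b, hb⟩
      have h1 := (hπeq _ _).1 hb
      have h2 := Γ.mul_mem (hBΓ b.2) (hPΓ h1)
      simpa using h2
    · intro hx
      have h1 : (QuotientGroup.mk (⟨x, hx⟩ : Γ) : SectionOf Γ P) ∈
          sectionTrace (B : Set (GL (Fin n) F)) Γ P := by rw [hBsurj]; trivial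
      obtain ⟨b, hb, hbx⟩ := h1
      refine ⟨⟨b, hb⟩, (hπeq _ _).2 ?_⟩
      have h2 := QuotientGroup.eq.1 (show (QuotientGroup.mk b : SectionOf Γ P) =
        QuotientGroup.mk (⟨x, hx⟩ : Γ) from hbx)
      exact h2
  set A' : Set G := Subtype.val ⁻¹' A with hA'
  have hA'im : ∀ j, (A' ^ j).ncard = (A ^ j).ncard := fun j => by
    rw [← Set.ncard_image_of_injective (A' ^ j) G.subtype_injective, Set.image_pow,
      Subgroup.image_val_preimage hAG]
  have hA'inv : A'⁻¹ = A' := by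
    ext x
    rw [Set.mem_inv, hA', Set.mem_preimage, Set.mem_preimage, ← hinv, Set.mem_inv]
    simp [hinv]
  have hA'ne : A'.Nonempty := by
    obtain ⟨a, ha⟩ := hAne
    exact ⟨⟨a, hAG ha⟩, ha⟩
  have hgrowth : SmallGrowth ((π '' A') ^ 2) (K ^ 6) := by
    have h1 := (SmallGrowth.of_tripling (K := K) hA'ne hA'inv (by
      rw [hA'im, ← pow_one A', hA'im, pow_one]; exact htrip)).image π
    rwa [Set.image_pow, ← pow_mul] at h1
  have hclosure : Subgroup.closure (π '' A') = ⊤ := by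
    rw [← MonoidHom.map_closure, hA']
    have h1 : Subgroup.closure (Subtype.val ⁻¹' A : Set G) = ⊤ := by
      subst hG
      exact Subgroup.closure_closure_coe_preimage
    rw [h1, ← MonoidHom.range_eq_map, QuotientGroup.range_mk']
  have hsurj : Function.Surjective π := QuotientGroup.mk'_surjective _
  have hrangeN : ψ.range.Normal := by
    refine ⟨fun d hd g => ?_⟩
    obtain ⟨x, rfl⟩ := hsurj d
    obtain ⟨y, rfl⟩ := hsurj g
    rw [← map_inv, ← map_mul, ← map_mul, hrange]
    exact hΓconj y y.2 x ((hrange x).1 hd)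
  have hdata := torusData_of_upperTriangular (ρ := ρ) (hρ := hρ) hp hn hρinj ψ hclosure
    (by rw [← Set.image_inv, hA'inv]) hgrowth
    (by
      calc (2 : ℝ) ≤ (3 / 2) ^ 6 := by norm_num
        _ ≤ K ^ 6 := by gcongr)
    hrangeN
    (by
      intro d hd g
      obtain ⟨x, rfl⟩ := hsurj d
      obtain ⟨y, rfl⟩ := hsurj g
      obtain ⟨a, ha⟩ := exists_commutator_pow_mem hΓconj hact y.2 ((hrange x).1 hd)
      refine ⟨a, ?_⟩
      rw [← map_commutatorElement, ← map_pow, hker]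
      exact ha)
  obtain ⟨Δ, hΔle, hΔn, hΔcount, hΔ⟩ := hmain hdata (by
    calc (cosetCount (π '' A') ψ.range : ℝ) ≤ cosetCount A Γ := by
          exact_mod_cast cosetCount_image_le π fun x hx => (hrange x).2 hx
      _ ≤ K ^ c := hcount
      _ ≤ (K ^ 6) ^ c := by gcongr; exact le_self_pow₀ hK1 (by lia))
  refine ⟨(Δ.comap π).map G.subtype, ?_, ?_, ?_, ?_, ?_⟩
  · intro x hx
    refine ⟨⟨x, hΓG (hPΓ hx)⟩, ?_, rfl⟩
    rw [SetLike.mem_coe, Subgroup.mem_comap, (hker _).2 hx]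
    exact Δ.one_mem
  · rintro _ ⟨x, hx, rfl⟩
    exact (hrange x).1 (hΔle hx)
  · rw [Subgroup.subgroupOf, Subgroup.comap_map_eq_self_of_injective G.subtype_injective]
    infer_instance
  · calc (cosetCount A ((Δ.comap π).map G.subtype) : ℝ) ≤ cosetCount (π '' A') Δ := by
          exact_mod_cast cosetCount_le_image π hAG
      _ ≤ (K ^ 6) ^ C := hΔcount
      _ = K ^ (6 * C) := (pow_mul _ _ _).symm
      _ ≤ K ^ (6 * C + c) := pow_le_pow_right₀ hK1 (Nat.le_add_right _ _)
  · intro x hx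
    rw [SetLike.mem_coe, lowerCentralTerm, ← Subgroup.map_lowerCentralSeries] at hx
    obtain ⟨y, hy, rfl⟩ := hx
    have h1 : π y ∈ Δ.lowerCentralSeries (n - 1) := by
      have h2 := Subgroup.mem_map_of_mem π hy
      rw [Subgroup.map_lowerCentralSeries, Subgroup.map_comap_eq_self_of_surjective hsurj] at h2
      exact h2
    have h3 := hΔ h1
    rw [← Set.image_pow, ← Set.image_pow] at h3
    obtain ⟨a, ha, hay⟩ := h3
    have h4 := hPA ((hπeq a y).1 hay)
    have h5 : (a : GL (Fin n) F) ∈ A ^ (2 * m) := by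
      have h6 := Set.mem_image_of_mem G.subtype ha
      rw [Set.image_pow, Set.image_pow, Subgroup.image_val_preimage hAG, ← pow_mul] at h6
      exact h6
    have h7 := Set.mul_mem_mul h5 h4
    rw [← pow_add, mul_inv_cancel_left] at h7
    exact h7
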